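/- Conventions. For a chain complex $C$ of abelian groups let $C\otimes C$ have $d(x\otimes y)=x\otimes dy+(-1)^{q}dx\otimes y$ and $T(x\otimes y)=(-1)^{pq}y\otimes x$ for $x\in C_p$, $y\in C_q$. An element of $(\widehat W^{\%}C)_n$ is a family $\theta=\{\theta_s\in(C\otimes C)_{n+s}\mid s\in\mathbb Z\}$, with $(d\theta)_s=d\theta_s+(-1)^{n+s-1}(\theta_{s-1}+(-1)^sT\theta_{s-1})$, and $(W^{\%}C)_n$ consists of the families indexed by $s\ge 0$, with the same differential ($\theta_{-1}=0$); $J:W^{\%}C\to\widehat W^{\%}C$ is extension by $0$. A complex is $n$-dimensional if it is finitely generated free in degrees $0,\dots,n$ and $0$ in the other degrees. Let $C^{0-*}$ be the dual complex, $(C^{0-*})_{-r}=C^r=\mathrm{Hom}(C_r,\mathbb Z)$, with differential $(-1)^rd^*:C^{-r}\to C^{-r+1}$. A bundle over $C$ is a cycle $\gamma\in(\widehat W^{\%}C^{0-*})_0$, that is a family of bilinear forms $\gamma_s:C_p\times C_q\to\mathbb Z$, $p+q=-s$, and a map of chain bundles $(f,\chi):(C,\gamma)\to(C',\gamma')$ is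 a chain map $f:C\to C'$ with a chain $\chi\in(\widehat W^{\%}C^{0-*})_1$ such that $f^*\gamma'-\gamma=d\chi$. An $n$-dimensional symmetric structure on $(C,\gamma)$ is a pair $(\phi,\theta)$ with $\phi\in(W^{\%}C)_n$, $d\phi=0$, $\theta\in(\widehat W^{\%}C)_{n+1}$ and $J\phi-(\phi_0)^{\%}(S^n\gamma)=d\theta$, where $((\phi_0)^{\%}(S^n\gamma))_s=(\phi_0\otimes\phi_0)(\gamma_{s-n})$. Here chains of $C\otimes C$ of degrees $m$, $k$ are regarded as homomorphisms $x:C^a\to C_{m-a}$, $y:C^b\to C_{k-b}$, and $(x\otimes y)(u\otimes v)=(-1)^{mb}x(u)\otimes y(v)$ for $v\in C^b$. Two such structures are equivalent, $(\phi,\theta)\sim(\phi',\theta')$, if there are $\xi\in(W^{\%}C)_{n+1}$, $\eta\in(\widehat W^{\%}C)_{n+2}$ with $\phi'-\phi=d\xi$ and $\theta'-\theta-J\xi+(\xi_0;\phi_0,\phi_0')^{\%}(S^n\gamma)=d\eta$, where $$\big((g;x,y)^{\%}(S^n\gamma)\big)_s=(x\otimes g)\gamma_{s-n}+(-1)^n(g\otimes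 y)\gamma_{s-n}+(-1)^n(g\otimes g)T\gamma_{s-n-1}.$$ The twisted quadratic group $Q_n(C,\gamma)$ is the group of equivalence classes, with $(\phi,\theta)+(\phi',\theta')=(\phi+\phi',\theta+\theta'+[\phi_0,\phi_0'](S^n\gamma))$, $([x,y](S^n\gamma))_s=-(x\otimes y)T\gamma_{s-n+1}$. If $C$ is not finite-dimensional then all chains of $W^{\%}C$ and $\widehat W^{\%}C$ are required to be supported in finitely many degrees of $C$, so that $Q_n(C,\gamma)$ is the direct limit over the finite skeleta of $C$. A map of chain bundles $(f,\chi)$ induces $(f,\chi)_{\%}(\phi,\theta)=(f^{\%}\phi,\widehat f^{\%}\theta-(f\phi_0)^{\%}(S^n\chi))$. For a chain bundle $(B,\beta)$, an $n$-dimensional $(B,\beta)$-normal complex $(C,\phi,\gamma,\theta,f,\chi)$ is an $n$-dimensional complex $C$ with a bundle $\gamma$, an $n$-dimensional symmetric structure $(\phi,\theta)$ on $(C,\gamma)$ and a map of chain bundles $(f,\chi):(C,\gamma)\to(B,\beta)$. Its characteristic element is $(f,\chi)_{\%}(\phi,\theta)\in Q_n(B,\beta)$. Two of them are cobordant if there are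 an $(n+1)$-dimensional complex $D$ with a bundle $\delta$, a map of chain bundles $(D,\delta)\to(B,\beta)$, maps of chain bundles $a:(C,\gamma)\to(D,\delta)$ and $a':(C',\gamma')\to(D,\delta)$ over $(B,\beta)$, and an equivalence $a_{\%}(\phi,\theta)\sim a'_{\%}(\phi',\theta')$ of symmetric structures on $(D,\delta)$. Let $\widehat L\langle B,\beta\rangle^n(\mathbb Z)$ be the cobordism group, with addition by direct sum (the bundle map on a sum being $f\oplus f'$ followed by the codiagonal, with its standard equivalence). Theorem. Let $B(\infty)$ be the complex with $B(\infty)_r=\mathbb Z$ for $r\ge0$ and $B(\infty)_r=0$ for $r<0$, whose differential $B(\infty)_r\to B(\infty)_{r-1}$ is $2$ for $r$ odd and $0$ for $r$ even. Let $\beta(\infty)$ be the bundle over $B(\infty)$ whose only non-zero components are $\beta(\infty)_{-2k}$ on $B(\infty)_k\times B(\infty)_k$ and $\beta(\infty)_{-2k-1}$ on $B(\infty)_k\times B(\infty)_{k+1}$ and on $B(\infty)_{k+1}\times B(\infty)_k$, for $k\ge0$ even, each of them $(x,y)\mapsto xy$. Then $(B(\infty),\beta(\infty))$ is universal, in the sense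 that its Wu classes $$\widehat v_r:H_r(B(\infty))\to\widehat H^r(\mathbb Z_2;\mathbb Z)=\{a\mid a=(-1)^ra\}/\{b+(-1)^rb\},\qquad x\mapsto\beta(\infty)_{-2r}(x,x),$$ are isomorphisms for all $r\ge0$. For every $n\ge0$ the relation $\sim$ of equivalence of $n$-dimensional symmetric structures on $(B(\infty),\beta(\infty))$ is an additive equivalence relation, so is cobordism of $n$-dimensional $(B(\infty),\beta(\infty))$-normal complexes, the characteristic element defines an isomorphism $$\widehat L\langle B(\infty),\beta(\infty)\rangle^n(\mathbb Z)\;\cong\;Q_n(B(\infty),\beta(\infty)),$$ and $$\widehat L\langle B(\infty),\beta(\infty)\rangle^n(\mathbb Z)\cong Q_n(B(\infty),\beta(\infty))\cong\begin{cases}\mathbb Z_8&n\equiv0\pmod 4\\ \mathbb Z_2&n\equiv1,3\pmod 4\\ 0&n\equiv2\pmod 4.\end{cases}$$ -/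

import Mathlib

open scoped TensorProduct
open CategoryTheory CategoryTheory.Limits

namespace ChainBundles

/-- Chain complexes of abelian groups, graded by `ℤ`, with differential of degree `-1`. -/
abbrev Cx : Type 1 := ChainComplex AddCommGrpCat.{0} ℤ

/-- Multiplication by `(-1)^k`. -/
def sgn {M : Type} [AddCommGroup M] (k : ℤ) : M →+ M :=
  if Even k then AddMonoidHom.id M else -AddMonoidHom.id M

/-- The differential `C_i → C_j` (zero unless `i = j + 1`) as a linear map. -/
abbrev dl (C : Cx) (i j : ℤ) : C.X i →ₗ[ℤ] C.X j := (C.d i j).hom.toIntLinearMap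

/-- A chain map in degree `p` as a linear map. -/
abbrev fl {C D : Cx} (f : C ⟶ D) (p : ℤ) : C.X p →ₗ[ℤ] D.X p := (f.f p).hom.toIntLinearMap

/-- `C` is `n`-dimensional: finitely generated projective in degrees `0, …, n`, and zero in all
other degrees. -/
def IsDim (n : ℤ) (C : Cx) : Prop :=
  (∀ p, Module.Finite ℤ (C.X p) ∧ Module.Projective ℤ (C.X p)) ∧
    ∀ p, (p < 0 ∨ n < p) → Subsingleton (C.X p)

/-! ### The complex `C ⊗ C` with its transposition involution -/

/-- Families of components `x p q ∈ C_p ⊗ C_q`. A chain of `C ⊗ C` of degree `m` is such a family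
supported on finitely many `(p, q)` with `p + q = m`. -/
abbrev Tens (C : Cx) : Type := ∀ p q : ℤ, C.X p ⊗[ℤ] C.X q

/-- `d (x ⊗ y) = x ⊗ d y + (-1)^q d x ⊗ y` for `y ∈ C_q`. -/
noncomputable def dT (C : Cx) : Tens C →+ Tens C where
  toFun x p q := (dl C (q + 1) q).lTensor (C.X p) (x p (q + 1)) +
    sgn q ((dl C (p + 1) p).rTensor (C.X q) (x (p + 1) q))
  map_zero' := by ext p q; simp
  map_add' x y := by ext p q; simp only [Pi.add_apply, map_add]; abel

/-- `T (x ⊗ y) = (-1)^(pq) y ⊗ x` for `x ∈ C_p`, `y ∈ C_q`. -/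
noncomputable def trT (C : Cx) : Tens C →+ Tens C where
  toFun x p q := sgn (p * q) (TensorProduct.comm ℤ (C.X q) (C.X p) (x q p))
  map_zero' := by ext p q; simp
  map_add' x y := by ext p q; simp

/-- `f ⊗ g` for chain maps (of degree zero). -/
noncomputable def pushT {C D : Cx} (f : C ⟶ D) : Tens C →+ Tens D where
  toFun x p q := TensorProduct.map (fl f p) (fl f q) (x p q)
  map_zero' := by ext p q; simp
  map_add' x y := by ext p q; simp

/-! ### The complex dual to `C ⊗ C`, written as bilinear forms -/

/-- Families of bilinear forms `C_p × C_q → ℤ`, i.e. of elements of `C^p ⊗ C^q` when `C` is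
finitely generated projective in each degree. In `C^{0-*} ⊗ C^{0-*}` the component `(p, q)` has
degree `-(p + q)`. -/
abbrev Form (C : Cx) : Type := ∀ p q : ℤ, C.X p →ₗ[ℤ] C.X q →ₗ[ℤ] ℤ

/-- The differential of `C^{0-*} ⊗ C^{0-*}`, where `d = (-1)^r d^* : C^{-r} → C^{-r+1}` on
`C^{0-*}`. -/
noncomputable def dF (C : Cx) : Form C →+ Form C where
  toFun g p q := sgn (q - 1) ((g p (q - 1)).compl₂ (dl C q (q - 1))) +
    sgn (p + q - 1) ((g (p - 1) q).comp (dl C p (p - 1)))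
  map_zero' := by
    funext p q
    have h : (0 : C.X p →ₗ[ℤ] C.X (q - 1) →ₗ[ℤ] ℤ).compl₂ (dl C q (q - 1)) = 0 := by ext; simp
    simp [h]
  map_add' g h := by
    funext p q
    have e : (g p (q - 1) + h p (q - 1)).compl₂ (dl C q (q - 1)) =
        (g p (q - 1)).compl₂ (dl C q (q - 1)) + (h p (q - 1)).compl₂ (dl C q (q - 1)) := by
      ext; simp
    simp only [Pi.add_apply, e, LinearMap.add_comp, map_add]
    abel

/-- The transposition involution on `C^{0-*} ⊗ C^{0-*}`. -/
noncomputable def trF (C : Cx) : Form C →+ Form C where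
  toFun g p q := sgn (p * q) (g q p).flip
  map_zero' := by
    funext p q
    exact map_zero (sgn (p * q))
  map_add' g h := by
    funext p q
    exact map_add (sgn (p * q)) (g q p).flip (h q p).flip

/-- The pullback `(x, y) ↦ g (u x, v y)` along two chain maps. -/
noncomputable def pullF {C D : Cx} (u v : C ⟶ D) : Form D →+ Form C where
  toFun g p q := (g p q).compl₁₂ (fl u p) (fl v q)
  map_zero' := by ext p q x y; simp
  map_add' g h := by ext p q x y; simp

/-! ### Hypercochains -/

/-- The differential of `Hom_{ℤ[ℤ/2]}(Ŵ, M)` on chains of degree `n`, for a complex `M` with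
differential `d` and involution `T`:
`(dθ)_s = d θ_s + (-1)^(n+s-1) (θ_{s-1} + (-1)^s T θ_{s-1})`. -/
def tateD {M : Type} [AddCommGroup M] (d T : M →+ M) (n : ℤ) : (ℤ → M) →+ (ℤ → M) where
  toFun θ s := d (θ s) + sgn (n + s - 1) (θ (s - 1) + sgn s (T (θ (s - 1))))
  map_zero' := by ext s; simp
  map_add' θ η := by
    ext s
    simp only [Pi.add_apply, map_add]
    abel

/-- The group `(Ŵ^% C)_n` of families `θ_s ∈ (C ⊗ C)_{n+s}`, `s ∈ ℤ`. If `C` is not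
finite-dimensional, a chain is required to live on a finite-dimensional part of `C`. -/
def hyperChains (C : Cx) (n : ℤ) : AddSubgroup (ℤ → Tens C) where
  carrier := {θ | (∀ s p q, p + q ≠ n + s → θ s p q = 0) ∧
    ∃ N : ℤ, ∀ s p q, N < |p| ∨ N < |q| → θ s p q = 0}
  zero_mem' := ⟨fun _ _ _ _ => rfl, 0, fun _ _ _ _ => rfl⟩
  add_mem' := by
    rintro a b ⟨ha, N, hN⟩ ⟨hb, M, hM⟩
    refine ⟨fun s p q h => by simp [ha s p q h, hb s p q h], max N M, fun s p q h => ?_⟩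
    simp only [max_lt_iff] at h
    simp [hN s p q (h.imp And.left And.left), hM s p q (h.imp And.right And.right)]
  neg_mem' := by
    rintro a ⟨ha, N, hN⟩
    exact ⟨fun s p q h => by simp [ha s p q h], N, fun s p q h => by simp [hN s p q h]⟩

/-- The group `(W^% C)_n` of families `φ_s ∈ (C ⊗ C)_{n+s}`, `s ≥ 0`, extended by `φ_s = 0` for
`s < 0`. With this convention `J` is the inclusion of a subcomplex. -/
def symChains (C : Cx) (n : ℤ) : AddSubgroup (ℤ → Tens C) where
  carrier := {φ | φ ∈ hyperChains C n ∧ ∀ s < 0, φ s = 0}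
  zero_mem' := ⟨zero_mem _, fun _ _ => rfl⟩
  add_mem' := fun ha hb =>
    ⟨add_mem ha.1 hb.1, fun s hs => by simp [ha.2 s hs, hb.2 s hs]⟩
  neg_mem' := fun ha => ⟨neg_mem ha.1, fun s hs => by simp [ha.2 s hs]⟩

/-- The differential of `Ŵ^% C`, and of its subcomplex `W^% C`, on chains of degree `n`. -/
noncomputable def dW (C : Cx) (n : ℤ) : (ℤ → Tens C) →+ (ℤ → Tens C) :=
  tateD (dT C) (trT C) n

/-- The chain map `f^%` (and `f̂^%`) induced by a chain map `f`. -/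
noncomputable def pushW {C D : Cx} (f : C ⟶ D) : (ℤ → Tens C) →+ (ℤ → Tens D) where
  toFun θ s := pushT f (θ s)
  map_zero' := by ext s; simp
  map_add' θ η := by ext s; simp

/-- The group `(Ŵ^% C^{0-*})_n` of families `γ_s ∈ (C^{0-*} ⊗ C^{0-*})_{n+s}`, `s ∈ ℤ`. -/
def formChains (C : Cx) (n : ℤ) : AddSubgroup (ℤ → Form C) where
  carrier := {γ | ∀ s p q, p + q ≠ -(n + s) → γ s p q = 0}
  zero_mem' := fun _ _ _ _ => rfl
  add_mem' := fun ha hb s p q h => by simp [ha s p q h, hb s p q h]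
  neg_mem' := fun ha s p q h => by simp [ha s p q h]

/-- The differential of `Ŵ^% C^{0-*}` on chains of degree `n`. -/
noncomputable def dWF (C : Cx) (n : ℤ) : (ℤ → Form C) →+ (ℤ → Form C) :=
  tateD (dF C) (trF C) n

/-- The map `f^* : Ŵ^% D^{0-*} → Ŵ^% C^{0-*}` induced by a chain map `f : C → D`. -/
noncomputable def pullW {C D : Cx} (f : C ⟶ D) : (ℤ → Form D) →+ (ℤ → Form C) where
  toFun γ s := pullF f f (γ s)
  map_zero' := by ext s; simp
  map_add' θ η := by ext s; simp

/-! ### Chain bundles -/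

/-- A bundle over `C`: a cycle `γ ∈ (Ŵ^% C^{0-*})_0`. -/
structure Bundle (C : Cx) where
  /-- the family `γ_s` -/
  form : ℤ → Form C
  mem : form ∈ formChains C 0
  cycle : dWF C 0 form = 0

/-- A map of chain bundles `(f, χ) : (C, γ) → (C', γ')`: a chain map `f` and an equivalence
`χ : γ → f^* γ'`, i.e. a chain `χ ∈ (Ŵ^% C^{0-*})_1` with `f^* γ' - γ = dχ`. -/
structure BundleMap {C C' : Cx} (γ : Bundle C) (γ' : Bundle C') where
  /-- the chain map -/
  f : C ⟶ C'
  /-- the equivalence of bundles -/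
  χ : ℤ → Form C
  mem : χ ∈ formChains C 1
  eq : pullW f γ'.form - γ.form = dWF C 1 χ

/-! ### Slant products -/

/-- The contraction `a ⊗ y, b ⊗ z ↦ g (a, b) y ⊗ z`. -/
noncomputable def contr {A B P Q : Type} [AddCommGroup A] [AddCommGroup B] [AddCommGroup P]
    [AddCommGroup Q] (g : A →ₗ[ℤ] B →ₗ[ℤ] ℤ) : A ⊗[ℤ] P →ₗ[ℤ] B ⊗[ℤ] Q →ₗ[ℤ] P ⊗[ℤ] Q :=
  TensorProduct.curry ((TensorProduct.lid ℤ (P ⊗[ℤ] Q)).toLinearMap ∘ₗ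
    (TensorProduct.lift g).rTensor (P ⊗[ℤ] Q) ∘ₗ
    (TensorProduct.tensorTensorTensorComm ℤ A P B Q).toLinearMap)

/-- For chains `x`, `y` of `C ⊗ C` of degrees `m`, `k`, viewed as homomorphisms
`C^a → C_{m-a}`, `C^b → C_{k-b}` of these degrees, this is `(x ⊗ y) g`, with the sign
`(x ⊗ y) (u ⊗ v) = (-1)^(m b) x u ⊗ y v` for `v ∈ C^b`. -/
noncomputable def slant {C : Cx} (m k : ℤ) (x y : Tens C) (g : Form C) : Tens C := fun p q =>
  sgn (m * (k - q)) (contr (g (m - p) (k - q)) (x (m - p) p) (y (k - q) q))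

/-- `(φ₀)^% (S^n γ)`, the image of `γ` under `S^n`, which shifts `s` by `n`, followed by the map
induced by `φ₀ : C^{n-*} → C`. -/
noncomputable def twist {C : Cx} (n : ℤ) (x : Tens C) (γ : ℤ → Form C) : ℤ → Tens C :=
  fun s => slant n n x x (γ (s - n))

/-- The chain `[x, y] (S^n γ)`, with boundary
`x^% (S^n γ) + y^% (S^n γ) - (x + y)^% (S^n γ)` for cycles `x`, `y` of degree `n`. -/
noncomputable def bracket {C : Cx} (n : ℤ) (x y : Tens C) (γ : ℤ → Form C) : ℤ → Tens C :=
  fun s => -slant n n x y (trF C (γ (s - n + 1)))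

/-- The chain `(g; x, y)^% (S^n γ)`, with boundary `y^% (S^n γ) - x^% (S^n γ)` for cycles `x`, `y`
of degree `n` and `g` of degree `n + 1` with `d g = y - x`. -/
noncomputable def twistHomotopy {C : Cx} (n : ℤ) (g x y : Tens C) (γ : ℤ → Form C) :
    ℤ → Tens C := fun s =>
  slant n (n + 1) x g (γ (s - n)) + sgn n (slant (n + 1) n g y (γ (s - n))) +
    sgn n (slant (n + 1) (n + 1) g g (trF C (γ (s - n - 1))))

/-! ### Elementary identities -/

section identities

variable {M N : Type} [AddCommGroup M] [AddCommGroup N]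

theorem sgn_even {k : ℤ} (h : Even k) (x : M) : sgn k x = x := by simp [sgn, h]

theorem sgn_odd {k : ℤ} (h : ¬ Even k) (x : M) : sgn k x = -x := by simp [sgn, h]

theorem map_sgn {F : Type} [FunLike F M N] [AddMonoidHomClass F M N] (f : F) (k : ℤ) (x : M) :
    f (sgn k x) = sgn k (f x) := by
  by_cases h : Even k <;> simp [sgn, h]

theorem sgn_add (a b : ℤ) (x : M) : sgn (a + b) x = sgn a (sgn b x) := by
  by_cases ha : Even a <;> by_cases hb : Even b <;> simp [sgn, ha, hb, Int.even_add]

theorem sgn_congr {a b : ℤ} (h : Even (a - b)) (x : M) : sgn a x = sgn b x := by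
  rw [Int.even_sub] at h
  by_cases hb : Even b
  · rw [sgn_even hb, sgn_even (h.2 hb)]
  · rw [sgn_odd hb, sgn_odd (fun ha => hb (h.1 ha))]

theorem neg_sgn (k : ℤ) (x : M) : -sgn k x = sgn (1 + k) x := by
  rw [sgn_add, sgn_odd (k := 1) (by decide)]

theorem sgn_lin₂ {A B : Type} [AddCommGroup A] [AddCommGroup B] (k : ℤ)
    (g : A →ₗ[ℤ] B →ₗ[ℤ] ℤ) (a : A) (b : B) : sgn k g a b = sgn k (g a b) := by
  by_cases h : Even k <;> simp [sgn, h]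

theorem sgn_mul_right (k a b : ℤ) : sgn k a * b = sgn k (a * b) := by
  by_cases h : Even k <;> simp [sgn, h]

variable {A B P Q A' B' P' Q' : Type} [AddCommGroup A] [AddCommGroup B] [AddCommGroup P]
  [AddCommGroup Q] [AddCommGroup A'] [AddCommGroup B'] [AddCommGroup P'] [AddCommGroup Q']

@[simp] theorem contr_tmul (g : A →ₗ[ℤ] B →ₗ[ℤ] ℤ) (a : A) (b : B) (y : P) (z : Q) :
    contr g (a ⊗ₜ y) (b ⊗ₜ z) = g a b • (y ⊗ₜ z) := rfl

theorem contr_map (u : A →ₗ[ℤ] A') (v : B →ₗ[ℤ] B') (k : P →ₗ[ℤ] P') (l : Q →ₗ[ℤ] Q')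
    (g : A' →ₗ[ℤ] B' →ₗ[ℤ] ℤ) (x : A ⊗[ℤ] P) (y : B ⊗[ℤ] Q) :
    contr g (TensorProduct.map u k x) (TensorProduct.map v l y) =
      TensorProduct.map k l (contr (g.compl₁₂ u v) x y) := by
  induction x with
  | zero => simp
  | add x x' hx hx' => simp only [map_add, LinearMap.add_apply, hx, hx']
  | tmul a p =>
    induction y with
    | zero => simp
    | add y y' hy hy' => simp only [map_add, hy, hy']
    | tmul b q => simp

theorem contr_add (g h : A →ₗ[ℤ] B →ₗ[ℤ] ℤ) (x : A ⊗[ℤ] P) (y : B ⊗[ℤ] Q) :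
    contr (g + h) x y = contr g x y + contr h x y := by
  induction x with
  | zero => simp
  | add x x' hx hx' => simp only [map_add, LinearMap.add_apply, hx, hx']; abel
  | tmul a p =>
    induction y with
    | zero => simp
    | add y y' hy hy' => simp only [map_add, hy, hy']; abel
    | tmul b q => simp [add_smul]

theorem contr_zero (x : A ⊗[ℤ] P) (y : B ⊗[ℤ] Q) :
    contr (0 : A →ₗ[ℤ] B →ₗ[ℤ] ℤ) x y = 0 := by
  have h := contr_add (0 : A →ₗ[ℤ] B →ₗ[ℤ] ℤ) 0 x y
  simpa using h

theorem contr_sgn (k : ℤ) (g : A →ₗ[ℤ] B →ₗ[ℤ] ℤ) (x : A ⊗[ℤ] P) (y : B ⊗[ℤ] Q) :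
    contr (sgn k g) x y = sgn k (contr g x y) := by
  by_cases h : Even k
  · rw [sgn_even h, sgn_even h]
  · rw [sgn_odd h, sgn_odd h, eq_neg_iff_add_eq_zero, ← contr_add]
    simp [contr_zero]

theorem contr_sgn_left (k : ℤ) (g : A →ₗ[ℤ] B →ₗ[ℤ] ℤ) (x : A ⊗[ℤ] P) (y : B ⊗[ℤ] Q) :
    contr g (sgn k x) y = sgn k (contr g x y) := by
  by_cases h : Even k <;> simp [sgn, h]

theorem contr_sgn_right (k : ℤ) (g : A →ₗ[ℤ] B →ₗ[ℤ] ℤ) (x : A ⊗[ℤ] P) (y : B ⊗[ℤ] Q) :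
    contr g x (sgn k y) = sgn k (contr g x y) := by
  by_cases h : Even k <;> simp [sgn, h]

theorem comm_contr (g : A →ₗ[ℤ] B →ₗ[ℤ] ℤ) (x : A ⊗[ℤ] P) (y : B ⊗[ℤ] Q) :
    TensorProduct.comm ℤ P Q (contr g x y) = contr g.flip y x := by
  induction x with
  | zero => simp
  | add x x' hx hx' => simp only [map_add, LinearMap.add_apply, hx, hx']
  | tmul a p =>
    induction y with
    | zero => simp
    | add y y' hy hy' => simp only [map_add, LinearMap.add_apply, hy, hy']
    | tmul b q => simp

end identities

section slant

variable {C D : Cx}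

theorem slant_add_left (m k : ℤ) (x x' y : Tens C) (g : Form C) :
    slant m k (x + x') y g = slant m k x y g + slant m k x' y g := by
  funext p q; simp [slant]

theorem slant_add_right (m k : ℤ) (x y y' : Tens C) (g : Form C) :
    slant m k x (y + y') g = slant m k x y g + slant m k x y' g := by
  funext p q; simp [slant]

theorem slant_add (m k : ℤ) (x y : Tens C) (g h : Form C) :
    slant m k x y (g + h) = slant m k x y g + slant m k x y h := by
  funext p q; simp [slant, contr_add]

theorem slant_zero (m k : ℤ) (x y : Tens C) : slant m k x y (0 : Form C) = 0 := by
  funext p q; simp [slant, contr_zero]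

theorem slant_sgn (m k j : ℤ) (x y : Tens C) (g : Form C) :
    slant m k x y (sgn j g) = sgn j (slant m k x y g) := by
  by_cases h : Even j
  · rw [sgn_even h, sgn_even h]
  · rw [sgn_odd h, sgn_odd h, eq_neg_iff_add_eq_zero, ← slant_add]
    simp [slant_zero]

theorem sgn_apply₂ (k : ℤ) (x : Tens C) (p q : ℤ) : sgn k x p q = sgn k (x p q) := by
  by_cases h : Even k <;> simp [sgn, h]

theorem sgn_form (k : ℤ) (g : Form C) (p q : ℤ) : sgn k g p q = sgn k (g p q) := by
  by_cases h : Even k <;> simp [sgn, h]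

theorem slant_neg (m k : ℤ) (x y : Tens C) (g : Form C) :
    slant m k x y (-g) = -slant m k x y g := by
  rw [eq_neg_iff_add_eq_zero, ← slant_add]
  simp [slant_zero]

theorem trT_slant (n : ℤ) (x y : Tens C) (g : Form C) :
    trT C (slant n n x y g) = sgn n (slant n n y x (trF C g)) := by
  funext p q
  rw [sgn_apply₂]
  change sgn (p * q) (TensorProduct.comm ℤ (C.X q) (C.X p)
    (sgn (n * (n - p)) (contr (g (n - q) (n - p)) (x (n - q) q) (y (n - p) p)))) =
    sgn n (sgn (n * (n - q)) (contr (sgn ((n - p) * (n - q)) (g (n - q) (n - p)).flip)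
      (y (n - p) p) (x (n - q) q)))
  rw [map_sgn, comm_contr, contr_sgn, ← sgn_add, ← sgn_add, ← sgn_add]
  apply sgn_congr
  by_cases hn : Even n <;> by_cases hp : Even p <;> by_cases hq : Even q <;>
    simp [Int.even_add, Int.even_sub, Int.even_mul, hn, hp, hq]

theorem cycle_right {y : Tens C} (hy : dT C y = 0) {b b' q q' : ℤ} (hb : b' = b + 1)
    (hq : q' = q + 1) : TensorProduct.map LinearMap.id (dl C q' q) (y b q') =
      -sgn q (TensorProduct.map (dl C b' b) LinearMap.id (y b' q)) := by
  subst hb hq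
  exact eq_neg_of_add_eq_zero_left (congrFun (congrFun hy b) q)

theorem dT_slant (n : ℤ) {x y : Tens C} (hx : dT C x = 0) (hy : dT C y = 0) (g : Form C) :
    dT C (slant n n x y g) = slant n n x y (dF C g) := by
  funext p q
  change TensorProduct.map LinearMap.id (dl C (q + 1) q) (sgn (n * (n - (q + 1)))
      (contr (g (n - p) (n - (q + 1))) (x (n - p) p) (y (n - (q + 1)) (q + 1)))) +
    sgn q (TensorProduct.map (dl C (p + 1) p) LinearMap.id (sgn (n * (n - q))
      (contr (g (n - (p + 1)) (n - q)) (x (n - (p + 1)) (p + 1)) (y (n - q) q)))) =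
    sgn (n * (n - q)) (contr
      (sgn (n - q - 1) ((g (n - p) (n - q - 1)).compl₂ (dl C (n - q) (n - q - 1))) +
      sgn (n - p + (n - q) - 1) ((g (n - p - 1) (n - q)).comp (dl C (n - p) (n - p - 1))))
      (x (n - p) p) (y (n - q) q))
  have e1 : n - q - 1 = n - (q + 1) := by ring
  have e2 : n - p - 1 = n - (p + 1) := by ring
  rw [e1, e2]
  have h1 := contr_map (LinearMap.id : C.X (n - p) →ₗ[ℤ] _) (LinearMap.id : C.X (n - (q + 1)) →ₗ[ℤ] _)
    (LinearMap.id : C.X p →ₗ[ℤ] _) (dl C (q + 1) q) (g (n - p) (n - (q + 1)))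
    (x (n - p) p) (y (n - (q + 1)) (q + 1))
  have h2 := contr_map (LinearMap.id : C.X (n - (p + 1)) →ₗ[ℤ] _) (LinearMap.id : C.X (n - q) →ₗ[ℤ] _)
    (dl C (p + 1) p) (LinearMap.id : C.X q →ₗ[ℤ] _) (g (n - (p + 1)) (n - q))
    (x (n - (p + 1)) (p + 1)) (y (n - q) q)
  have h3 := contr_map (LinearMap.id : C.X (n - p) →ₗ[ℤ] _) (dl C (n - q) (n - (q + 1)))
    (LinearMap.id : C.X p →ₗ[ℤ] _) (LinearMap.id : C.X q →ₗ[ℤ] _) (g (n - p) (n - (q + 1)))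
    (x (n - p) p) (y (n - q) q)
  have h4 := contr_map (dl C (n - p) (n - (p + 1))) (LinearMap.id : C.X (n - q) →ₗ[ℤ] _)
    (LinearMap.id : C.X p →ₗ[ℤ] _) (LinearMap.id : C.X q →ₗ[ℤ] _) (g (n - (p + 1)) (n - q))
    (x (n - p) p) (y (n - q) q)
  have c1 := cycle_right hy (b := n - (q + 1)) (b' := n - q) (q := q) (q' := q + 1) (by ring) rfl
  have c2 := cycle_right hx (b := n - (p + 1)) (b' := n - p) (q := p) (q' := p + 1) (by ring) rfl
  simp only [TensorProduct.map_id, LinearMap.id_apply, LinearMap.compl₁₂_id_id] at h1 h2 h3 h4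
  rw [map_sgn, map_sgn, ← h1, ← h2, c1, c2, contr_add, contr_sgn, contr_sgn]
  simp only [map_neg, LinearMap.neg_apply, contr_sgn_left, contr_sgn_right]
  rw [h3, h4]
  change -sgn (n * (n - (q + 1))) (sgn q (contr ((g (n - p) (n - (q + 1))).compl₂
      (dl C (n - q) (n - (q + 1)))) (x (n - p) p) (y (n - q) q))) +
    -sgn q (sgn (n * (n - q)) (sgn p (contr ((g (n - (p + 1)) (n - q)).comp
      (dl C (n - p) (n - (p + 1)))) (x (n - p) p) (y (n - q) q)))) = _
  simp only [map_add, ← sgn_add, neg_sgn]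
  exact congrArg₂ (· + ·) (sgn_congr ⟨1 - n + q, by ring⟩ _) (sgn_congr ⟨1 + p + q - n, by ring⟩ _)

end slant

section functoriality

variable {C D E : Cx}

theorem dl_comp (f : C ⟶ D) (i j : ℤ) : dl D i j ∘ₗ fl f i = fl f j ∘ₗ dl C i j := by
  ext x
  exact ConcreteCategory.congr_hom (f.comm i j) x

theorem dT_push (f : C ⟶ D) (x : Tens C) : dT D (pushT f x) = pushT f (dT C x) := by
  funext p q
  change TensorProduct.map LinearMap.id (dl D (q + 1) q)
      (TensorProduct.map (fl f p) (fl f (q + 1)) (x p (q + 1))) +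
    sgn q (TensorProduct.map (dl D (p + 1) p) LinearMap.id
      (TensorProduct.map (fl f (p + 1)) (fl f q) (x (p + 1) q))) =
    TensorProduct.map (fl f p) (fl f q)
      (TensorProduct.map LinearMap.id (dl C (q + 1) q) (x p (q + 1)) +
        sgn q (TensorProduct.map (dl C (p + 1) p) LinearMap.id (x (p + 1) q)))
  rw [map_add, map_sgn]
  simp only [← LinearMap.comp_apply, ← TensorProduct.map_comp, dl_comp, LinearMap.id_comp,
    LinearMap.comp_id]

theorem trT_push (f : C ⟶ D) (x : Tens C) : trT D (pushT f x) = pushT f (trT C x) := by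
  funext p q
  change sgn (p * q) (TensorProduct.comm ℤ _ _ (TensorProduct.map (fl f q) (fl f p) (x q p))) =
    TensorProduct.map (fl f p) (fl f q) (sgn (p * q) (TensorProduct.comm ℤ _ _ (x q p)))
  rw [map_sgn, TensorProduct.map_comm]

theorem slant_push_apply (n : ℤ) (u v : C ⟶ D) (x y : Tens C) (g : Form D) (p q : ℤ) :
    slant n n (pushT u x) (pushT v y) g p q =
      TensorProduct.map (fl u p) (fl v q) (slant n n x y (pullF u v g) p q) := by
  change sgn _ (contr _ (TensorProduct.map _ _ _) (TensorProduct.map _ _ _)) =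
    TensorProduct.map _ _ (sgn _ (contr _ _ _))
  rw [map_sgn, contr_map]
  rfl

theorem slant_push (n : ℤ) (f : C ⟶ D) (x y : Tens C) (g : Form D) :
    slant n n (pushT f x) (pushT f y) g = pushT f (slant n n x y (pullF f f g)) := by
  funext p q
  exact slant_push_apply n f f x y g p q

theorem dF_pull (u v : C ⟶ D) (g : Form D) : dF C (pullF u v g) = pullF u v (dF D g) := by
  funext p q
  ext a b
  have hu := LinearMap.congr_fun (dl_comp u p (p - 1)) a
  have hv := LinearMap.congr_fun (dl_comp v q (q - 1)) b
  simp only [LinearMap.comp_apply] at hu hv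
  change (sgn (q - 1) (_ : C.X p →ₗ[ℤ] C.X q →ₗ[ℤ] ℤ) + sgn (p + q - 1) _) a b =
    (sgn (q - 1) (_ : D.X p →ₗ[ℤ] D.X q →ₗ[ℤ] ℤ) + sgn (p + q - 1) _) (fl u p a) (fl v q b)
  simp only [LinearMap.add_apply, sgn_lin₂]
  simp only [LinearMap.compl₂_apply, LinearMap.comp_apply, hu, hv]
  rfl

theorem trF_pull (u v : C ⟶ D) (g : Form D) : trF C (pullF u v g) = pullF v u (trF D g) := by
  funext p q
  ext a b
  change (sgn (p * q) (_ : C.X p →ₗ[ℤ] C.X q →ₗ[ℤ] ℤ)) a b =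
    (sgn (p * q) (_ : D.X p →ₗ[ℤ] D.X q →ₗ[ℤ] ℤ)) (fl v p a) (fl u q b)
  rw [sgn_lin₂, sgn_lin₂]
  rfl

theorem dF_trF (g : Form C) : dF C (trF C g) = trF C (dF C g) := by
  funext p q
  ext a b
  change (sgn (q - 1) ((sgn (p * (q - 1)) (g (q - 1) p).flip).compl₂ (dl C q (q - 1))) +
    sgn (p + q - 1) ((sgn ((p - 1) * q) (g q (p - 1)).flip).comp (dl C p (p - 1)))) a b =
    sgn (p * q) (sgn (p - 1) ((g q (p - 1)).compl₂ (dl C p (p - 1))) +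
      sgn (q + p - 1) ((g (q - 1) p).comp (dl C q (q - 1)))).flip a b
  simp only [LinearMap.add_apply, sgn_lin₂, LinearMap.flip_apply, LinearMap.compl₂_apply,
    LinearMap.comp_apply, ← sgn_add, map_add]
  rw [add_comm]
  exact congrArg₂ (· + ·) (sgn_congr ⟨0, by ring⟩ _) (sgn_congr ⟨-p, by ring⟩ _)

theorem trF_trF (g : Form C) : trF C (trF C g) = g := by
  funext p q
  ext a b
  change sgn (p * q) (sgn (q * p) (g p q).flip).flip a b = g p q a b
  simp only [sgn_lin₂, LinearMap.flip_apply, ← sgn_add]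
  rw [sgn_even]
  rw [mul_comm q p]
  exact ⟨_, rfl⟩

theorem pullF_add (u u' v v' : C ⟶ D) (g : Form D) :
    pullF (u + u') (v + v') g =
      pullF u v g + pullF u' v' g + (pullF u v' g + pullF u' v g) := by
  funext p q
  ext a b
  change g p q (fl u p a + fl u' p a) (fl v q b + fl v' q b) =
    g p q (fl u p a) (fl v q b) + g p q (fl u' p a) (fl v' q b) +
      (g p q (fl u p a) (fl v' q b) + g p q (fl u' p a) (fl v q b))
  simp only [map_add, LinearMap.add_apply]
  abel

theorem pullF_zero_left (v : C ⟶ D) (g : Form D) : pullF 0 v g = 0 := by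
  funext p q
  ext a b
  change g p q 0 (fl v q b) = 0
  simp

theorem pullF_zero_right (u : C ⟶ D) (g : Form D) : pullF u 0 g = 0 := by
  funext p q
  ext a b
  change g p q (fl u p a) 0 = 0
  simp

theorem pullF_pullF (u v : C ⟶ D) (u' v' : D ⟶ E) (g : Form E) :
    pullF u v (pullF u' v' g) = pullF (u ≫ u') (v ≫ v') g := rfl

theorem pullF_id (g : Form C) : pullF (𝟙 C) (𝟙 C) g = g := rfl

theorem tateD_comp {M N : Type} [AddCommGroup M] [AddCommGroup N] {d T : M →+ M}
    {d' T' : N →+ N} (F : M →+ N) (hd : ∀ x, d' (F x) = F (d x)) (hT : ∀ x, T' (F x) = F (T x))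
    (n : ℤ) (θ : ℤ → M) : tateD d' T' n (fun s => F (θ s)) = fun s => F (tateD d T n θ s) := by
  funext s
  change d' (F (θ s)) + sgn (n + s - 1) (F (θ (s - 1)) + sgn s (T' (F (θ (s - 1))))) =
    F (d (θ s) + sgn (n + s - 1) (θ (s - 1) + sgn s (T (θ (s - 1)))))
  simp only [hd, hT, map_add, map_sgn F]

theorem dW_push (f : C ⟶ D) (n : ℤ) (θ : ℤ → Tens C) :
    dW D n (pushW f θ) = pushW f (dW C n θ) :=
  tateD_comp (pushT f) (dT_push f) (trT_push f) n θ

theorem dWF_pull (f : C ⟶ D) (n : ℤ) (γ : ℤ → Form D) :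
    dWF C n (pullW f γ) = pullW f (dWF D n γ) :=
  tateD_comp (pullF f f) (dF_pull f f) (trF_pull f f) n γ

theorem twist_push (f : C ⟶ D) (n : ℤ) (x : Tens C) (γ : ℤ → Form D) :
    twist n (pushT f x) γ = pushW f (twist n x (pullW f γ)) := by
  funext s
  exact slant_push n f x x _

theorem twist_add_form (n : ℤ) (x : Tens C) (γ δ : ℤ → Form C) :
    twist n x (γ + δ) = twist n x γ + twist n x δ := by
  funext s
  exact slant_add n n x x _ _

theorem dW_twist (n m : ℤ) {x : Tens C} (hx : dT C x = 0) (χ : ℤ → Form C) :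
    dW C (n + m) (twist n x χ) = twist n x (dWF C m χ) := by
  funext s
  change dT C (slant n n x x (χ (s - n))) + sgn (n + m + s - 1)
      (slant n n x x (χ (s - 1 - n)) + sgn s (trT C (slant n n x x (χ (s - 1 - n))))) =
    slant n n x x (dF C (χ (s - n)) + sgn (m + (s - n) - 1)
      (χ (s - n - 1) + sgn (s - n) (trF C (χ (s - n - 1)))))
  rw [show s - 1 - n = s - n - 1 by ring, dT_slant n hx hx, trT_slant, slant_add, slant_sgn,
    slant_add, slant_sgn, ← sgn_add]
  rw [sgn_congr (a := s + n) (b := s - n) ⟨n, by ring⟩,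
    sgn_congr (a := n + m + s - 1) (b := m + (s - n) - 1) ⟨n, by ring⟩]

theorem dW_bracket (γ : Bundle C) (n : ℤ) {x y : Tens C} (hx : dT C x = 0) (hy : dT C y = 0) :
    dW C (n + 1) (bracket n x y γ.form) =
      twist n x γ.form + twist n y γ.form - twist n (x + y) γ.form := by
  funext s
  have hc : dF C (γ.form (s - n + 1)) + sgn (0 + (s - n + 1) - 1) (γ.form (s - n + 1 - 1) +
      sgn (s - n + 1) (trF C (γ.form (s - n + 1 - 1)))) = 0 := congrFun γ.cycle (s - n + 1)
  change dT C (-slant n n x y (trF C (γ.form (s - n + 1)))) + sgn (n + 1 + s - 1)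
      (-slant n n x y (trF C (γ.form (s - 1 - n + 1))) +
        sgn s (trT C (-slant n n x y (trF C (γ.form (s - 1 - n + 1)))))) =
    slant n n x x (γ.form (s - n)) + slant n n y y (γ.form (s - n)) -
      slant n n (x + y) (x + y) (γ.form (s - n))
  rw [show s - n + 1 - 1 = s - n by ring] at hc
  rw [show s - 1 - n + 1 = s - n by ring, map_neg, dT_slant n hx hy, dF_trF,
    eq_neg_of_add_eq_zero_left hc, map_neg, map_neg, trT_slant, trF_trF, map_sgn, map_add, map_sgn,
    trF_trF, slant_add_left, slant_add_right, slant_add_right]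
  rw [sgn_congr (a := 0 + (s - n + 1) - 1) (b := s + n) ⟨-n, by ring⟩,
    sgn_congr (a := s - n + 1) (b := 1 + (s + n)) ⟨-n, by ring⟩,
    sgn_congr (a := n + 1 + s - 1) (b := s + n) ⟨0, by ring⟩]
  simp only [sgn_add]
  by_cases hn : Even n <;> by_cases hs : Even s <;>
    simp [sgn, hn, hs, slant_neg, slant_add] <;> abel

/-- The analogue of `bracket` for the pullback of a bundle along two chain maps. -/
noncomputable def bracketF (u v : C ⟶ D) (γ : ℤ → Form D) : ℤ → Form C :=
  fun s => pullF u v (trF D (γ (s + 1)))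

theorem dWF_bracketF (γ : Bundle D) (u v : C ⟶ D) :
    dWF C 1 (bracketF u v γ.form) =
      pullW (u + v) γ.form - pullW u γ.form - pullW v γ.form := by
  funext s
  have hc : dF D (γ.form (s + 1)) + sgn (0 + (s + 1) - 1) (γ.form (s + 1 - 1) +
      sgn (s + 1) (trF D (γ.form (s + 1 - 1)))) = 0 := congrFun γ.cycle (s + 1)
  change dF C (pullF u v (trF D (γ.form (s + 1)))) + sgn (1 + s - 1)
      (pullF u v (trF D (γ.form (s - 1 + 1))) +
        sgn s (trF C (pullF u v (trF D (γ.form (s - 1 + 1)))))) =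
    pullF (u + v) (u + v) (γ.form s) - pullF u u (γ.form s) - pullF v v (γ.form s)
  rw [show s + 1 - 1 = s by ring] at hc
  rw [show s - 1 + 1 = s by ring, dF_pull, dF_trF, eq_neg_of_add_eq_zero_left hc, trF_pull,
    trF_trF, pullF_add, map_neg, map_sgn, map_add, map_sgn, trF_trF]
  rw [sgn_congr (a := 0 + (s + 1) - 1) (b := s) ⟨0, by ring⟩,
    sgn_congr (a := s + 1) (b := 1 + s) ⟨0, by ring⟩,
    sgn_congr (a := 1 + s - 1) (b := s) ⟨0, by ring⟩]
  simp only [← neg_sgn]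
  by_cases hs : Even s <;> simp [sgn, hs] <;> abel

end functoriality

section membership

variable {C D : Cx}

theorem pushW_hyper (f : C ⟶ D) {n : ℤ} {θ : ℤ → Tens C} (h : θ ∈ hyperChains C n) :
    pushW f θ ∈ hyperChains D n := by
  obtain ⟨h1, N, h2⟩ := h
  refine ⟨fun s p q e => ?_, N, fun s p q e => ?_⟩
  · change TensorProduct.map _ _ (θ s p q) = 0
    rw [h1 s p q e, map_zero]
  · change TensorProduct.map _ _ (θ s p q) = 0
    rw [h2 s p q e, map_zero]

theorem pushW_sym (f : C ⟶ D) {n : ℤ} {φ : ℤ → Tens C} (h : φ ∈ symChains C n) :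
    pushW f φ ∈ symChains D n := by
  refine ⟨pushW_hyper f h.1, fun s hs => ?_⟩
  change pushT f (φ s) = 0
  rw [h.2 s hs, map_zero]

theorem pullW_mem (f : C ⟶ D) {n : ℤ} {γ : ℤ → Form D} (h : γ ∈ formChains D n) :
    pullW f γ ∈ formChains C n := by
  intro s p q e
  change (γ s p q).compl₁₂ _ _ = 0
  rw [h s p q e]
  rfl

theorem bracketF_mem (u v : C ⟶ D) {γ : ℤ → Form D} (h : γ ∈ formChains D 0) :
    bracketF u v γ ∈ formChains C 1 := by
  intro s p q e
  change (sgn (p * q) (γ (s + 1) q p).flip).compl₁₂ _ _ = 0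
  rw [h (s + 1) q p (by omega)]
  have e0 : (0 : D.X q →ₗ[ℤ] D.X p →ₗ[ℤ] ℤ).flip = 0 := rfl
  rw [e0, map_zero]
  rfl

theorem slant_family_mem {φ : ℤ → Tens C} {n m k : ℤ} (hφ : φ ∈ hyperChains C n) (y : Tens C)
    {F : ℤ → Form C} (hF : F ∈ formChains C m) (hy : ∃ N : ℤ, ∀ p q, N < |q| → y p q = 0) :
    (fun s => slant n n (φ 0) y (F (s - k))) ∈ hyperChains C (2 * n + m - k) := by
  obtain ⟨N, hN⟩ := hφ.2
  obtain ⟨M, hM⟩ := hy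
  refine ⟨fun s p q e => ?_, max N M, fun s p q e => ?_⟩
  · change sgn _ (contr (F (s - k) (n - p) (n - q)) _ _) = 0
    rw [hF (s - k) (n - p) (n - q) (by omega), contr_zero, map_zero]
  · change sgn _ (contr _ (φ 0 (n - p) p) (y (n - q) q)) = 0
    simp only [max_lt_iff] at e
    rcases e with e | e
    · rw [hN 0 _ _ (Or.inr e.1)]; simp
    · rw [hM _ _ e.2]; simp

theorem bound_zero {φ : ℤ → Tens C} {n : ℤ} (hφ : φ ∈ hyperChains C n) :
    ∃ N : ℤ, ∀ p q, N < |q| → φ 0 p q = 0 := by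
  obtain ⟨N, hN⟩ := hφ.2
  exact ⟨N, fun p q h => hN 0 p q (Or.inr h)⟩

theorem twist_mem {φ : ℤ → Tens C} {n m : ℤ} (hφ : φ ∈ hyperChains C n) {F : ℤ → Form C}
    (hF : F ∈ formChains C m) : twist n (φ 0) F ∈ hyperChains C (n + m) := by
  have h := slant_family_mem (k := n) hφ (φ 0) hF (bound_zero hφ)
  rwa [show 2 * n + m - n = n + m by ring] at h

theorem bracket_mem {φ φ' : ℤ → Tens C} {n : ℤ} (hφ : φ ∈ hyperChains C n)
    (hφ' : φ' ∈ hyperChains C n) {F : ℤ → Form C} (hF : F ∈ formChains C 0) :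
    bracket n (φ 0) (φ' 0) F ∈ hyperChains C (n + 1) := by
  have hT : (fun s => trF C (F s)) ∈ formChains C 0 := by
    intro s p q e
    change sgn (p * q) (F s q p).flip = 0
    rw [hF s q p (by omega)]
    exact map_zero (sgn (p * q))
  have h := neg_mem (slant_family_mem (k := n - 1) hφ (φ' 0) hT (bound_zero hφ'))
  rw [show 2 * n + 0 - (n - 1) = n + 1 by ring] at h
  convert h using 1
  funext s
  change -slant n n (φ 0) (φ' 0) (trF C (F (s - n + 1))) =
    -slant n n (φ 0) (φ' 0) (trF C (F (s - (n - 1))))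
  rw [show s - (n - 1) = s - n + 1 by ring]

theorem dT_zero {φ : ℤ → Tens C} {n : ℤ} (hφ : φ ∈ symChains C n) (h : dW C n φ = 0) :
    dT C (φ 0) = 0 := by
  have h0 : dT C (φ 0) + sgn (n + 0 - 1) (φ (0 - 1) + sgn 0 (trT C (φ (0 - 1)))) = 0 :=
    congrFun h 0
  rw [hφ.2 (0 - 1) (by norm_num)] at h0
  simpa using h0

end membership

/-! ### Twisted quadratic groups -/

/-- An `n`-dimensional symmetric structure `(φ, θ)` on the chain bundle `(C, γ)`: a cycle
`φ ∈ (W^% C)_n` and a chain `θ ∈ (Ŵ^% C)_{n+1}` with `J φ - (φ₀)^% (S^n γ) = dθ`. -/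
@[ext] structure SymStr {C : Cx} (γ : Bundle C) (n : ℤ) where
  /-- the symmetric structure on `C` -/
  φ : ℤ → Tens C
  /-- the equivalence `J φ → (φ₀)^% (S^n γ)` of hyperquadratic structures -/
  θ : ℤ → Tens C
  φ_mem : φ ∈ symChains C n
  φ_cycle : dW C n φ = 0
  θ_mem : θ ∈ hyperChains C (n + 1)
  eq : φ - twist n (φ 0) γ.form = dW C (n + 1) θ

namespace SymStr

variable {C D : Cx} {γ : Bundle C} {δ : Bundle D} {n : ℤ}

/-- Equivalence of symmetric structures on a chain bundle: chains `ξ ∈ (W^% C)_{n+1}`,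
`η ∈ (Ŵ^% C)_{n+2}` with `φ' - φ = dξ` and
`θ' - θ - J ξ + (ξ₀; φ₀, φ'₀)^% (S^n γ) = dη`. -/
def Equiv (x y : SymStr γ n) : Prop :=
  ∃ ξ ∈ symChains C (n + 1), ∃ η ∈ hyperChains C (n + 2),
    y.φ - x.φ = dW C (n + 1) ξ ∧
    y.θ - x.θ - ξ + twistHomotopy n (ξ 0) (x.φ 0) (y.φ 0) γ.form = dW C (n + 2) η

/-- `(φ, θ) + (φ', θ') = (φ + φ', θ + θ' + [φ₀, φ'₀] (S^n γ))`. -/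
noncomputable instance : Add (SymStr γ n) where
  add x y :=
    { φ := x.φ + y.φ
      θ := x.θ + y.θ + bracket n (x.φ 0) (y.φ 0) γ.form
      φ_mem := add_mem x.φ_mem y.φ_mem
      φ_cycle := by rw [map_add, x.φ_cycle, y.φ_cycle, add_zero]
      θ_mem := add_mem (add_mem x.θ_mem y.θ_mem) (bracket_mem x.φ_mem.1 y.φ_mem.1 γ.mem)
      eq := by
        rw [map_add, map_add, dW_bracket γ n (dT_zero x.φ_mem x.φ_cycle)
          (dT_zero y.φ_mem y.φ_cycle), ← x.eq, ← y.eq, Pi.add_apply]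
        abel }

/-- The induced structure
`(f, χ)_% (φ, θ) = (f^% φ, f^% θ - (f φ₀)^% (S^n χ))` for a map of chain bundles. -/
noncomputable def push (a : BundleMap γ δ) (x : SymStr γ n) : SymStr δ n where
  φ := pushW a.f x.φ
  θ := pushW a.f x.θ - pushW a.f (twist n (x.φ 0) a.χ)
  φ_mem := pushW_sym a.f x.φ_mem
  φ_cycle := by rw [dW_push, x.φ_cycle, map_zero]
  θ_mem := sub_mem (pushW_hyper a.f x.θ_mem) (pushW_hyper a.f (twist_mem x.φ_mem.1 a.mem))
  eq := by
    change pushW a.f x.φ - twist n (pushT a.f (x.φ 0)) δ.form = _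
    rw [map_sub, dW_push, dW_push, dW_twist n 1 (dT_zero x.φ_mem x.φ_cycle), ← a.eq, ← x.eq,
      twist_push, ← map_sub, ← map_sub]
    congr 1
    have h := twist_add_form n (x.φ 0) (pullW a.f δ.form - γ.form) γ.form
    rw [sub_add_cancel] at h
    rw [h]
    abel

end SymStr

/-- The twisted quadratic group `Q_n(C, γ)` of equivalence classes of `n`-dimensional symmetric
structures on `(C, γ)`. (It is the quotient by the additive congruence which the relation
`SymStr.Equiv` generates.) -/
abbrev TwistedQ {C : Cx} (γ : Bundle C) (n : ℤ) : Type :=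
  (addConGen (SymStr.Equiv (γ := γ) (n := n))).Quotient

/-- The class of a symmetric structure in the twisted quadratic group. -/
noncomputable def TwistedQ.mk {C : Cx} {γ : Bundle C} {n : ℤ} (x : SymStr γ n) : TwistedQ γ n :=
  (x : (addConGen (SymStr.Equiv (γ := γ) (n := n))).Quotient)

/-! ### Normal complexes and their cobordism groups -/

namespace BundleMap

variable {C C' C'' : Cx} {γ : Bundle C} {γ' : Bundle C'} {γ'' : Bundle C''}

/-- The composite `(f', χ') (f, χ) = (f' f, χ + f^* χ')`. -/
noncomputable def comp (a : BundleMap γ γ') (b : BundleMap γ' γ'') : BundleMap γ γ'' where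
  f := a.f ≫ b.f
  χ := a.χ + pullW a.f b.χ
  mem := add_mem a.mem (pullW_mem a.f b.mem)
  eq := by
    rw [map_add, dWF_pull, ← a.eq, ← b.eq, map_sub]
    change pullW a.f (pullW b.f γ''.form) - _ = _
    abel

end BundleMap

namespace Bundle

variable {C D : Cx}

/-- The direct sum of chain bundles. -/
noncomputable def sum (γ : Bundle C) (δ : Bundle D) : Bundle (C ⊞ D) where
  form := pullW biprod.fst γ.form + pullW biprod.snd δ.form
  mem := add_mem (pullW_mem _ γ.mem) (pullW_mem _ δ.mem)
  cycle := by rw [map_add, dWF_pull, dWF_pull, γ.cycle, δ.cycle, map_zero, map_zero, add_zero]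

theorem pullW_zero (γ : ℤ → Form D) : pullW (0 : C ⟶ D) γ = 0 := by
  funext s
  exact pullF_zero_left 0 (γ s)

theorem pullW_comp {E : Cx} (u : C ⟶ D) (v : D ⟶ E) (γ : ℤ → Form E) :
    pullW u (pullW v γ) = pullW (u ≫ v) γ := rfl

/-- The inclusion of the first summand, as a map of chain bundles. -/
noncomputable def inl (γ : Bundle C) (δ : Bundle D) : BundleMap γ (γ.sum δ) where
  f := biprod.inl
  χ := 0
  mem := zero_mem _
  eq := by
    change pullW biprod.inl (pullW biprod.fst γ.form + pullW biprod.snd δ.form) - γ.form = _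
    rw [map_add, pullW_comp, pullW_comp, biprod.inl_fst, biprod.inl_snd, pullW_zero, map_zero,
      add_zero]
    exact sub_self _

/-- The inclusion of the second summand, as a map of chain bundles. -/
noncomputable def inr (γ : Bundle C) (δ : Bundle D) : BundleMap δ (γ.sum δ) where
  f := biprod.inr
  χ := 0
  mem := zero_mem _
  eq := by
    change pullW biprod.inr (pullW biprod.fst γ.form + pullW biprod.snd δ.form) - δ.form = _
    rw [map_add, pullW_comp, pullW_comp, biprod.inr_fst, biprod.inr_snd, pullW_zero, map_zero,
      zero_add]
    exact sub_self _

/-- The map of chain bundles `(C, γ) ⊕ (D, δ) → (B, β)` induced by maps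
`(f, χ) : (C, γ) → (B, β)` and `(g, ω) : (D, δ) → (B, β)`. The sum of the two equivalences is
corrected by the standard equivalence between `(f p + g q)^* β` and `(f p)^* β + (g q)^* β`, where
`p`, `q` are the projections. -/
noncomputable def desc {B : Cx} {β : Bundle B} {γ : Bundle C} {δ : Bundle D}
    (a : BundleMap γ β) (b : BundleMap δ β) : BundleMap (γ.sum δ) β where
  f := biprod.desc a.f b.f
  χ := pullW biprod.fst a.χ + pullW biprod.snd b.χ +
    bracketF (biprod.fst ≫ a.f) (biprod.snd ≫ b.f) β.form
  mem := add_mem (add_mem (pullW_mem _ a.mem) (pullW_mem _ b.mem)) (bracketF_mem _ _ β.mem)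
  eq := by
    rw [biprod.desc_eq, map_add, map_add, dWF_bracketF, dWF_pull, dWF_pull, ← a.eq, ← b.eq,
      map_sub, map_sub, pullW_comp, pullW_comp]
    change _ - (pullW biprod.fst γ.form + pullW biprod.snd δ.form) = _
    abel

end Bundle

theorem IsDim.biprod {n : ℤ} {C D : Cx} (hC : IsDim n C) (hD : IsDim n D) : IsDim n (C ⊞ D) := by
  have key (p : ℤ) : ∃ e : (C.X p × D.X p) ≃ₗ[ℤ] (C ⊞ D).X p, True := by
    refine ⟨LinearEquiv.ofLinearMap
      ((fl biprod.inl p).coprod (fl biprod.inr p))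
      ((fl biprod.fst p).prod (fl biprod.snd p)) ?_ ?_, trivial⟩
    · ext x
      have h := congrArg (fun f : C ⊞ D ⟶ C ⊞ D => (f.f p).hom x) (biprod.total (X := C) (Y := D))
      exact h
    · have h1 := congrArg (fun f : C ⟶ C => fl f p) (biprod.inl_fst (X := C) (Y := D))
      have h2 := congrArg (fun f : C ⟶ D => fl f p) (biprod.inl_snd (X := C) (Y := D))
      have h3 := congrArg (fun f : D ⟶ C => fl f p) (biprod.inr_fst (X := C) (Y := D))
      have h4 := congrArg (fun f : D ⟶ D => fl f p) (biprod.inr_snd (X := C) (Y := D))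
      apply LinearMap.ext
      rintro ⟨x, y⟩
      have k1 : fl (biprod.fst (X := C) (Y := D)) p (fl biprod.inl p x) = x :=
        LinearMap.congr_fun h1 x
      have k2 : fl (biprod.snd (X := C) (Y := D)) p (fl biprod.inl p x) = 0 :=
        LinearMap.congr_fun h2 x
      have k3 : fl (biprod.fst (X := C) (Y := D)) p (fl biprod.inr p y) = 0 :=
        LinearMap.congr_fun h3 y
      have k4 : fl (biprod.snd (X := C) (Y := D)) p (fl biprod.inr p y) = y :=
        LinearMap.congr_fun h4 y
      change (fl biprod.fst p (fl biprod.inl p x + fl biprod.inr p y),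
        fl biprod.snd p (fl biprod.inl p x + fl biprod.inr p y)) = (x, y)
      rw [map_add, map_add, k1, k2, k3, k4, add_zero, zero_add]
  refine ⟨fun p => ?_, fun p hp => ?_⟩
  · obtain ⟨e, -⟩ := key p
    obtain ⟨h1, h2⟩ := hC.1 p
    obtain ⟨h3, h4⟩ := hD.1 p
    exact ⟨Module.Finite.equiv e, Module.Projective.of_equiv e⟩
  · obtain ⟨e, -⟩ := key p
    have h1 := hC.2 p hp
    have h2 := hD.2 p hp
    exact e.symm.injective.subsingleton

/-- An `n`-dimensional `(B, β)`-normal complex `(C, φ, γ, θ, f, χ)`: an `n`-dimensional complex `C`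
with a bundle `γ`, a symmetric structure `(φ, θ)` on `(C, γ)` and a map of chain bundles
`(f, χ) : (C, γ) → (B, β)`. -/
structure NormalCx {B : Cx} (β : Bundle B) (n : ℤ) where
  /-- the underlying complex -/
  C : Cx
  dim : IsDim n C
  /-- the bundle over `C` -/
  γ : Bundle C
  /-- the symmetric structure and the normal structure -/
  str : SymStr γ n
  /-- the classifying map -/
  map : BundleMap γ β

namespace NormalCx

variable {B : Cx} {β : Bundle B} {n : ℤ}

/-- The direct sum of normal complexes. -/
noncomputable instance : Add (NormalCx β n) where
  add x y :=
    { C := x.C ⊞ y.C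
      dim := x.dim.biprod y.dim
      γ := x.γ.sum y.γ
      str := x.str.push (x.γ.inl y.γ) + y.str.push (x.γ.inr y.γ)
      map := Bundle.desc x.map y.map }

/-- Cobordism of `(B, β)`-normal complexes: there are an `(n+1)`-dimensional complex `D` with a
bundle `δ`, a map of chain bundles `g : (D, δ) → (B, β)` and maps of chain bundles
`a : (C, γ) → (D, δ)`, `b : (C', γ') → (D, δ)` over `(B, β)`, and an equivalence of symmetric
structures `a_% (φ, θ) → b_% (φ', θ')` on `(D, δ)`. The chain `ξ` of that equivalence is, up to
sign, the symmetric structure relative to the boundary of the pair `C ⊕ C' → D`. -/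
def Cobordant (x y : NormalCx β n) : Prop :=
  ∃ (D : Cx) (δ : Bundle D) (g : BundleMap δ β) (a : BundleMap x.γ δ) (b : BundleMap y.γ δ),
    IsDim (n + 1) D ∧ a.comp g = x.map ∧ b.comp g = y.map ∧ (x.str.push a).Equiv (y.str.push b)

/-- The characteristic element `(f, χ)_% (φ, θ)` of a `(B, β)`-normal complex. -/
noncomputable def char (x : NormalCx β n) : TwistedQ β n := TwistedQ.mk (x.str.push x.map)

end NormalCx

/-- The cobordism group `L̂⟨B, β⟩^n(ℤ)` of `n`-dimensional `(B, β)`-normal complexes, with addition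
by direct sum. (It is the quotient by the additive congruence which the relation
`NormalCx.Cobordant` generates.) -/
abbrev LHat {B : Cx} (β : Bundle B) (n : ℤ) : Type 1 :=
  (addConGen (NormalCx.Cobordant (β := β) (n := n))).Quotient

/-- The cobordism class of a normal complex. -/
noncomputable def LHat.mk {B : Cx} {β : Bundle B} {n : ℤ} (x : NormalCx β n) : LHat β n :=
  (x : (addConGen (NormalCx.Cobordant (β := β) (n := n))).Quotient)

/-! ### The universal chain bundle over `ℤ` -/

/-- The Wu class `v̂_r(γ)(x) = γ_{-2r}(x, x)` of a bundle, before passage to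
`Ĥ^r(ℤ/2; ℤ) = ker(1 - (-1)^r) / im(1 + (-1)^r)`. -/
def Bundle.wu {C : Cx} (γ : Bundle C) (r : ℤ) (x : C.X r) : ℤ := γ.form (-2 * r) r r x x

/-- The Wu classes of `γ` define isomorphisms `H_r(C) → Ĥ^r(ℤ/2; ℤ)` for `r ≥ 0`, where
`Ĥ^r(ℤ/2; ℤ) = {a | a = (-1)^r a} / {b + (-1)^r b}`. -/
def Bundle.IsUniversal {C : Cx} (γ : Bundle C) : Prop :=
  ∀ r : ℤ, 0 ≤ r →
    (∀ x, dl C r (r - 1) x = 0 → γ.wu r x = sgn r (γ.wu r x)) ∧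
    (∀ x y, dl C r (r - 1) x = 0 → dl C r (r - 1) y = 0 →
      ∃ b, γ.wu r (x + y) - (γ.wu r x + γ.wu r y) = b + sgn r b) ∧
    (∀ x, dl C r (r - 1) x = 0 →
      ((∃ b, γ.wu r x = b + sgn r b) ↔ ∃ z, dl C (r + 1) r z = x)) ∧
    ∀ a : ℤ, a = sgn r a → ∃ x, dl C r (r - 1) x = 0 ∧ ∃ b, γ.wu r x - a = b + sgn r b

/-- `ℤ` for `r ≥ 0` and `0` for `r < 0`. -/
def zNonneg (r : ℤ) : AddSubgroup ℤ where
  carrier := {x | r < 0 → x = 0}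
  zero_mem' := fun _ => rfl
  add_mem' := fun ha hb h => by rw [ha h, hb h, add_zero]
  neg_mem' := fun ha h => by rw [ha h, neg_zero]

/-- The coefficient of the differential `B(∞)_i → B(∞)_j`: it is `2` if `i = j + 1` is odd. -/
def dCoeff (i j : ℤ) : ℤ := if i = j + 1 ∧ Odd i then 2 else 0

/-- Multiplication by `dCoeff i j`. -/
def dUniv (i j : ℤ) : zNonneg i →+ zNonneg j where
  toFun x := ⟨dCoeff i j * x, fun hj => by
    by_cases h : i = j + 1 ∧ Odd i
    · obtain ⟨h1, k, hk⟩ := h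
      rw [x.2 (by omega), mul_zero]
    · rw [dCoeff, if_neg h, zero_mul]⟩
  map_zero' := by ext; simp
  map_add' x y := by ext; simp [mul_add]

/-- The complex `B(∞)`, with `ℤ` in each degree `r ≥ 0` and `d = 2` in odd degrees, `d = 0` in even
degrees. -/
def univCx : Cx where
  X r := AddCommGrpCat.of (zNonneg r)
  d i j := AddCommGrpCat.ofHom (dUniv i j)
  shape i j h := by
    ext x
    change dCoeff i j * Subtype.val x = 0
    rw [dCoeff, if_neg, zero_mul]
    rintro ⟨h1, -⟩
    exact h h1.symm
  d_comp_d' i j k _ _ := by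
    ext x
    change dCoeff j k * (dCoeff i j * Subtype.val x) = 0
    rw [dCoeff, dCoeff]
    split_ifs with h1 h2 <;> simp
    obtain ⟨-, a, ha⟩ := h1
    obtain ⟨h3, b, hb⟩ := h2
    omega

/-- The coefficient of the form `β(∞)_s` on `B(∞)_p × B(∞)_q`. -/
def betaCoeff (s p q : ℤ) : ℤ :=
  if p + q = -s ∧ ((Even p ∧ q = p) ∨ (Even p ∧ q = p + 1) ∨ (Even q ∧ p = q + 1)) then 1 else 0

/-- The bilinear form `(x, y) ↦ c * (x * y)`. -/
def mulForm (c p q : ℤ) : zNonneg p →ₗ[ℤ] zNonneg q →ₗ[ℤ] ℤ :=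
  (c • LinearMap.mul ℤ ℤ).compl₁₂ (zNonneg p).subtype.toIntLinearMap
    (zNonneg q).subtype.toIntLinearMap

/-- The family `β(∞)_s : B(∞)_p × B(∞)_q → ℤ`. The components which are not zero are
`β(∞)_{-2k}` on `B(∞)_k × B(∞)_k` and `β(∞)_{-2k-1}` on `B(∞)_k × B(∞)_{k+1}` and on
`B(∞)_{k+1} × B(∞)_k`, for `k` even, and all of these are `(x, y) ↦ x y`. -/
def betaForm (s : ℤ) : Form univCx := fun p q => mulForm (betaCoeff s p q) p q

theorem betaCoeff_cycle (s p q : ℤ) :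
    sgn (q - 1) (betaCoeff s p (q - 1) * dCoeff q (q - 1)) +
      sgn (p + q - 1) (betaCoeff s (p - 1) q * dCoeff p (p - 1)) +
      sgn (0 + s - 1) (betaCoeff (s - 1) p q + sgn s (sgn (p * q) (betaCoeff (s - 1) q p))) = 0 := by
  have e : ∀ k : ℤ, sgn (M := ℤ) k = if k % 2 = 0 then AddMonoidHom.id ℤ else -AddMonoidHom.id ℤ :=
    fun k => by simp only [sgn, Int.even_iff]
  have hm : (p * q) % 2 = (p % 2) * (q % 2) % 2 := Int.mul_emod p q 2
  simp only [e, dCoeff, betaCoeff, Int.even_iff, Int.odd_iff, hm]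
  rcases Int.emod_two_eq_zero_or_one p with hp | hp <;>
    rcases Int.emod_two_eq_zero_or_one q with hq | hq <;>
    rw [hp, hq] <;> norm_num <;> split_ifs <;> simp <;> omega

/-- The universal chain bundle `β(∞)` over `B(∞)`. -/
def univBundle : Bundle univCx where
  form := betaForm
  mem s p q h := by
    ext x y
    change betaCoeff s p q * (_ * _) = 0
    rw [betaCoeff, if_neg, zero_mul]
    rintro ⟨h1, -⟩
    apply h
    omega
  cycle := by
    funext s p q
    ext x y
    change (sgn (q - 1) ((betaForm s p (q - 1)).compl₂ (dl univCx q (q - 1))) +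
      sgn (p + q - 1) ((betaForm s (p - 1) q).comp (dl univCx p (p - 1))) +
      (sgn (0 + s - 1) (betaForm (s - 1) + sgn s (trF univCx (betaForm (s - 1))))) p q) x y = 0
    rw [sgn_form, Pi.add_apply, Pi.add_apply, sgn_form]
    change (sgn (q - 1) ((betaForm s p (q - 1)).compl₂ (dl univCx q (q - 1))) +
      sgn (p + q - 1) ((betaForm s (p - 1) q).comp (dl univCx p (p - 1))) +
      (sgn (0 + s - 1) (betaForm (s - 1) p q + sgn s (sgn (p * q) (betaForm (s - 1) q p).flip))))
        x y = 0
    simp only [LinearMap.add_apply, sgn_lin₂]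
    change sgn (q - 1) (betaCoeff s p (q - 1) * (x.1 * (dCoeff q (q - 1) * y.1))) +
      sgn (p + q - 1) (betaCoeff s (p - 1) q * ((dCoeff p (p - 1) * x.1) * y.1)) +
      sgn (0 + s - 1) (betaCoeff (s - 1) p q * (x.1 * y.1) +
        sgn s (sgn (p * q) (betaCoeff (s - 1) q p * (y.1 * x.1)))) = 0
    have h := congrArg (fun c => c * (x.1 * y.1)) (betaCoeff_cycle s p q)
    simp only [zero_mul, add_mul, sgn_mul_right] at h
    have e1 : betaCoeff s p (q - 1) * (x.1 * (dCoeff q (q - 1) * y.1)) =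
        betaCoeff s p (q - 1) * dCoeff q (q - 1) * (x.1 * y.1) := by ring
    have e2 : betaCoeff s (p - 1) q * ((dCoeff p (p - 1) * x.1) * y.1) =
        betaCoeff s (p - 1) q * dCoeff p (p - 1) * (x.1 * y.1) := by ring
    rw [e1, e2, mul_comm y.1 x.1]
    exact h

end ChainBundles

/-! The first half holds for every nonnegatively graded `B`, finitely generated projective in each
degree. The relation ∼ is an additive congruence because the twisted homotopy `twistHomotopy` fails
to be additive under concatenation and under sums only by explicit boundaries (`dW_twistCross`,
`dW_twistSum`); so the generated congruence is the relation itself. A map of chain bundles preserves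
∼ and addition up to ∼ (`SymStr.Equiv.push`, `SymStr.push_add`).

Two normal complexes are cobordant exactly when their push-forwards to `B` are equivalent
(`NormalCx.cobordant_iff`). A cobordism is pushed forward along its classifying map. Conversely an
equivalence over `B` can be compressed to the (n+1)-skeleton, which then serves as the cobordism. In
the same way every structure on `B` is equivalent to one living on the n-skeleton, and that skeleton
is a normal complex with the given characteristic element. Compression works because the part of θ
(or η) in high degrees with s ≥ 0 is a chain of W^%, so it can be absorbed by ξ (or by adding a
boundary to ξ).

For the computation, B(∞) has rank one in each degree, so a structure is a pair of finitely
supported integer matrices `cφ`, `cθ` indexed by (p, q), the index s being determined by p + q. For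
h even the invariants are φ(h,h) + 2θ(h,h+1) − 2θ(h+1,h) mod 8 if n = 2h, φ(h,h+1) mod 2 if n = 2h +
1 and θ(h,h) mod 2 if n = 2h − 1. Under an equivalence the first changes by 4g(g+1) plus a multiple
of 8 and the last by g(g+1) plus an even number, where g is an entry of ξ; the moduli 8 and 2 come
from the evenness of g(g+1).

The invariants are complete (`SymStr.equiv_zero_of_vanishes`): for n ≥ 2 the first two rows and
columns can be cleared, with no obstruction since the relevant entries are far from the middle
dimension. The shift (p, q) ↦ (p + 2, q + 2) then identifies what remains with an (n−4)-dimensional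
structure. The descent ends at n = −2, −1, 0, 1, where the vanishing of the invariant is used
directly. Explicit structures realise the value 1 of each invariant. -/

namespace ChainBundles

/-! ### The tensor complex and slant products: Leibniz rule and transposition. -/

section tensorComplex

variable {C : Cx}

theorem dl_dl (i j k : ℤ) (x : C.X i) : dl C j k (dl C i j x) = 0 := by
  exact ConcreteCategory.congr_hom (C.d_comp_d i j k) x

theorem sgn_congr_neg {M : Type} [AddCommGroup M] {a b : ℤ} (h : Odd (a - b)) (x : M) :
    sgn a x = -sgn b x := by
  rw [neg_sgn]
  refine sgn_congr ?_ x
  rw [show a - (1 + b) = a - b - 1 by ring]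
  exact h.sub_odd odd_one

theorem sgn_sub {M : Type} [AddCommGroup M] (a b : ℤ) (x : M) :
    sgn (a - b) x = sgn a (sgn b x) := by
  rw [← sgn_add]
  exact sgn_congr ⟨-b, by ring⟩ x

theorem sgn_one {M : Type} [AddCommGroup M] (x : M) : sgn 1 x = -x := sgn_odd (by decide) x

theorem sgn_zero {M : Type} [AddCommGroup M] (x : M) : sgn 0 x = x := sgn_even (by decide) x

theorem sgn_two {M : Type} [AddCommGroup M] (x : M) : sgn 2 x = x := sgn_even (by decide) x

theorem sgn_sgn {M : Type} [AddCommGroup M] (k : ℤ) (x : M) : sgn k (sgn k x) = x := by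
  rw [← sgn_add, sgn_even ⟨k, rfl⟩]

theorem dT_dT (x : Tens C) : dT C (dT C x) = 0 := by
  funext p q
  change (dl C (q + 1) q).lTensor (C.X p) ((dl C (q + 1 + 1) (q + 1)).lTensor (C.X p)
      (x p (q + 1 + 1)) +
      sgn (q + 1) ((dl C (p + 1) p).rTensor (C.X (q + 1)) (x (p + 1) (q + 1)))) +
    sgn q ((dl C (p + 1) p).rTensor (C.X q)
      ((dl C (q + 1) q).lTensor (C.X (p + 1)) (x (p + 1) (q + 1)) +
        sgn q ((dl C (p + 1 + 1) (p + 1)).rTensor (C.X q) (x (p + 1 + 1) q)))) = 0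
  have h1 : dl C (q + 1) q ∘ₗ dl C (q + 1 + 1) (q + 1) = 0 := by
    ext x; exact dl_dl _ _ _ x
  have h2 : dl C (p + 1) p ∘ₗ dl C (p + 1 + 1) (p + 1) = 0 := by
    ext x; exact dl_dl _ _ _ x
  have h3 : (dl C (q + 1) q).lTensor (C.X p)
      ((dl C (p + 1) p).rTensor (C.X (q + 1)) (x (p + 1) (q + 1))) =
      (dl C (p + 1) p).rTensor (C.X q)
      ((dl C (q + 1) q).lTensor (C.X (p + 1)) (x (p + 1) (q + 1))) := by
    rw [← LinearMap.comp_apply, ← LinearMap.comp_apply, LinearMap.lTensor_comp_rTensor,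
      LinearMap.rTensor_comp_lTensor]
  have h4 : (dl C (q + 1) q).lTensor (C.X p)
      ((dl C (q + 1 + 1) (q + 1)).lTensor (C.X p) (x p (q + 1 + 1))) = 0 := by
    rw [← LinearMap.comp_apply, ← LinearMap.lTensor_comp, h1]; simp
  have h5 : (dl C (p + 1) p).rTensor (C.X q)
      ((dl C (p + 1 + 1) (p + 1)).rTensor (C.X q) (x (p + 1 + 1) q)) = 0 := by
    rw [← LinearMap.comp_apply, ← LinearMap.rTensor_comp, h2]; simp
  rw [map_add, map_add, map_sgn, map_sgn, h3, h4, h5, add_comm q 1, ← neg_sgn]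
  simp

theorem trT_trT (x : Tens C) : trT C (trT C x) = x := by
  funext p q
  change sgn (p * q) (TensorProduct.comm ℤ _ _ (sgn (q * p) (TensorProduct.comm ℤ _ _ (x p q)))) = _
  rw [map_sgn, mul_comm q p, sgn_sgn]
  exact (TensorProduct.comm ℤ (C.X p) (C.X q)).symm_apply_apply _

theorem comm_rTensor {A B D : Type} [AddCommGroup A] [AddCommGroup B] [AddCommGroup D]
    (f : A →ₗ[ℤ] B) (x : A ⊗[ℤ] D) :
    TensorProduct.comm ℤ B D (f.rTensor D x) = f.lTensor D (TensorProduct.comm ℤ A D x) := by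
  induction x with
  | zero => simp
  | add x y hx hy => simp only [map_add, hx, hy]
  | tmul a d => rfl

theorem comm_lTensor {A B D : Type} [AddCommGroup A] [AddCommGroup B] [AddCommGroup D]
    (f : A →ₗ[ℤ] B) (x : D ⊗[ℤ] A) :
    TensorProduct.comm ℤ D B (f.lTensor D x) = f.rTensor D (TensorProduct.comm ℤ D A x) := by
  induction x with
  | zero => simp
  | add x y hx hy => simp only [map_add, hx, hy]
  | tmul a d => rfl

theorem dT_trT (x : Tens C) : dT C (trT C x) = trT C (dT C x) := by
  funext p q
  change (dl C (q + 1) q).lTensor (C.X p) (sgn (p * (q + 1))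
      (TensorProduct.comm ℤ _ _ (x (q + 1) p))) +
    sgn q ((dl C (p + 1) p).rTensor (C.X q) (sgn ((p + 1) * q)
      (TensorProduct.comm ℤ _ _ (x q (p + 1))))) =
    sgn (p * q) (TensorProduct.comm ℤ _ _ ((dl C (p + 1) p).lTensor (C.X q) (x q (p + 1)) +
      sgn p ((dl C (q + 1) q).rTensor (C.X p) (x (q + 1) p))))
  rw [map_add, map_sgn, map_sgn, comm_lTensor, map_sgn (TensorProduct.comm ℤ (C.X q) (C.X p)),
    comm_rTensor, map_add, ← sgn_add, ← sgn_add, add_comm]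
  exact congrArg₂ (· + ·) (sgn_congr ⟨q, by ring⟩ _) (sgn_congr ⟨0, by ring⟩ _)

/-- Since T is an involution, 1 + (-1)^s T and 1 + (-1)^(s-1) T multiply to zero; the mixed terms
cancel by sign because d commutes with T. -/
theorem tateD_tateD {M : Type} [AddCommGroup M] {d T : M →+ M} (hd : ∀ x, d (d x) = 0)
    (hT : ∀ x, T (T x) = x) (hdT : ∀ x, d (T x) = T (d x)) (m : ℤ) (θ : ℤ → M) :
    tateD d T m (tateD d T (m + 1) θ) = 0 := by
  funext s
  change d (d (θ s) + sgn (m + 1 + s - 1) (θ (s - 1) + sgn s (T (θ (s - 1))))) +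
    sgn (m + s - 1) ((d (θ (s - 1)) + sgn (m + 1 + (s - 1) - 1) (θ (s - 1 - 1) +
      sgn (s - 1) (T (θ (s - 1 - 1))))) + sgn s (T (d (θ (s - 1)) +
        sgn (m + 1 + (s - 1) - 1) (θ (s - 1 - 1) + sgn (s - 1) (T (θ (s - 1 - 1))))))) = 0
  simp only [map_add, map_sgn d, map_sgn T, hd, hdT, hT]
  generalize θ (s - 1 - 1) = u
  generalize d (θ (s - 1)) = v
  simp only [sgn_add, sgn_sub, sgn_one, map_neg]
  by_cases hm : Even m <;> by_cases hs : Even s <;>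
    simp only [sgn_even, sgn_odd, hm, hs, not_false_eq_true, map_neg] <;> abel

theorem dW_dW {m k : ℤ} (h : k = m + 1) (θ : ℤ → Tens C) : dW C m (dW C k θ) = 0 := by
  subst h
  exact tateD_tateD dT_dT trT_trT dT_trT m θ

/-- The Leibniz rule for slant products. -/
theorem dT_slant_general (m k : ℤ) (x y : Tens C) (g : Form C) :
    dT C (slant m k x y g) = sgn (m + k) (slant m k x y (dF C g)) +
      slant m (k - 1) x (dT C y) g + sgn k (slant (m - 1) k (dT C x) y g) := by
  funext p q
  rw [Pi.add_apply, Pi.add_apply, Pi.add_apply, Pi.add_apply, sgn_apply₂, sgn_apply₂]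
  change TensorProduct.map LinearMap.id (dl C (q + 1) q) (sgn (m * (k - (q + 1)))
      (contr (g (m - p) (k - (q + 1))) (x (m - p) p) (y (k - (q + 1)) (q + 1)))) +
    sgn q (TensorProduct.map (dl C (p + 1) p) LinearMap.id (sgn (m * (k - q))
      (contr (g (m - (p + 1)) (k - q)) (x (m - (p + 1)) (p + 1)) (y (k - q) q)))) =
    sgn (m + k) (sgn (m * (k - q)) (contr
      (sgn (k - q - 1) ((g (m - p) (k - q - 1)).compl₂ (dl C (k - q) (k - q - 1))) +
      sgn (m - p + (k - q) - 1) ((g (m - p - 1) (k - q)).comp (dl C (m - p) (m - p - 1))))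
      (x (m - p) p) (y (k - q) q))) +
    sgn (m * (k - 1 - q)) (contr (g (m - p) (k - 1 - q)) (x (m - p) p) (dT C y (k - 1 - q) q)) +
    sgn k (sgn ((m - 1) * (k - q)) (contr (g (m - 1 - p) (k - q)) (dT C x (m - 1 - p) p)
      (y (k - q) q)))
  have e1 : k - q - 1 = k - (q + 1) := by ring
  have e2 : m - p - 1 = m - (p + 1) := by ring
  have e3 : k - 1 - q = k - (q + 1) := by ring
  have e4 : m - 1 - p = m - (p + 1) := by ring
  rw [e1, e2, e3, e4]
  have h1 := contr_map (LinearMap.id : C.X (m - p) →ₗ[ℤ] _) (LinearMap.id : C.X (k - (q + 1)) →ₗ[ℤ] _)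
    (LinearMap.id : C.X p →ₗ[ℤ] _) (dl C (q + 1) q) (g (m - p) (k - (q + 1)))
    (x (m - p) p) (y (k - (q + 1)) (q + 1))
  have h2 := contr_map (LinearMap.id : C.X (m - (p + 1)) →ₗ[ℤ] _) (LinearMap.id : C.X (k - q) →ₗ[ℤ] _)
    (dl C (p + 1) p) (LinearMap.id : C.X q →ₗ[ℤ] _) (g (m - (p + 1)) (k - q))
    (x (m - (p + 1)) (p + 1)) (y (k - q) q)
  have h3 := contr_map (LinearMap.id : C.X (m - p) →ₗ[ℤ] _) (dl C (k - q) (k - (q + 1)))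
    (LinearMap.id : C.X p →ₗ[ℤ] _) (LinearMap.id : C.X q →ₗ[ℤ] _) (g (m - p) (k - (q + 1)))
    (x (m - p) p) (y (k - q) q)
  have h4 := contr_map (dl C (m - p) (m - (p + 1))) (LinearMap.id : C.X (k - q) →ₗ[ℤ] _)
    (LinearMap.id : C.X p →ₗ[ℤ] _) (LinearMap.id : C.X q →ₗ[ℤ] _) (g (m - (p + 1)) (k - q))
    (x (m - p) p) (y (k - q) q)
  -- The definition of `dT` trades the differential on the second tensor factor for the one on the
  -- first, which `contr_map` then moves onto the form, producing `dF`; the remainders are the terms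
  -- in `dT C x` and `dT C y`.
  have c {b b' : ℤ} (z : Tens C) (q : ℤ) (hb : b' = b + 1) :
      TensorProduct.map LinearMap.id (dl C (q + 1) q) (z b (q + 1)) =
      dT C z b q - sgn q (TensorProduct.map (dl C b' b) LinearMap.id (z b' q)) := by
    subst hb
    exact (eq_sub_of_add_eq rfl)
  have c1 := c (b := k - (q + 1)) (b' := k - q) y q (by ring)
  have c2 := c (b := m - (p + 1)) (b' := m - p) x p (by ring)
  simp only [TensorProduct.map_id, LinearMap.id_apply, LinearMap.compl₁₂_id_id] at h1 h2 h3 h4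
  rw [map_sgn, map_sgn, ← h1, ← h2, c1, c2, contr_add, contr_sgn, contr_sgn]
  simp only [map_sub, LinearMap.sub_apply, contr_sgn_left, contr_sgn_right]
  rw [h3, h4]
  rw [show (g (m - p) (k - (q + 1))).compl₁₂ LinearMap.id (dl C (k - q) (k - (q + 1))) =
      (g (m - p) (k - (q + 1))).compl₂ (dl C (k - q) (k - (q + 1))) from rfl,
    show (g (m - (p + 1)) (k - q)).compl₁₂ (dl C (m - p) (m - (p + 1))) LinearMap.id =
      (g (m - (p + 1)) (k - q)).comp (dl C (m - p) (m - (p + 1))) from rfl]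
  generalize contr ((g (m - (p + 1)) (k - q)).comp
      (dl C (m - p) (m - (p + 1)))) (x (m - p) p) (y (k - q) q) = A
  generalize contr ((g (m - p) (k - (q + 1))).compl₂
      (dl C (k - q) (k - (q + 1)))) (x (m - p) p) (y (k - q) q) = B
  generalize contr (g (m - p) (k - (q + 1))) (x (m - p) p) (dT C y (k - (q + 1)) q) = E
  generalize contr (g (m - (p + 1)) (k - q)) (dT C x (m - (p + 1)) p) (y (k - q) q) = F
  simp only [map_add, ← sgn_add]
  rw [sgn_congr_neg (a := m * (k - (q + 1)) + q) (b := m + k + (m * (k - q) + (k - (q + 1))))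
      ⟨-m + q - k, by ring⟩ B,
    sgn_congr_neg (a := q + (m * (k - q) + p))
      (b := m + k + (m * (k - q) + (m - p + (k - q) - 1))) ⟨q + p - m - k, by ring⟩ A,
    sgn_congr (a := q + m * (k - q)) (b := k + (m - 1) * (k - q)) ⟨q - k + (k-q), by ring⟩ F]
  abel

theorem trT_slant_general (m k : ℤ) (x y : Tens C) (g : Form C) :
    trT C (slant m k x y g) = sgn (m * k) (slant k m y x (trF C g)) := by
  funext p q
  rw [sgn_apply₂]
  change sgn (p * q) (TensorProduct.comm ℤ (C.X q) (C.X p)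
    (sgn (m * (k - p)) (contr (g (m - q) (k - p)) (x (m - q) q) (y (k - p) p)))) =
    sgn (m * k) (sgn (k * (m - q)) (contr (sgn ((k - p) * (m - q)) (g (m - q) (k - p)).flip)
      (y (k - p) p) (x (m - q) q)))
  rw [map_sgn, comm_contr, contr_sgn, ← sgn_add, ← sgn_add, ← sgn_add]
  apply sgn_congr
  by_cases hn : Even m <;> by_cases hk : Even k <;> by_cases hp : Even p <;> by_cases hq : Even q <;>
    simp [Int.even_add, Int.even_sub, Int.even_mul, hn, hk, hp, hq]

theorem slant_neg_left (m k : ℤ) (x y : Tens C) (g : Form C) :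
    slant m k (-x) y g = -slant m k x y g := by
  rw [eq_neg_iff_add_eq_zero, ← slant_add_left]
  funext p q; simp [slant]

theorem slant_neg_right (m k : ℤ) (x y : Tens C) (g : Form C) :
    slant m k x (-y) g = -slant m k x y g := by
  rw [eq_neg_iff_add_eq_zero, ← slant_add_right]
  funext p q; simp [slant]

theorem slant_zero_left (m k : ℤ) (y : Tens C) (g : Form C) : slant m k 0 y g = 0 := by
  funext p q; simp [slant]

theorem slant_zero_right (m k : ℤ) (x : Tens C) (g : Form C) : slant m k x 0 g = 0 := by
  funext p q; simp [slant]

theorem slant_sub_left (m k : ℤ) (x x' y : Tens C) (g : Form C) :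
    slant m k (x - x') y g = slant m k x y g - slant m k x' y g := by
  rw [sub_eq_add_neg, slant_add_left, slant_neg_left, ← sub_eq_add_neg]

theorem slant_sub_right (m k : ℤ) (x y y' : Tens C) (g : Form C) :
    slant m k x (y - y') g = slant m k x y g - slant m k x y' g := by
  rw [sub_eq_add_neg, slant_add_right, slant_neg_right, ← sub_eq_add_neg]

end tensorComplex

/-! ### Twisted homotopies and the chains that compare them. -/

section homotopies

variable {C : Cx}

/-- The analogue of `twistHomotopy` for a chain of forms of degree `r`. -/
noncomputable def twistHomotopyDeg (n r : ℤ) (g x y : Tens C) (γ : ℤ → Form C) :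
    ℤ → Tens C := fun s =>
  slant n (n + 1) x g (γ (s - n)) + sgn n (slant (n + 1) n g y (γ (s - n))) +
    sgn (n + r) (slant (n + 1) (n + 1) g g (trF C (γ (s - n - 1))))

theorem twistHomotopyDeg_zero (n : ℤ) (g x y : Tens C) (γ : ℤ → Form C) :
    twistHomotopyDeg n 0 g x y γ = twistHomotopy n g x y γ := by
  funext s
  simp only [twistHomotopyDeg, twistHomotopy, add_zero]

theorem twistHomotopyDeg_zero_form (n r : ℤ) (g x y : Tens C) :
    twistHomotopyDeg n r g x y 0 = 0 := by
  funext s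
  simp only [twistHomotopyDeg, Pi.zero_apply, map_zero, slant_zero, add_zero]

-- The homotopy formula for chains of forms that need not be cycles. Degree 0 is the case of a
-- bundle; degree 1 is applied to the chain χ of a bundle map. After the Leibniz rule only signs
-- remain, settled by the parities of n, s and r.
set_option maxHeartbeats 1000000 in
theorem dW_twistHomotopyDeg (n r : ℤ) {g x y : Tens C} (hx : dT C x = 0) (hy : dT C y = 0)
    (hg : dT C g = y - x) (F : ℤ → Form C) :
    dW C (n + 1 + r) (twistHomotopyDeg n r g x y F) =
      twist n y F - twist n x F - twistHomotopyDeg n (r - 1) g x y (dWF C r F) := by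
  funext s
  change dT C (slant n (n + 1) x g (F (s - n)) + sgn n (slant (n + 1) n g y (F (s - n))) +
      sgn (n + r) (slant (n + 1) (n + 1) g g (trF C (F (s - n - 1))))) +
    sgn (n + 1 + r + s - 1) ((slant n (n + 1) x g (F (s - 1 - n)) +
      sgn n (slant (n + 1) n g y (F (s - 1 - n))) +
      sgn (n + r) (slant (n + 1) (n + 1) g g (trF C (F (s - 1 - n - 1))))) +
      sgn s (trT C (slant n (n + 1) x g (F (s - 1 - n)) +
      sgn n (slant (n + 1) n g y (F (s - 1 - n))) +
      sgn (n + r) (slant (n + 1) (n + 1) g g (trF C (F (s - 1 - n - 1))))))) =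
    slant n n y y (F (s - n)) - slant n n x x (F (s - n)) -
      (slant n (n + 1) x g (dF C (F (s - n)) + sgn (r + (s - n) - 1)
        (F (s - n - 1) + sgn (s - n) (trF C (F (s - n - 1))))) +
      sgn n (slant (n + 1) n g y (dF C (F (s - n)) + sgn (r + (s - n) - 1)
        (F (s - n - 1) + sgn (s - n) (trF C (F (s - n - 1)))))) +
      sgn (n + (r - 1)) (slant (n + 1) (n + 1) g g (trF C (dF C (F (s - n - 1)) + sgn (r + (s - n - 1) - 1)
        (F (s - n - 1 - 1) + sgn (s - n - 1) (trF C (F (s - n - 1 - 1))))))))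
  rw [show s - 1 - n = s - n - 1 by ring]
  generalize F (s - n - 1 - 1) = c
  generalize F (s - n - 1) = b
  generalize F (s - n) = a
  simp only [map_add, map_sgn (dT C), map_sgn (trT C), map_sgn (trF C), dT_slant_general,
    trT_slant_general, hx, hy, hg, dF_trF, trF_trF, slant_add, slant_sgn, slant_neg,
        slant_zero_left,
    slant_zero_right, slant_sub_left, slant_sub_right, add_sub_cancel_right, map_sub, map_zero,
    add_mul, mul_add, one_mul, mul_one, sgn_add, sgn_sub, sgn_one, map_neg]
  by_cases hn : Even n <;> by_cases hs : Even s <;> by_cases hr : Even r <;>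
    simp only [sgn_even, sgn_odd, hn, hs, hr, not_false_eq_true, map_neg, Int.even_mul, or_self]
        <;> abel

theorem dW_twistHomotopy (n : ℤ) {g x y : Tens C} (hx : dT C x = 0) (hy : dT C y = 0)
    (hg : dT C g = y - x) (γ : Bundle C) :
    dW C (n + 1) (twistHomotopy n g x y γ.form) = twist n y γ.form - twist n x γ.form := by
  have h := dW_twistHomotopyDeg n 0 hx hy hg γ.form
  rwa [twistHomotopyDeg_zero, γ.cycle, twistHomotopyDeg_zero_form, add_zero, sub_zero] at h

/-- The chain whose boundary measures the failure of additivity of `twistHomotopy`. -/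
noncomputable def twistCross (n : ℤ) (g g' : Tens C) (γ : ℤ → Form C) : ℤ → Tens C := fun s =>
  sgn n (slant (n + 1) (n + 1) g g' (γ (s - n)))

/-- The quadratic term of the homotopy produces products of g with g', and these bound. Transitivity
and symmetry of equivalence rest on this. -/
theorem dW_twistCross (n : ℤ) {g g' x y z : Tens C} (hg : dT C g = y - x)
    (hg' : dT C g' = z - y) (γ : Bundle C) :
    dW C (n + 2) (twistCross n g g' γ.form) =
      twistHomotopy n (g + g') x z γ.form - twistHomotopy n g x y γ.form -
        twistHomotopy n g' y z γ.form := by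
  funext s
  have hc : dF C (γ.form (s - n)) + sgn (0 + (s - n) - 1) (γ.form (s - n - 1) +
      sgn (s - n) (trF C (γ.form (s - n - 1)))) = 0 := congrFun γ.cycle (s - n)
  change dT C (sgn n (slant (n + 1) (n + 1) g g' (γ.form (s - n)))) + sgn (n + 2 + s - 1)
    (sgn n (slant (n + 1) (n + 1) g g' (γ.form (s - 1 - n))) +
      sgn s (trT C (sgn n (slant (n + 1) (n + 1) g g' (γ.form (s - 1 - n)))))) =
    (slant n (n + 1) x (g + g') (γ.form (s - n)) +
      sgn n (slant (n + 1) n (g + g') z (γ.form (s - n))) +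
      sgn n (slant (n + 1) (n + 1) (g + g') (g + g') (trF C (γ.form (s - n - 1))))) -
    (slant n (n + 1) x g (γ.form (s - n)) + sgn n (slant (n + 1) n g y (γ.form (s - n))) +
      sgn n (slant (n + 1) (n + 1) g g (trF C (γ.form (s - n - 1))))) -
    (slant n (n + 1) y g' (γ.form (s - n)) + sgn n (slant (n + 1) n g' z (γ.form (s - n))) +
      sgn n (slant (n + 1) (n + 1) g' g' (trF C (γ.form (s - n - 1)))))
  rw [show s - 1 - n = s - n - 1 by ring]
  simp only [map_sgn (dT C), dT_slant_general, eq_neg_of_add_eq_zero_left hc]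
  generalize γ.form (s - n - 1) = b
  generalize γ.form (s - n) = a
  simp only [map_add, map_sgn (trT C), trT_slant_general, hg, hg', slant_add, slant_sgn, slant_neg,
    slant_sub_left, slant_sub_right, slant_add_left, slant_add_right, add_sub_cancel_right, map_sub,
    add_mul, mul_add, one_mul, mul_one, sgn_add, sgn_sub, sgn_one, sgn_zero, sgn_two, map_neg]
  by_cases hn : Even n <;> by_cases hs : Even s <;>
    simp only [sgn_even, sgn_odd, hn, hs, not_false_eq_true, map_neg, Int.even_mul, or_self] <;>
        abel

/-- The chain whose boundary is the twisted homotopy of a boundary. -/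
noncomputable def twistNull (n : ℤ) (h y : Tens C) (γ : ℤ → Form C) : ℤ → Tens C := fun s =>
  slant n (n + 2) y h (γ (s - n)) + slant (n + 2) n h y (γ (s - n)) -
    slant (n + 2) (n + 1) h (dT C h) (trF C (γ (s - n - 1))) -
    (slant (n + 2) (n + 2) h h (γ (s - n - 1 - 1)))

/-- Replacing ξ by ξ + dκ changes ξ₀ by the boundary of κ₀. Together with `dW_twistCross` this shows
that such a change can be compensated in η, as is needed to compress an equivalence. -/
theorem dW_twistNull (n : ℤ) {h y : Tens C} (hy : dT C y = 0) (γ : Bundle C) :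
    dW C (n + 2) (twistNull n h y γ.form) = twistHomotopy n (dT C h) y y γ.form := by
  funext s
  have hc : dF C (γ.form (s - n)) + sgn (0 + (s - n) - 1) (γ.form (s - n - 1) +
      sgn (s - n) (trF C (γ.form (s - n - 1)))) = 0 := congrFun γ.cycle (s - n)
  have hc1 : dF C (γ.form (s - n - 1)) + sgn (0 + (s - n - 1) - 1) (γ.form (s - n - 1 - 1) +
      sgn (s - n - 1) (trF C (γ.form (s - n - 1 - 1)))) = 0 := congrFun γ.cycle (s - n - 1)
  have hc2 : dF C (γ.form (s - n - 1 - 1)) + sgn (0 + (s - n - 1 - 1) - 1)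
      (γ.form (s - n - 1 - 1 - 1) + sgn (s - n - 1 - 1) (trF C (γ.form (s - n - 1 - 1 - 1)))) = 0 :=
    congrFun γ.cycle (s - n - 1 - 1)
  change dT C (slant n (n + 2) y h (γ.form (s - n)) + slant (n + 2) n h y (γ.form (s - n)) -
    slant (n + 2) (n + 1) h (dT C h) (trF C (γ.form (s - n - 1))) -
    (slant (n + 2) (n + 2) h h (γ.form (s - n - 1 - 1)))) + sgn (n + 2 + s - 1)
    ((slant n (n + 2) y h (γ.form (s - 1 - n)) + slant (n + 2) n h y (γ.form (s - 1 - n)) -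
    slant (n + 2) (n + 1) h (dT C h) (trF C (γ.form (s - 1 - n - 1))) -
    (slant (n + 2) (n + 2) h h (γ.form (s - 1 - n - 1 - 1)))) +
      sgn s (trT C (slant n (n + 2) y h (γ.form (s - 1 - n)) +
    slant (n + 2) n h y (γ.form (s - 1 - n)) -
    slant (n + 2) (n + 1) h (dT C h) (trF C (γ.form (s - 1 - n - 1))) -
    (slant (n + 2) (n + 2) h h (γ.form (s - 1 - n - 1 - 1)))))) =
    slant n (n + 1) y (dT C h) (γ.form (s - n)) +
      sgn n (slant (n + 1) n (dT C h) y (γ.form (s - n))) +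
      sgn n (slant (n + 1) (n + 1) (dT C h) (dT C h) (trF C (γ.form (s - n - 1))))
  rw [show s - 1 - n = s - n - 1 by ring]
  have e : n + 2 - 1 = n + 1 := by ring
  simp only [map_add, map_sub, dT_slant_general, hy, dT_dT, dF_trF,
    eq_neg_of_add_eq_zero_left hc, eq_neg_of_add_eq_zero_left hc1, eq_neg_of_add_eq_zero_left hc2]
  generalize γ.form (s - n - 1 - 1 - 1) = c'
  generalize γ.form (s - n - 1 - 1) = c
  generalize γ.form (s - n - 1) = b
  generalize γ.form (s - n) = a
  simp only [map_add, map_sgn (trF C), trF_trF, trT_slant_general, slant_add,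
    slant_sgn, slant_neg, slant_zero_left, slant_zero_right,
    add_sub_cancel_right, add_mul, mul_add, mul_one, sgn_add, sgn_sub, sgn_one, sgn_zero, sgn_two,
    map_neg,
    map_zero, e]
  by_cases hn : Even n <;> by_cases hs : Even s <;>
    simp only [sgn_even, sgn_odd, hn, hs, not_false_eq_true, map_neg, Int.even_mul, or_self,
      even_two, or_true, true_or] <;> abel

end homotopies

/-! ### Compatibility of twisted homotopies with sums and chain maps. -/

section additivity

variable {C D : Cx}

/-- For r = 1 and the chain χ of a bundle map this is the reason why push-forward is additive up to
equivalence. -/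
theorem dW_bracketDeg (n r : ℤ) {x y : Tens C} (hx : dT C x = 0) (hy : dT C y = 0)
    (F : ℤ → Form C) :
    dW C (n + 1 + r) (bracket n x y F) = bracket n x y (dWF C r F) +
      fun s => sgn r (twist n x F s + twist n y F s - twist n (x + y) F s) := by
  funext s
  change dT C (-slant n n x y (trF C (F (s - n + 1)))) + sgn (n + 1 + r + s - 1)
      (-slant n n x y (trF C (F (s - 1 - n + 1))) +
        sgn s (trT C (-slant n n x y (trF C (F (s - 1 - n + 1)))))) =
    -slant n n x y (trF C (dF C (F (s - n + 1)) + sgn (r + (s - n + 1) - 1)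
      (F (s - n + 1 - 1) + sgn (s - n + 1) (trF C (F (s - n + 1 - 1)))))) +
    sgn r (slant n n x x (F (s - n)) + slant n n y y (F (s - n)) -
      slant n n (x + y) (x + y) (F (s - n)))
  rw [show s - 1 - n + 1 = s - n by ring, show s - n + 1 - 1 = s - n by ring]
  generalize F (s - n + 1) = a
  generalize F (s - n) = b
  simp only [map_add, map_sgn (trF C), map_neg, dT_slant_general,
    trT_slant_general, hx, hy, dF_trF, trF_trF, slant_add, slant_zero_left,
    slant_zero_right, slant_add_left, slant_add_right, map_sub, map_zero, sgn_add, sgn_sub, sgn_one]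
  by_cases hn : Even n <;> by_cases hs : Even s <;> by_cases hr : Even r <;>
    simp only [sgn_even, sgn_odd, hn, hs, hr, not_false_eq_true, map_neg, Int.even_mul, or_self,
      slant_neg] <;> abel

/-- The chain comparing `twistHomotopy` with the sum of structures. -/
noncomputable def twistSum (n : ℤ) (g y' x g' : Tens C) (γ : ℤ → Form C) : ℤ → Tens C := fun s =>
  -sgn n (slant (n + 1) n g y' (trF C (γ (s - n + 1)))) -
    slant n (n + 1) x g' (trF C (γ (s - n + 1))) +
    sgn n (slant (n + 1) (n + 1) g' g (γ (s - n)))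

-- The products mixing the data g, x, y with g', x', y' agree up to a boundary with the difference
-- of the two brackets. This makes equivalence compatible with addition of structures.
set_option maxHeartbeats 1000000 in
theorem dW_twistSum (n : ℤ) {g y x g' y' x' : Tens C} (hx : dT C x = 0) (hy' : dT C y' = 0)
    (hg : dT C g = y - x) (hg' : dT C g' = y' - x') (γ : Bundle C) :
    dW C (n + 2) (twistSum n g y' x g' γ.form) =
      twistHomotopy n (g + g') (x + x') (y + y') γ.form - twistHomotopy n g x y γ.form -
        twistHomotopy n g' x' y' γ.form + bracket n y y' γ.form - bracket n x x' γ.form := by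
  funext s
  have hc : dF C (γ.form (s - n + 1)) + sgn (0 + (s - n + 1) - 1) (γ.form (s - n + 1 - 1) +
      sgn (s - n + 1) (trF C (γ.form (s - n + 1 - 1)))) = 0 := congrFun γ.cycle (s - n + 1)
  have hc0 : dF C (γ.form (s - n)) + sgn (0 + (s - n) - 1) (γ.form (s - n - 1) +
      sgn (s - n) (trF C (γ.form (s - n - 1)))) = 0 := congrFun γ.cycle (s - n)
  change dT C (-sgn n (slant (n + 1) n g y' (trF C (γ.form (s - n + 1)))) -
      slant n (n + 1) x g' (trF C (γ.form (s - n + 1))) +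
      sgn n (slant (n + 1) (n + 1) g' g (γ.form (s - n)))) + sgn (n + 2 + s - 1)
    ((-sgn n (slant (n + 1) n g y' (trF C (γ.form (s - 1 - n + 1)))) -
      slant n (n + 1) x g' (trF C (γ.form (s - 1 - n + 1))) +
      sgn n (slant (n + 1) (n + 1) g' g (γ.form (s - 1 - n)))) +
      sgn s (trT C (-sgn n (slant (n + 1) n g y' (trF C (γ.form (s - 1 - n + 1)))) -
      slant n (n + 1) x g' (trF C (γ.form (s - 1 - n + 1))) +
      sgn n (slant (n + 1) (n + 1) g' g (γ.form (s - 1 - n)))))) =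
    (slant n (n + 1) (x + x') (g + g') (γ.form (s - n)) +
      sgn n (slant (n + 1) n (g + g') (y + y') (γ.form (s - n))) +
      sgn n (slant (n + 1) (n + 1) (g + g') (g + g') (trF C (γ.form (s - n - 1))))) -
    (slant n (n + 1) x g (γ.form (s - n)) + sgn n (slant (n + 1) n g y (γ.form (s - n))) +
      sgn n (slant (n + 1) (n + 1) g g (trF C (γ.form (s - n - 1))))) -
    (slant n (n + 1) x' g' (γ.form (s - n)) + sgn n (slant (n + 1) n g' y' (γ.form (s - n))) +
      sgn n (slant (n + 1) (n + 1) g' g' (trF C (γ.form (s - n - 1))))) +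
    -slant n n y y' (trF C (γ.form (s - n + 1))) - -slant n n x x' (trF C (γ.form (s - n + 1)))
  rw [show s - 1 - n + 1 = s - n by ring, show s - 1 - n = s - n - 1 by ring]
  rw [show s - n + 1 - 1 = s - n by ring] at hc
  simp only [map_add, map_sub, map_neg, map_sgn (dT C), dT_slant_general, dF_trF,
    eq_neg_of_add_eq_zero_left hc, eq_neg_of_add_eq_zero_left hc0]
  clear hc hc0
  generalize γ.form (s - n + 1) = c
  generalize γ.form (s - n - 1) = b
  generalize γ.form (s - n) = a
  simp only [map_add, map_neg, map_sgn (trT C), map_sgn (trF C), trF_trF, trT_slant_general, hx,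
      hy',
    hg, hg', slant_add, slant_sgn, slant_neg, slant_sub_left, slant_sub_right, slant_add_left,
    slant_add_right, slant_zero_left, slant_zero_right, add_sub_cancel_right, map_sub, map_zero,
    add_mul, mul_add, one_mul, mul_one, sgn_add, sgn_sub, sgn_one, sgn_zero, sgn_two]
  by_cases hn : Even n <;> by_cases hs : Even s <;>
    simp only [sgn_even, sgn_odd, hn, hs, not_false_eq_true, map_neg, Int.even_mul, or_self] <;>
        abel

theorem slant_push_general (m k : ℤ) (f : C ⟶ D) (x y : Tens C) (g : Form D) :
    slant m k (pushT f x) (pushT f y) g = pushT f (slant m k x y (pullF f f g)) := by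
  funext p q
  change sgn _ (contr _ (TensorProduct.map _ _ _) (TensorProduct.map _ _ _)) =
    TensorProduct.map _ _ (sgn _ (contr _ _ _))
  rw [map_sgn, contr_map]
  rfl

theorem twistHomotopy_push (f : C ⟶ D) (n : ℤ) (g x y : Tens C) (γ : ℤ → Form D) :
    twistHomotopy n (pushT f g) (pushT f x) (pushT f y) γ =
      pushW f (twistHomotopy n g x y (pullW f γ)) := by
  funext s
  change slant n (n + 1) (pushT f x) (pushT f g) (γ (s - n)) +
    sgn n (slant (n + 1) n (pushT f g) (pushT f y) (γ (s - n))) +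
    sgn n (slant (n + 1) (n + 1) (pushT f g) (pushT f g) (trF D (γ (s - n - 1)))) =
    pushT f (slant n (n + 1) x g (pullF f f (γ (s - n))) +
    sgn n (slant (n + 1) n g y (pullF f f (γ (s - n)))) +
    sgn n (slant (n + 1) (n + 1) g g (trF C (pullF f f (γ (s - n - 1))))))
  simp only [map_add, map_sgn (pushT f), slant_push_general, trF_pull]

theorem bracket_push (f : C ⟶ D) (n : ℤ) (x y : Tens C) (γ : ℤ → Form D) :
    bracket n (pushT f x) (pushT f y) γ = pushW f (bracket n x y (pullW f γ)) := by
  funext s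
  change -slant n n (pushT f x) (pushT f y) (trF D (γ (s - n + 1))) =
    pushT f (-slant n n x y (trF C (pullF f f (γ (s - n + 1)))))
  rw [map_neg, slant_push_general, trF_pull]

theorem twistHomotopy_add_form (n : ℤ) (g x y : Tens C) (γ δ : ℤ → Form C) :
    twistHomotopy n g x y (γ + δ) = twistHomotopy n g x y γ + twistHomotopy n g x y δ := by
  funext s
  simp only [twistHomotopy, Pi.add_apply, map_add, slant_add]
  abel

theorem bracket_add_form (n : ℤ) (x y : Tens C) (γ δ : ℤ → Form C) :
    bracket n x y (γ + δ) = bracket n x y γ + bracket n x y δ := by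
  funext s
  simp only [bracket, Pi.add_apply, map_add, slant_add]
  abel

end additivity

/-! ### Degrees and finiteness of the auxiliary chains. -/

section membership

variable {C D : Cx}

/-- `x` vanishes outside a finite range of bidegrees. -/
def Bounded (x : Tens C) : Prop := ∃ N : ℤ, ∀ p q, N < |p| ∨ N < |q| → x p q = 0

theorem bounded_apply {n : ℤ} {θ : ℤ → Tens C} (h : θ ∈ hyperChains C n) (s : ℤ) :
    Bounded (θ s) := by
  obtain ⟨-, N, hN⟩ := h
  exact ⟨N, hN s⟩

/-- The component (p, q) of a slant product involves x only in second degree p and y only in second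
degree q, so bounds on the factors are enough, even when the form has infinite support. -/
theorem slant_mem {m k r j : ℤ} {x y : Tens C} (hx : Bounded x) (hy : Bounded y)
    {F : ℤ → Form C} (hF : F ∈ formChains C r) {N : ℤ} (hN : N = m + k + r - j) :
    (fun s => slant m k x y (F (s - j))) ∈ hyperChains C N := by
  obtain ⟨M, hM⟩ := hx
  obtain ⟨L, hL⟩ := hy
  refine ⟨fun s p q e => ?_, max M L, fun s p q e => ?_⟩
  · change sgn _ (contr (F (s - j) (m - p) (k - q)) _ _) = 0
    rw [hF (s - j) (m - p) (k - q) (by omega), contr_zero, map_zero]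
  · change sgn _ (contr _ (x (m - p) p) (y (k - q) q)) = 0
    simp only [max_lt_iff] at e
    rcases e with e | e
    · rw [hM _ _ (Or.inr e.1)]; simp
    · rw [hL _ _ (Or.inr e.2)]; simp

theorem trF_mem {r : ℤ} {F : ℤ → Form C} (hF : F ∈ formChains C r) :
    (fun s => trF C (F s)) ∈ formChains C r := by
  intro s p q e
  change sgn (p * q) (F s q p).flip = 0
  rw [hF s q p (by omega)]
  exact map_zero (sgn (p * q))

theorem sgn_mem {n : ℤ} {θ : ℤ → Tens C} (h : θ ∈ hyperChains C n) (k : ℤ) :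
    (fun s => sgn k (θ s)) ∈ hyperChains C n := by
  by_cases hk : Even k
  · simpa only [sgn_even hk] using h
  · simp only [sgn_odd hk]
    exact neg_mem h

theorem twistHomotopyDeg_mem {n r : ℤ} {g x y : Tens C} (hg : Bounded g) (hx : Bounded x)
    (hy : Bounded y) {F : ℤ → Form C} (hF : F ∈ formChains C r) :
    twistHomotopyDeg n r g x y F ∈ hyperChains C (n + 1 + r) := by
  refine add_mem (add_mem (slant_mem (r := r) hx hg hF (by ring))
    (sgn_mem (slant_mem (r := r) hg hy hF (by ring)) n))
    (sgn_mem (θ := fun s => slant (n + 1) (n + 1) g g (trF C (F (s - n - 1)))) ?_ (n + r))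
  simp only [sub_sub]
  exact slant_mem (r := r) hg hg (trF_mem hF) (by ring)

theorem twistHomotopy_mem {n : ℤ} {g x y : Tens C} (hg : Bounded g) (hx : Bounded x)
    (hy : Bounded y) (γ : Bundle C) :
    twistHomotopy n g x y γ.form ∈ hyperChains C (n + 1) := by
  have h := twistHomotopyDeg_mem (n := n) hg hx hy γ.mem
  rwa [twistHomotopyDeg_zero, add_zero] at h

theorem twistCross_mem {n : ℤ} {g g' : Tens C} (hg : Bounded g) (hg' : Bounded g')
    (γ : Bundle C) : twistCross n g g' γ.form ∈ hyperChains C (n + 2) :=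
  sgn_mem (slant_mem hg hg' γ.mem (by ring)) n

theorem twistSum_mem {n : ℤ} {g y' x g' : Tens C} (hg : Bounded g) (hy' : Bounded y')
    (hx : Bounded x) (hg' : Bounded g') (γ : Bundle C) :
    twistSum n g y' x g' γ.form ∈ hyperChains C (n + 2) := by
  have e (s : ℤ) : s - n + 1 = s - (n - 1) := by ring
  refine add_mem (sub_mem (neg_mem (sgn_mem (θ := fun s => slant (n + 1) n g y'
    (trF C (γ.form (s - n + 1)))) ?_ n)) ?_) (twistCross_mem hg' hg γ)
  · simp only [e]
    exact slant_mem hg hy' (trF_mem γ.mem) (by ring)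
  · simp only [e]
    exact slant_mem hx hg' (trF_mem γ.mem) (by ring)

theorem bounded_dT {x : Tens C} (hx : Bounded x) : Bounded (dT C x) := by
  obtain ⟨N, hN⟩ := hx
  refine ⟨N + 1, fun p q h => ?_⟩
  change (dl C (q + 1) q).lTensor (C.X p) (x p (q + 1)) +
    sgn q ((dl C (p + 1) p).rTensor (C.X q) (x (p + 1) q)) = 0
  rw [hN p (q + 1) (by
      have h1 := abs_sub_abs_le_abs_sub q (-1)
      simp only [abs_neg, abs_one, sub_neg_eq_add] at h1
      omega),
    hN (p + 1) q (by
      have h1 := abs_sub_abs_le_abs_sub p (-1)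
      simp only [abs_neg, abs_one, sub_neg_eq_add] at h1
      omega)]
  simp

theorem twistNull_mem {n : ℤ} {h y : Tens C} (hh : Bounded h) (hy : Bounded y)
    (γ : Bundle C) : twistNull n h y γ.form ∈ hyperChains C (n + 2) := by
  have e (s : ℤ) : s - n - 1 = s - (n + 1) := by ring
  have e' (s : ℤ) : s - n - 1 - 1 = s - (n + 2) := by ring
  refine sub_mem (sub_mem (add_mem (slant_mem hy hh γ.mem (by ring))
    (slant_mem hh hy γ.mem (by ring))) ?_) ?_
  · simp only [e]
    exact slant_mem hh (bounded_dT hh) (trF_mem γ.mem) (by ring)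
  · simp only [e']
    exact slant_mem hh hh γ.mem (by ring)

theorem dW_hyper {n m : ℤ} (h : n = m + 1) {θ : ℤ → Tens C} (hθ : θ ∈ hyperChains C n) :
    dW C n θ ∈ hyperChains C m := by
  subst h
  obtain ⟨h1, N, h2⟩ := hθ
  have key (s p q : ℤ) (e0 : θ s p (q + 1) = 0) (e1 : θ s (p + 1) q = 0)
      (e2 : θ (s - 1) p q = 0) (e3 : θ (s - 1) q p = 0) : dW C (m + 1) θ s p q = 0 := by
    change (dl C (q + 1) q).lTensor (C.X p) (θ s p (q + 1)) +
      sgn q ((dl C (p + 1) p).rTensor (C.X q) (θ s (p + 1) q)) +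
      sgn (m + 1 + s - 1) (θ (s - 1) + sgn s (trT C (θ (s - 1)))) p q = 0
    rw [sgn_apply₂, Pi.add_apply, Pi.add_apply, sgn_apply₂]
    change _ + sgn (m + 1 + s - 1) (θ (s - 1) p q + sgn s (sgn (p * q)
      (TensorProduct.comm ℤ _ _ (θ (s - 1) q p)))) = 0
    rw [e0, e1, e2, e3]
    simp
  refine ⟨fun s p q e => key s p q (h1 _ _ _ (by omega)) (h1 _ _ _ (by omega))
    (h1 _ _ _ (by omega)) (h1 _ _ _ (by omega)), N + 1, fun s p q e => key s p q ?_ ?_ ?_ ?_⟩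
  · have h := abs_sub_abs_le_abs_sub q (-1)
    simp only [abs_neg, abs_one, sub_neg_eq_add] at h
    exact h2 _ _ _ (by omega)
  · have h := abs_sub_abs_le_abs_sub p (-1)
    simp only [abs_neg, abs_one, sub_neg_eq_add] at h
    exact h2 _ _ _ (by omega)
  · exact h2 _ _ _ (by omega)
  · exact h2 _ _ _ (by omega)

theorem dW_sym {n m : ℤ} (h : n = m + 1) {ξ : ℤ → Tens C} (hξ : ξ ∈ symChains C n) :
    dW C n ξ ∈ symChains C m := by
  refine ⟨dW_hyper h hξ.1, fun s hs => ?_⟩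
  change dT C (ξ s) + sgn (n + s - 1) (ξ (s - 1) + sgn s (trT C (ξ (s - 1)))) = 0
  rw [hξ.2 s hs, hξ.2 (s - 1) (by omega)]
  simp

theorem dW_apply_zero {n : ℤ} {ξ : ℤ → Tens C} (hξ : ξ ∈ symChains C n) :
    dW C n ξ 0 = dT C (ξ 0) := by
  change dT C (ξ 0) + sgn (n + 0 - 1) (ξ (0 - 1) + sgn 0 (trT C (ξ (0 - 1)))) = dT C (ξ 0)
  rw [hξ.2 (0 - 1) (by norm_num)]
  simp

end membership

/-! ### Equivalence of symmetric structures as an additive congruence. -/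

namespace SymStr

variable {C D E : Cx} {γ : Bundle C} {δ : Bundle D} {n : ℤ}

theorem bounded (x : SymStr γ n) : Bounded (x.φ 0) := bounded_apply x.φ_mem.1 0

theorem dT_zero (x : SymStr γ n) : dT C (x.φ 0) = 0 := ChainBundles.dT_zero x.φ_mem x.φ_cycle

theorem add_φ (x y : SymStr γ n) : (x + y).φ = x.φ + y.φ := rfl

theorem add_θ (x y : SymStr γ n) :
    (x + y).θ = x.θ + y.θ + bracket n (x.φ 0) (y.φ 0) γ.form := rfl

theorem push_φ (a : BundleMap γ δ) (x : SymStr γ n) : (x.push a).φ = pushW a.f x.φ := rfl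

theorem push_θ (a : BundleMap γ δ) (x : SymStr γ n) :
    (x.push a).θ = pushW a.f x.θ - pushW a.f (twist n (x.φ 0) a.χ) := rfl

theorem bracket_add_left (x x' y : Tens C) (F : ℤ → Form C) :
    bracket n (x + x') y F = bracket n x y F + bracket n x' y F := by
  funext s
  simp only [bracket, slant_add_left, Pi.add_apply, neg_add]

theorem bracket_add_right (x y y' : Tens C) (F : ℤ → Form C) :
    bracket n x (y + y') F = bracket n x y F + bracket n x y' F := by
  funext s
  simp only [bracket, slant_add_right, Pi.add_apply, neg_add]

theorem bracket_zero_left (y : Tens C) (F : ℤ → Form C) : bracket n 0 y F = 0 := by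
  funext s
  simp only [bracket, slant_zero_left, Pi.zero_apply, neg_zero]

theorem bracket_neg_left (x y : Tens C) (F : ℤ → Form C) :
    bracket n (-x) y F = -bracket n x y F := by
  funext s
  simp only [bracket, slant_neg_left, Pi.neg_apply]

theorem bracket_neg_right (x y : Tens C) (F : ℤ → Form C) :
    bracket n x (-y) F = -bracket n x y F := by
  funext s
  simp only [bracket, slant_neg_right, Pi.neg_apply]

/-- Associativity is strict because the bracket is biadditive. -/
theorem add_assoc' (x y z : SymStr γ n) : x + y + z = x + (y + z) := by
  apply SymStr.ext
  · simp only [add_φ, add_assoc]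
  · simp only [add_θ, add_φ, Pi.add_apply, bracket_add_left, bracket_add_right]
    abel

noncomputable instance : Zero (SymStr γ n) where
  zero :=
    { φ := 0
      θ := 0
      φ_mem := zero_mem _
      φ_cycle := map_zero _
      θ_mem := zero_mem _
      eq := by
        rw [map_zero]
        funext s
        change (0 : Tens C) - slant n n 0 0 _ = 0
        rw [slant_zero_left, sub_zero] }

theorem zero_φ : (0 : SymStr γ n).φ = 0 := rfl

theorem zero_θ : (0 : SymStr γ n).θ = 0 := rfl

theorem zero_add' (x : SymStr γ n) : 0 + x = x := by
  apply SymStr.ext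
  · rw [add_φ, zero_φ, zero_add]
  · rw [add_θ, zero_θ, zero_φ, Pi.zero_apply, bracket_zero_left, zero_add, add_zero]

theorem add_zero' (x : SymStr γ n) : x + 0 = x := by
  apply SymStr.ext
  · rw [add_φ, zero_φ, add_zero]
  · rw [add_θ, zero_θ, zero_φ, Pi.zero_apply]
    have h := bracket_add_right (n := n) (x.φ 0) 0 0 γ.form
    rw [add_zero, left_eq_add] at h
    rw [h, add_zero, add_zero]

theorem twist_neg (x : Tens C) (F : ℤ → Form C) : twist n (-x) F = twist n x F := by
  funext s
  simp only [twist, slant_neg_left, slant_neg_right, neg_neg]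

/-- The bracket of φ₀ with itself is added so that -x + x is strictly 0; it also gives the right
boundary, since φ₀ and -φ₀ have the same twist. -/
noncomputable instance : Neg (SymStr γ n) where
  neg x :=
    { φ := -x.φ
      θ := -x.θ + bracket n (x.φ 0) (x.φ 0) γ.form
      φ_mem := neg_mem x.φ_mem
      φ_cycle := by rw [map_neg, x.φ_cycle, neg_zero]
      θ_mem := add_mem (neg_mem x.θ_mem) (bracket_mem x.φ_mem.1 x.φ_mem.1 γ.mem)
      eq := by
        have h := dW_bracket γ n x.dT_zero (y := -x.φ 0) (by rw [map_neg, x.dT_zero, neg_zero])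
        rw [bracket_neg_right, map_neg, twist_neg, add_neg_cancel] at h
        have h0 : twist n 0 γ.form = 0 := by
          funext s
          exact slant_zero_left n n 0 _
        rw [h0, sub_zero] at h
        rw [map_add, map_neg, ← x.eq, Pi.neg_apply, twist_neg, ← neg_neg (dW C (n + 1) _), h]
        abel }

theorem neg_add_cancel' (x : SymStr γ n) : -x + x = 0 := by
  apply SymStr.ext
  · change -x.φ + x.φ = 0
    rw [neg_add_cancel]
  · change -x.θ + bracket n (x.φ 0) (x.φ 0) γ.form + x.θ + bracket n (-x.φ 0) (x.φ 0) γ.form = 0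
    rw [bracket_neg_left]
    abel

theorem dT_of_eq {x y : SymStr γ n} {ξ : ℤ → Tens C} (hξ : ξ ∈ symChains C (n + 1))
    (h : y.φ - x.φ = dW C (n + 1) ξ) : dT C (ξ 0) = y.φ 0 - x.φ 0 := by
  rw [← dW_apply_zero hξ, ← h]
  rfl

theorem twistHomotopy_zero_left (x y : Tens C) (F : ℤ → Form C) :
    twistHomotopy n 0 x y F = 0 := by
  funext s
  simp only [twistHomotopy, slant_zero_left, slant_zero_right, map_zero, add_zero, Pi.zero_apply]

theorem Equiv.of_eta {x y : SymStr γ n} (hφ : y.φ = x.φ) {η : ℤ → Tens C}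
    (hη : η ∈ hyperChains C (n + 2)) (h : y.θ - x.θ = dW C (n + 2) η) : x.Equiv y := by
  refine ⟨0, zero_mem _, η, hη, by rw [hφ, sub_self, map_zero], ?_⟩
  rw [Pi.zero_apply, twistHomotopy_zero_left, h, sub_zero, add_zero]

theorem Equiv.refl (x : SymStr γ n) : x.Equiv x :=
  Equiv.of_eta rfl (zero_mem _) (by rw [sub_self, map_zero])

theorem Equiv.trans {x y z : SymStr γ n} (h : x.Equiv y) (h' : y.Equiv z) : x.Equiv z := by
  obtain ⟨ξ, hξ, η, hη, e, f⟩ := h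
  obtain ⟨ξ', hξ', η', hη', e', f'⟩ := h'
  refine ⟨ξ + ξ', add_mem hξ hξ', η + η' + twistCross n (ξ 0) (ξ' 0) γ.form,
    add_mem (add_mem hη hη') (twistCross_mem (bounded_apply hξ.1 0) (bounded_apply hξ'.1 0) γ), ?_,
        ?_⟩
  · rw [map_add, ← e, ← e']
    abel
  · rw [map_add, map_add, dW_twistCross n (dT_of_eq hξ e) (dT_of_eq hξ' e'), ← f, ← f',
        Pi.add_apply]
    abel

/-- Concatenating ξ₀ with -ξ₀ gives the zero homotopy, so their cross chain bounds minus the sum of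
the two twisted homotopies. -/
theorem Equiv.symm {x y : SymStr γ n} (h : x.Equiv y) : y.Equiv x := by
  obtain ⟨ξ, hξ, η, hη, e, f⟩ := h
  have e' : dT C (-ξ 0) = x.φ 0 - y.φ 0 := by rw [map_neg, dT_of_eq hξ e, neg_sub]
  refine ⟨-ξ, neg_mem hξ, -η - twistCross n (ξ 0) (-ξ 0) γ.form, sub_mem (neg_mem hη)
    (twistCross_mem (bounded_apply hξ.1 0) (bounded_apply (neg_mem hξ).1 0) γ), ?_, ?_⟩
  · rw [map_neg, ← e, neg_sub]
  · have h := dW_twistCross n (dT_of_eq hξ e) e' γ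
    rw [add_neg_cancel, twistHomotopy_zero_left] at h
    rw [map_sub, map_neg, h, ← f, Pi.neg_apply]
    abel

theorem Equiv.add {x x' y y' : SymStr γ n} (h : x.Equiv y) (h' : x'.Equiv y') :
    (x + x').Equiv (y + y') := by
  obtain ⟨ξ, hξ, η, hη, e, f⟩ := h
  obtain ⟨ξ', hξ', η', hη', e', f'⟩ := h'
  refine ⟨ξ + ξ', add_mem hξ hξ', η + η' + twistSum n (ξ 0) (y'.φ 0) (x.φ 0) (ξ' 0) γ.form,
    add_mem (add_mem hη hη') (twistSum_mem (bounded_apply hξ.1 0) y'.bounded x.bounded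
      (bounded_apply hξ'.1 0) γ), ?_, ?_⟩
  · rw [map_add, ← e, ← e', add_φ, add_φ]
    abel
  · rw [map_add, map_add, dW_twistSum n x.dT_zero y'.dT_zero (dT_of_eq hξ e) (dT_of_eq hξ' e'), ← f,
      ← f', add_θ, add_θ, add_φ, add_φ, Pi.add_apply, Pi.add_apply, Pi.add_apply]
    abel

/-- Equivalence of symmetric structures as an additive congruence. -/
def equivCon (γ : Bundle C) (n : ℤ) : AddCon (SymStr γ n) where
  r := Equiv
  iseqv := ⟨Equiv.refl, Equiv.symm, Equiv.trans⟩
  add' := Equiv.add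

theorem addConGen_equiv (γ : Bundle C) (n : ℤ) :
    addConGen (SymStr.Equiv (γ := γ) (n := n)) = equivCon γ n :=
  AddCon.addConGen_of_addCon (equivCon γ n)

theorem mk_eq_iff {x y : SymStr γ n} : TwistedQ.mk x = TwistedQ.mk y ↔ x.Equiv y := by
  refine (AddCon.eq (addConGen (SymStr.Equiv (γ := γ) (n := n))) (a := x) (b := y)).trans ?_
  rw [addConGen_equiv]
  rfl

/-- The structure obtained from `x` by a chain `ξ ∈ (W^% C)_{n+1}` and a chain
`η ∈ (Ŵ^% C)_{n+2}`. -/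
noncomputable def move (x : SymStr γ n) {ξ η : ℤ → Tens C} (hξ : ξ ∈ symChains C (n + 1))
    (hη : η ∈ hyperChains C (n + 2)) : SymStr γ n where
  φ := x.φ + dW C (n + 1) ξ
  θ := x.θ + ξ - twistHomotopy n (ξ 0) (x.φ 0) (x.φ 0 + dT C (ξ 0)) γ.form + dW C (n + 2) η
  φ_mem := add_mem x.φ_mem (dW_sym rfl hξ)
  φ_cycle := by rw [map_add, x.φ_cycle, dW_dW rfl, add_zero]
  θ_mem := add_mem (sub_mem (add_mem x.θ_mem hξ.1) (twistHomotopy_mem (bounded_apply hξ.1 0)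
    x.bounded (by
      rw [← dW_apply_zero hξ]
      exact bounded_apply (add_mem x.φ_mem (dW_sym rfl hξ)).1 0) γ)) (dW_hyper (by ring) hη)
  eq := by
    rw [map_add, map_sub, map_add, dW_dW (by ring), add_zero, ← x.eq,
      dW_twistHomotopy n x.dT_zero (by rw [map_add, x.dT_zero, dT_dT, add_zero]) (by abel),
      Pi.add_apply, dW_apply_zero hξ]
    abel

theorem equiv_move (x : SymStr γ n) {ξ η : ℤ → Tens C} (hξ : ξ ∈ symChains C (n + 1))
    (hη : η ∈ hyperChains C (n + 2)) : x.Equiv (x.move hξ hη) := by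
  refine ⟨ξ, hξ, η, hη, ?_, ?_⟩
  · change x.φ + dW C (n + 1) ξ - x.φ = _
    abel
  · have e : (x.move hξ hη).φ 0 = x.φ 0 + dT C (ξ 0) := by
      change x.φ 0 + dW C (n + 1) ξ 0 = _
      rw [dW_apply_zero hξ]
    rw [e]
    change x.θ + ξ - _ + _ - x.θ - ξ + _ = _
    abel

theorem pushW_comp (f : C ⟶ D) (g : D ⟶ E) (θ : ℤ → Tens C) :
    pushW (f ≫ g) θ = pushW g (pushW f θ) := by
  funext s p q
  change TensorProduct.map (fl g p ∘ₗ fl f p) (fl g q ∘ₗ fl f q) (θ s p q) = _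
  rw [TensorProduct.map_comp]
  rfl

theorem push_comp {β : Bundle E} (a : BundleMap γ δ) (b : BundleMap δ β) (x : SymStr γ n) :
    x.push (a.comp b) = (x.push a).push b := by
  apply SymStr.ext
  · exact pushW_comp a.f b.f x.φ
  · change pushW (a.f ≫ b.f) x.θ - pushW (a.f ≫ b.f) (twist n (x.φ 0) (a.χ + pullW a.f b.χ)) =
      pushW b.f (pushW a.f x.θ - pushW a.f (twist n (x.φ 0) a.χ)) -
        pushW b.f (twist n (pushT a.f (x.φ 0)) b.χ)
    rw [pushW_comp, pushW_comp, twist_push, twist_add_form, map_add, map_add, map_sub]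
    abel

/-- The bundle δ pulls back to γ + dχ. The extra term dχ in the twisted homotopy is balanced by the
twists of χ in the pushed θ, up to the boundary of the degree 1 homotopy of χ. -/
theorem Equiv.push {x y : SymStr γ n} (h : x.Equiv y) (a : BundleMap γ δ) :
    (x.push a).Equiv (y.push a) := by
  obtain ⟨ξ, hξ, η, hη, e, f⟩ := h
  have hd := dW_twistHomotopyDeg n 1 x.dT_zero y.dT_zero (dT_of_eq hξ e) a.χ
  rw [sub_self, twistHomotopyDeg_zero, ← a.eq, show n + 1 + 1 = n + 2 by ring] at hd
  refine ⟨pushW a.f ξ, pushW_sym a.f hξ,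
    pushW a.f η - pushW a.f (twistHomotopyDeg n 1 (ξ 0) (x.φ 0) (y.φ 0) a.χ),
    sub_mem (pushW_hyper a.f hη) (pushW_hyper a.f ?_), ?_, ?_⟩
  · have h := twistHomotopyDeg_mem (n := n) (bounded_apply hξ.1 0) x.bounded y.bounded a.mem
    rwa [show n + 1 + 1 = n + 2 by ring] at h
  · rw [push_φ, push_φ, dW_push, ← e, map_sub]
  · rw [push_θ, push_θ, push_φ, push_φ]
    change _ + twistHomotopy n (pushT a.f (ξ 0)) (pushT a.f (x.φ 0)) (pushT a.f (y.φ 0)) δ.form = _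
    have hp : pullW a.f δ.form = γ.form + (pullW a.f δ.form - γ.form) := by abel
    rw [twistHomotopy_push, map_sub, dW_push, dW_push, ← f, hd, hp, twistHomotopy_add_form]
    simp only [map_add, map_sub, ← hp]
    abel

/-- The pushed θ is quadratic in φ₀ through χ, so additivity is not strict; the bracket of χ is the
correcting η, with ξ = 0. -/
theorem push_add (a : BundleMap γ δ) (x y : SymStr γ n) :
    ((x + y).push a).Equiv (x.push a + y.push a) := by
  have hb : bracket n (x.φ 0) (y.φ 0) a.χ ∈ hyperChains C (n + 2) := by
    have e (s : ℤ) : s - n + 1 = s - (n - 1) := by ring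
    refine neg_mem (x := fun s => slant n n (x.φ 0) (y.φ 0) (trF C (a.χ (s - n + 1)))) ?_
    simp only [e]
    exact slant_mem x.bounded y.bounded (trF_mem a.mem) (by ring)
  refine Equiv.of_eta (η := pushW a.f (bracket n (x.φ 0) (y.φ 0) a.χ)) ?_ (pushW_hyper a.f hb) ?_
  · rw [add_φ, push_φ, push_φ, push_φ, add_φ, map_add]
  · have hd := dW_bracketDeg n 1 x.dT_zero y.dT_zero a.χ
    rw [← a.eq, show n + 1 + 1 = n + 2 by ring] at hd
    have hs : (fun s => sgn 1 (twist n (x.φ 0) a.χ s + twist n (y.φ 0) a.χ s -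
        twist n (x.φ 0 + y.φ 0) a.χ s)) = -(twist n (x.φ 0) a.χ + twist n (y.φ 0) a.χ -
        twist n (x.φ 0 + y.φ 0) a.χ) := by
      funext s
      rw [sgn_one]
      rfl
    rw [hs] at hd
    rw [dW_push, hd, add_θ, push_θ, push_θ, push_θ, push_φ, push_φ, add_θ, add_φ, Pi.add_apply]
    change _ + bracket n (pushT a.f (x.φ 0)) (pushT a.f (y.φ 0)) δ.form - _ = _
    have hp : pullW a.f δ.form = γ.form + (pullW a.f δ.form - γ.form) := by abel
    rw [bracket_push, hp, bracket_add_form]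
    simp only [map_add, map_sub, map_neg, ← hp]
    abel

end SymStr

/-! ### Chains concentrated in low degrees. -/

section support

variable {C : Cx} {n : ℤ}

theorem tensor_eq_zero_left {A B : Type} [AddCommGroup A] [AddCommGroup B] (h : Subsingleton A)
    (x : A ⊗[ℤ] B) : x = 0 := by
  induction x with
  | zero => rfl
  | add x y hx hy => rw [hx, hy, add_zero]
  | tmul a b => rw [Subsingleton.elim a 0, TensorProduct.zero_tmul]

theorem tensor_eq_zero_right {A B : Type} [AddCommGroup A] [AddCommGroup B] (h : Subsingleton B)
    (x : A ⊗[ℤ] B) : x = 0 := by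
  induction x with
  | zero => rfl
  | add x y hx hy => rw [hx, hy, add_zero]
  | tmul a b => rw [Subsingleton.elim b 0, TensorProduct.tmul_zero]

/-- All components of `u` involving degrees greater than `k` vanish. -/
def Supp (k : ℤ) (u : ℤ → Tens C) : Prop := ∀ s p q, (k < p ∨ k < q) → u s p q = 0

theorem Supp.add {k : ℤ} {u v : ℤ → Tens C} (hu : Supp k u) (hv : Supp k v) : Supp k (u + v) :=
  fun s p q h => by rw [Pi.add_apply, Pi.add_apply, Pi.add_apply, hu s p q h, hv s p q h, add_zero]

theorem Supp.sub {k : ℤ} {u v : ℤ → Tens C} (hu : Supp k u) (hv : Supp k v) : Supp k (u - v) :=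
  fun s p q h => by rw [Pi.sub_apply, Pi.sub_apply, Pi.sub_apply, hu s p q h, hv s p q h, sub_zero]

theorem Supp.sgn {k : ℤ} {u : ℤ → Tens C} (hu : Supp k u) (j : ℤ) :
    Supp k (fun s => sgn j (u s)) :=
  fun s p q h => by
    change ChainBundles.sgn j (u s) p q = 0
    rw [sgn_apply₂, hu s p q h, map_zero]

theorem dW_apply (θ : ℤ → Tens C) (s p q : ℤ) :
    dW C n θ s p q = (dl C (q + 1) q).lTensor (C.X p) (θ s p (q + 1)) +
      sgn q ((dl C (p + 1) p).rTensor (C.X q) (θ s (p + 1) q)) +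
      sgn (n + s - 1) (θ (s - 1) p q + sgn s (sgn (p * q)
        (TensorProduct.comm ℤ (C.X q) (C.X p) (θ (s - 1) q p)))) := by
  change _ + sgn (n + s - 1) (θ (s - 1) + sgn s (trT C (θ (s - 1)))) p q = _
  rw [sgn_apply₂, Pi.add_apply, Pi.add_apply, sgn_apply₂]
  rfl

theorem Supp.dW {k : ℤ} {u : ℤ → Tens C} (hu : Supp k u) (m : ℤ) : Supp k (dW C m u) := by
  intro s p q h
  rw [dW_apply, hu s p (q + 1) (by omega), hu s (p + 1) q (by omega), hu (s - 1) p q h,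
    hu (s - 1) q p h.symm]
  simp

theorem slant_eq_zero_left {m k p q : ℤ} {x y : Tens C} {F : Form C} (h : x (m - p) p = 0) :
    slant m k x y F p q = 0 := by
  simp [slant, h]

theorem slant_eq_zero_right {m k p q : ℤ} {x y : Tens C} {F : Form C} (h : y (k - q) q = 0) :
    slant m k x y F p q = 0 := by
  simp [slant, h]

theorem comp_neg_left (h0 : ∀ p < 0, Subsingleton (C.X p)) (x : Tens C) {p : ℤ} (hp : p < 0)
    (q : ℤ) : x p q = 0 :=
  tensor_eq_zero_left (h0 p hp) _

theorem comp_neg_right (h0 : ∀ p < 0, Subsingleton (C.X p)) (x : Tens C) (p : ℤ) {q : ℤ}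
    (hq : q < 0) : x p q = 0 :=
  tensor_eq_zero_right (h0 q hq) _

/-- The component (p, q) uses x in first degree m - p and y in first degree k - q, and both must be
nonnegative. -/
theorem supp_slant (h0 : ∀ p < 0, Subsingleton (C.X p)) {m k l : ℤ} (hm : m ≤ l) (hk : k ≤ l)
    (x y : Tens C) (F : ℤ → Form C) :
    Supp l (fun s => slant m k x y (F s)) := by
  rintro s p q (h | h)
  · exact slant_eq_zero_left (comp_neg_left h0 x (by omega) p)
  · exact slant_eq_zero_right (comp_neg_left h0 y (by omega) q)

theorem supp_twist (h0 : ∀ p < 0, Subsingleton (C.X p)) (x : Tens C) (F : ℤ → Form C) :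
    Supp n (twist n x F) :=
  supp_slant h0 le_rfl le_rfl x x fun s => F (s - n)

theorem supp_twistHomotopy (h0 : ∀ p < 0, Subsingleton (C.X p)) (g x y : Tens C) (F : ℤ → Form C) :
    Supp (n + 1) (twistHomotopy n g x y F) :=
  ((supp_slant h0 (by omega) le_rfl x g fun s => F (s - n)).add
    ((supp_slant h0 le_rfl (by omega) g y fun s => F (s - n)).sgn n)).add
    ((supp_slant h0 le_rfl le_rfl g g fun s => trF C (F (s - n - 1))).sgn n)

/-- A chain `η` with a single component, which is chosen so that `dη` cancels the component `(0, j)`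
of the chain `θ` in the index `s = 0`. -/
noncomputable def cancelCorner (n j : ℤ) (θ : ℤ → Tens C) : ℤ → Tens C := fun s p q =>
  if s = -1 ∧ p = 0 ∧ q = j then -sgn n (θ 0 p q) else 0

theorem cancelCorner_mem {j : ℤ} (h : n = j) (θ : ℤ → Tens C) :
    cancelCorner n j θ ∈ hyperChains C (n + 1) := by
  refine ⟨fun s p q e => if_neg (by omega), |j|, fun s p q e => if_neg ?_⟩
  rintro ⟨-, rfl, rfl⟩
  simp at e
  have := abs_nonneg q
  omega

/-- The symmetrisation in the differential sees (0, j) and (j, 0); as j ≠ 0 these differ, so only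
the chosen entry contributes. -/
theorem add_dW_cancelCorner {j : ℤ} (hj : j ≠ 0) (θ : ℤ → Tens C) :
    (θ + dW C (n + 1) (cancelCorner n j θ)) 0 0 j = 0 := by
  rw [Pi.add_apply, Pi.add_apply, Pi.add_apply, dW_apply]
  have e1 (p q : ℤ) : cancelCorner n j θ 0 p q = 0 := if_neg (by omega)
  have e2 : cancelCorner n j θ (0 - 1) 0 j = -sgn n (θ 0 0 j) := if_pos ⟨by norm_num, rfl, rfl⟩
  have e3 : cancelCorner n j θ (0 - 1) j 0 = 0 := if_neg (by omega)
  rw [e1, e1, e2, e3, show n + 1 + 0 - 1 = n by ring]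
  simp [sgn_sgn]

/-- The part of a chain in degrees greater than `k`, with `s ≥ 0`. -/
noncomputable def highPart (k : ℤ) (θ : ℤ → Tens C) : ℤ → Tens C := fun s p q =>
  if 0 ≤ s ∧ (k < p ∨ k < q) then θ s p q else 0

theorem highPart_mem (k : ℤ) {θ : ℤ → Tens C} (h : θ ∈ hyperChains C n) :
    highPart k θ ∈ symChains C n := by
  obtain ⟨h1, N, h2⟩ := h
  refine ⟨⟨fun s p q e => ?_, N, fun s p q e => ?_⟩, fun s hs => ?_⟩
  · change ite _ _ _ = _
    rw [h1 s p q e, ite_self]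
  · change ite _ _ _ = _
    rw [h2 s p q e, ite_self]
  · funext p q
    exact if_neg (by omega)

/-- For s < 0 the total degree n + s is at most k, so in nonnegative grading no component lies
beyond k. Only s ≥ 0 has to be removed, and that part lies in W^%. -/
theorem supp_sub_highPart (h0 : ∀ p < 0, Subsingleton (C.X p)) {k : ℤ} (hk : n ≤ k + 1)
    {θ : ℤ → Tens C} (h : θ ∈ hyperChains C n) : Supp k (θ - highPart k θ) := by
  intro s p q e
  rw [Pi.sub_apply, Pi.sub_apply, Pi.sub_apply]
  by_cases hs : 0 ≤ s
  · rw [highPart, if_pos ⟨hs, e⟩, sub_self]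
  · rw [highPart, if_neg (by omega), sub_zero]
    by_cases hd : p + q = n + s
    · rcases e with e | e
      · exact comp_neg_right h0 _ p (by omega)
      · exact comp_neg_left h0 _ (by omega) q
    · exact h.1 s p q hd

/-- In total degree n = k + 1 the only bidegrees beyond k are (n, 0) and (0, n), and the second is
assumed to vanish. -/
theorem highPart_zero_apply (h0 : ∀ p < 0, Subsingleton (C.X p)) {k : ℤ} (hk : n = k + 1)
    {θ : ℤ → Tens C} (h : θ ∈ hyperChains C n) (hc : θ 0 0 n = 0) (p q : ℤ) (hq : q ≠ 0) :
    highPart k θ 0 p q = 0 := by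
  by_cases e : 0 ≤ (0 : ℤ) ∧ (k < p ∨ k < q)
  · rw [highPart, if_pos e]
    by_cases hd : p + q = n + 0
    · by_cases hp : p < 0
      · exact comp_neg_left h0 _ hp q
      · by_cases hq' : q < 0
        · exact comp_neg_right h0 _ p hq'
        · obtain rfl : p = 0 := by omega
          obtain rfl : q = n := by omega
          exact hc
    · exact h.1 0 p q hd
  · exact if_neg e

end support

/-! ### Compression of structures and of equivalences. -/

namespace SymStr

variable {B : Cx} {β : Bundle B} {n : ℤ}

/-- The part of θ beyond degree n is absorbed by ξ. Then φ is low as well, being the sum of dθ and a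
twist, which is supported in degrees at most n. -/
theorem exists_equiv_supp (h0 : ∀ p < 0, Subsingleton (B.X p)) (hn : 0 ≤ n) (x : SymStr β n) :
    ∃ y : SymStr β n, x.Equiv y ∧ Supp n y.φ ∧ Supp n y.θ := by
  -- With the entry (0, n+1) of θ₀ cleared, ξ₀ lives in second degree 0 only, and the twisted
  -- homotopy stays in degrees at most n. Otherwise it would reach n + 1.
  set η := cancelCorner (n + 1) (n + 1) x.θ with hη
  have hη_mem : η ∈ hyperChains B (n + 2) := by
    have h := cancelCorner_mem (n := n + 1) rfl x.θ
    rwa [show n + 1 + 1 = n + 2 by ring] at h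
  set θ := x.θ + dW B (n + 2) η with hθ
  have hθ_mem : θ ∈ hyperChains B (n + 1) := add_mem x.θ_mem (dW_hyper (by ring) hη_mem)
  have hc : θ 0 0 (n + 1) = 0 := by
    have h := add_dW_cancelCorner (n := n + 1) (j := n + 1) (by omega) x.θ
    rwa [show n + 1 + 1 = n + 2 by ring] at h
  have hz := highPart_zero_apply h0 rfl hθ_mem hc
  have hξ := neg_mem (highPart_mem n hθ_mem)
  have hg (p q : ℤ) (hq : q ≠ 0) : (-highPart n θ) 0 p q = 0 := by
    change -highPart n θ 0 p q = 0
    rw [hz p q hq, neg_zero]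
  have hθ' : Supp n (x.move hξ hη_mem).θ := by
    have e : (x.move hξ hη_mem).θ = (θ - highPart n θ) - twistHomotopy n ((-highPart n θ) 0)
        (x.φ 0) (x.φ 0 + dT B ((-highPart n θ) 0)) β.form := by
      change x.θ + -highPart n θ - _ + _ = _
      rw [hθ]
      abel
    rw [e]
    refine (supp_sub_highPart h0 le_rfl hθ_mem).sub ?_
    refine Supp.add (Supp.add ?_ (Supp.sgn ?_ n)) (Supp.sgn ?_ n)
    · rintro s p q (h | h)
      · exact slant_eq_zero_left (comp_neg_left h0 _ (by omega) p)
      · exact slant_eq_zero_right (hg _ q (by omega))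
    · rintro s p q (h | h)
      · exact slant_eq_zero_left (hg _ p (by omega))
      · exact slant_eq_zero_right (comp_neg_left h0 _ (by omega) q)
    · rintro s p q (h | h)
      · exact slant_eq_zero_left (hg _ p (by omega))
      · exact slant_eq_zero_right (hg _ q (by omega))
  refine ⟨x.move hξ hη_mem, x.equiv_move hξ hη_mem, ?_, hθ'⟩
  rw [eq_add_of_sub_eq (x.move hξ hη_mem).eq]
  exact (hθ'.dW _).add (supp_twist h0 _ _)

/-- The part κ of η beyond degree n + 1 is subtracted from η and dκ is added to ξ. The effect on the
twisted homotopy is a boundary. -/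
theorem Equiv.exists_supp (h0 : ∀ p < 0, Subsingleton (B.X p)) (hn : 0 ≤ n) {x y : SymStr β n}
    (hx : Supp (n + 1) x.θ) (hy : Supp (n + 1) y.θ) (h : x.Equiv y) :
    ∃ ξ ∈ symChains B (n + 1), ∃ η ∈ hyperChains B (n + 2), Supp (n + 1) ξ ∧ Supp (n + 1) η ∧
      y.φ - x.φ = dW B (n + 1) ξ ∧
      y.θ - x.θ - ξ + twistHomotopy n (ξ 0) (x.φ 0) (y.φ 0) β.form = dW B (n + 2) η := by
  obtain ⟨ξ, hξ, η, hη, e, f⟩ := h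
  have e2 : n + 2 = n + 1 + 1 := by ring
  set ζ := cancelCorner (n + 2) (n + 2) η with hζ
  have hζ_mem : ζ ∈ hyperChains B (n + 2 + 1) := cancelCorner_mem rfl η
  set η₁ := η + dW B (n + 2 + 1) ζ with hη₁
  have hη₁_mem : η₁ ∈ hyperChains B (n + 2) := add_mem hη (dW_hyper rfl hζ_mem)
  have hc : η₁ 0 0 (n + 2) = 0 := add_dW_cancelCorner (by omega) η
  have hz := highPart_zero_apply h0 e2 hη₁_mem hc
  have hκ := highPart_mem (n + 1) hη₁_mem
  set κ := highPart (n + 1) η₁ with hκ'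
  have hd (p q : ℤ) (hq : q ≠ 0) : dT B (κ 0) p q = 0 := by
    by_cases hq' : q < 0
    · exact comp_neg_right h0 _ p hq'
    · change (dl B (q + 1) q).lTensor (B.X p) (κ 0 p (q + 1)) +
        sgn q ((dl B (p + 1) p).rTensor (B.X q) (κ 0 (p + 1) q)) = 0
      rw [hz _ _ (by omega), hz _ _ hq]
      simp
  have hbκ := bounded_apply hκ.1 0
  have hbξ := bounded_apply hξ.1 0
  -- This chain bounds the change of the twisted homotopy when ξ₀ becomes ξ₀ + dκ₀. It stays low
  -- because κ₀ and dκ₀ live in second degree 0, which is why the corner of η was cleared.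
  set ρ := twistCross n (ξ 0) (dT B (κ 0)) β.form + twistNull n (κ 0) (y.φ 0) β.form with hρ
  have hρ_mem : ρ ∈ hyperChains B (n + 2) :=
    add_mem (twistCross_mem hbξ (bounded_dT hbκ) β) (twistNull_mem hbκ y.bounded β)
  have hρ_supp : Supp (n + 1) ρ := by
    refine Supp.add (Supp.sgn ?_ n) (Supp.sub (Supp.sub (Supp.add ?_ ?_) ?_) ?_)
    · rintro s p q (h | h)
      · exact slant_eq_zero_left (comp_neg_left h0 _ (by omega) p)
      · exact slant_eq_zero_right (hd _ q (by omega))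
    · rintro s p q (h | h)
      · exact slant_eq_zero_left (comp_neg_left h0 _ (by omega) p)
      · exact slant_eq_zero_right (hz _ q (by omega))
    · rintro s p q (h | h)
      · exact slant_eq_zero_left (hz _ p (by omega))
      · exact slant_eq_zero_right (comp_neg_left h0 _ (by omega) q)
    · rintro s p q (h | h)
      · exact slant_eq_zero_left (hz _ p (by omega))
      · exact slant_eq_zero_right (hd _ q (by omega))
    · rintro s p q (h | h)
      · exact slant_eq_zero_left (hz _ p (by omega))
      · exact slant_eq_zero_right (hz _ q (by omega))
  have hdξ := dT_of_eq hξ e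
  have hξ0 : (ξ + dW B (n + 2) κ) 0 = ξ 0 + dT B (κ 0) := by
    rw [Pi.add_apply, dW_apply_zero hκ]
  have hη'_supp : Supp (n + 1) (η₁ - κ + ρ) :=
    (supp_sub_highPart h0 e2.le hη₁_mem).add hρ_supp
  have key : y.θ - x.θ - (ξ + dW B (n + 2) κ) +
      twistHomotopy n ((ξ + dW B (n + 2) κ) 0) (x.φ 0) (y.φ 0) β.form =
      dW B (n + 2) (η₁ - κ + ρ) := by
    have h1 := dW_twistCross n hdξ (g' := dT B (κ 0)) (z := y.φ 0)
      (by rw [dT_dT, sub_self]) β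
    have h2 := dW_twistNull n (h := κ 0) y.dT_zero β
    rw [map_add, map_sub, hη₁, map_add, dW_dW rfl, hρ, map_add, h1, h2, hξ0, ← f]
    abel
  refine ⟨ξ + dW B (n + 2) κ, add_mem hξ (dW_sym e2 hκ), η₁ - κ + ρ,
    add_mem (sub_mem hη₁_mem hκ.1) hρ_mem, ?_, hη'_supp, ?_, key⟩
  -- No further choice is needed for the new ξ: the defining equation expresses it through chains
  -- already known to be low.
  · have e3 : ξ + dW B (n + 2) κ = y.θ - x.θ +
        twistHomotopy n ((ξ + dW B (n + 2) κ) 0) (x.φ 0) (y.φ 0) β.form -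
        dW B (n + 2) (η₁ - κ + ρ) := by
      rw [← key]
      abel
    rw [e3]
    exact ((hy.sub hx).add (supp_twistHomotopy h0 _ _ _ _)).sub (hη'_supp.dW _)
  · rw [map_add, dW_dW e2, add_zero, e]

end SymStr

/-! ### Skeleta and the lifting of structures to them. -/

/-- The degree `p` part of the `k`-skeleton of a complex. -/
def skGroup (B : Cx) (k p : ℤ) : AddSubgroup (B.X p) where
  carrier := {x | k < p → x = 0}
  zero_mem' := fun _ => rfl
  add_mem' := fun ha hb h => by rw [ha h, hb h, add_zero]
  neg_mem' := fun ha h => by rw [ha h, neg_zero]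

/-- The differential of the `k`-skeleton. -/
def skD (B : Cx) (k i j : ℤ) : skGroup B k i →+ skGroup B k j where
  toFun x := ⟨B.d i j x.1, fun h => by
    by_cases hij : j + 1 = i
    · rw [x.2 (by omega), map_zero]
    · rw [B.shape i j hij]
      rfl⟩
  map_zero' := by
    ext
    exact map_zero (B.d i j).hom
  map_add' x y := by
    ext
    exact map_add (B.d i j).hom x.1 y.1

/-- The `k`-skeleton of a complex. -/
def sk (B : Cx) (k : ℤ) : Cx where
  X p := AddCommGrpCat.of (skGroup B k p)
  d i j := AddCommGrpCat.ofHom (skD B k i j)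
  shape i j h := by
    ext x
    change B.d i j (Subtype.val x) = 0
    rw [B.shape i j h]
    rfl
  d_comp_d' i j l _ _ := by
    ext x
    exact ConcreteCategory.congr_hom (B.d_comp_d i j l) (Subtype.val x)

/-- The inclusion of the `k`-skeleton. -/
def skIncl (B : Cx) (k : ℤ) : sk B k ⟶ B where
  f p := AddCommGrpCat.ofHom (skGroup B k p).subtype
  comm' i j _ := by
    ext x
    rfl

open Classical in
/-- The retraction of `B_p` onto the degree `p` part of the `k`-skeleton. -/
noncomputable def skRet (B : Cx) (k p : ℤ) : B.X p →+ (sk B k).X p where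
  toFun x := (⟨if k < p then 0 else x, fun h => if_pos h⟩ : skGroup B k p)
  map_zero' := by
    apply Subtype.ext
    exact ite_self 0
  map_add' x y := by
    apply Subtype.ext
    change (if k < p then 0 else x + y) = (if k < p then 0 else x) + (if k < p then 0 else y)
    split_ifs
    · rw [add_zero]
    · rfl

section skeleton

variable {B : Cx} {k n : ℤ}

theorem skRet_incl (p : ℤ) : (skRet B k p).toIntLinearMap ∘ₗ fl (skIncl B k) p =
    LinearMap.id := by
  ext x
  apply Subtype.ext
  change (if k < p then 0 else Subtype.val x) = Subtype.val x
  split_ifs with h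
  · exact (Subtype.prop x h).symm
  · rfl

theorem incl_skRet {p : ℤ} (hp : p ≤ k) : fl (skIncl B k) p ∘ₗ (skRet B k p).toIntLinearMap =
    LinearMap.id := by
  ext x
  change (if k < p then 0 else x) = x
  rw [if_neg (by omega)]

/-- The lift to the `k`-skeleton of families of chains of `B ⊗ B`. -/
noncomputable def skLift (k : ℤ) : (ℤ → Tens B) →+ (ℤ → Tens (sk B k)) where
  toFun u s p q := TensorProduct.map (skRet B k p).toIntLinearMap (skRet B k q).toIntLinearMap
    (u s p q)
  map_zero' := by
    funext s p q
    exact map_zero _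
  map_add' u v := by
    funext s p q
    exact map_add _ _ _

theorem skLift_push (u : ℤ → Tens (sk B k)) : skLift k (pushW (skIncl B k) u) = u := by
  funext s p q
  change TensorProduct.map _ _ (TensorProduct.map _ _ (u s p q)) = _
  rw [← LinearMap.comp_apply, ← TensorProduct.map_comp, skRet_incl, skRet_incl,
    TensorProduct.map_id]
  rfl

theorem push_skLift {u : ℤ → Tens B} (hu : Supp k u) : pushW (skIncl B k) (skLift k u) = u := by
  funext s p q
  by_cases h : k < p ∨ k < q
  · rw [hu s p q h]
    change TensorProduct.map _ _ (TensorProduct.map _ _ (u s p q)) = _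
    rw [hu s p q h, map_zero, map_zero]
  · change TensorProduct.map _ _ (TensorProduct.map _ _ (u s p q)) = _
    rw [← LinearMap.comp_apply, ← TensorProduct.map_comp, incl_skRet (by omega),
      incl_skRet (by omega), TensorProduct.map_id]
    rfl

/-- The degreewise retractions `skRet` need not commute with the differential, so identities between
lifted chains are verified after this injection. -/
theorem push_skIncl_injective : Function.Injective (pushW (skIncl B k)) :=
  Function.LeftInverse.injective skLift_push

theorem skLift_hyper {u : ℤ → Tens B} (hu : u ∈ hyperChains B n) :
    skLift k u ∈ hyperChains (sk B k) n := by
  obtain ⟨h1, N, h2⟩ := hu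
  refine ⟨fun s p q e => ?_, N, fun s p q e => ?_⟩
  · change TensorProduct.map _ _ (u s p q) = 0
    rw [h1 s p q e, map_zero]
  · change TensorProduct.map _ _ (u s p q) = 0
    rw [h2 s p q e, map_zero]

theorem skLift_sym {u : ℤ → Tens B} (hu : u ∈ symChains B n) :
    skLift k u ∈ symChains (sk B k) n := by
  refine ⟨skLift_hyper hu.1, fun s hs => ?_⟩
  funext p q
  change TensorProduct.map _ _ (u s p q) = 0
  rw [hu.2 s hs]
  exact map_zero _

/-- The bundle induced by a chain map. -/
noncomputable def Bundle.pull {C D : Cx} (f : C ⟶ D) (δ : Bundle D) : Bundle C where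
  form := pullW f δ.form
  mem := pullW_mem f δ.mem
  cycle := by rw [dWF_pull, δ.cycle, map_zero]

/-- A bundle map lifting the chain map `f` to the induced bundle `g^* δ`. -/
noncomputable def BundleMap.lift {C D E : Cx} {γ : Bundle C} {δ : Bundle D} (a : BundleMap γ δ)
    (g : E ⟶ D) (f : C ⟶ E) (h : f ≫ g = a.f) : BundleMap γ (δ.pull g) where
  f := f
  χ := a.χ
  mem := a.mem
  eq := by
    rw [← a.eq, ← h]
    rfl

/-- The canonical bundle map from an induced bundle. -/
noncomputable def Bundle.pullMap {C D : Cx} (f : C ⟶ D) (δ : Bundle D) :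
    BundleMap (δ.pull f) δ where
  f := f
  χ := 0
  mem := zero_mem _
  eq := by
    rw [map_zero]
    exact sub_self _

theorem BundleMap.ext_of {C D : Cx} {γ : Bundle C} {δ : Bundle D} {a b : BundleMap γ δ}
    (hf : a.f = b.f) (hχ : a.χ = b.χ) : a = b := by
  cases a
  cases b
  subst hf hχ
  rfl

theorem BundleMap.lift_comp {C D E : Cx} {γ : Bundle C} {δ : Bundle D} (a : BundleMap γ δ)
    (g : E ⟶ D) (f : C ⟶ E) (h : f ≫ g = a.f) : (a.lift g f h).comp (δ.pullMap g) = a :=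
  BundleMap.ext_of h (by
    change a.χ + pullW f 0 = a.χ
    rw [map_zero, add_zero])

theorem twist_zero_form {C : Cx} (x : Tens C) : twist n x (0 : ℤ → Form C) = 0 := by
  funext s
  exact slant_zero n n x x

theorem push_pullMap_θ {β : Bundle B} (x : SymStr (β.pull (skIncl B k)) n) :
    (x.push (β.pullMap (skIncl B k))).θ = pushW (skIncl B k) x.θ := by
  rw [SymStr.push_θ]
  change _ - pushW (skIncl B k) (twist n (x.φ 0) 0) = _
  rw [twist_zero_form, map_zero, sub_zero]
  rfl

theorem push_apply_zero {C D : Cx} (f : C ⟶ D) (u : ℤ → Tens C) : (pushW f u) 0 = pushT f (u 0) :=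
  rfl

theorem SymStr.exists_push_eq {β : Bundle B} {x : SymStr β n} (hφ : Supp k x.φ)
    (hθ : Supp k x.θ) :
    ∃ y : SymStr (β.pull (skIncl B k)) n, y.push (β.pullMap (skIncl B k)) = x := by
  have eφ := push_skLift hφ
  have eθ := push_skLift hθ
  refine ⟨{ φ := skLift k x.φ
            θ := skLift k x.θ
            φ_mem := skLift_sym x.φ_mem
            φ_cycle := ?_
            θ_mem := skLift_hyper x.θ_mem
            eq := ?_ }, ?_⟩
  · apply push_skIncl_injective
    rw [← dW_push, eφ, x.φ_cycle, map_zero]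
  · apply push_skIncl_injective
    rw [map_sub, ← dW_push, eφ, eθ, ← x.eq]
    change _ - pushW _ (twist n (skLift k x.φ 0) (pullW (skIncl B k) β.form)) = _
    rw [← twist_push, ← push_apply_zero, eφ]
  · apply SymStr.ext
    · exact eφ
    · rw [push_pullMap_θ]
      exact eθ

theorem SymStr.equiv_of_push {β : Bundle B} {x y : SymStr (β.pull (skIncl B k)) n}
    {ξ η : ℤ → Tens B} (hξ : ξ ∈ symChains B (n + 1)) (hη : η ∈ hyperChains B (n + 2))
    (sξ : Supp k ξ) (sη : Supp k η)
    (e : (y.push (β.pullMap (skIncl B k))).φ - (x.push (β.pullMap (skIncl B k))).φ =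
      dW B (n + 1) ξ)
    (f : (y.push (β.pullMap (skIncl B k))).θ - (x.push (β.pullMap (skIncl B k))).θ - ξ +
      twistHomotopy n (ξ 0) ((x.push (β.pullMap (skIncl B k))).φ 0)
        ((y.push (β.pullMap (skIncl B k))).φ 0) β.form = dW B (n + 2) η) : x.Equiv y := by
  have eξ := push_skLift sξ
  have eη := push_skLift sη
  refine ⟨skLift k ξ, skLift_sym hξ, skLift k η, skLift_hyper hη, ?_, ?_⟩
  · apply push_skIncl_injective
    rw [← dW_push, eξ, ← e, map_sub]
    rfl
  · apply push_skIncl_injective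
    rw [← dW_push, eη, ← f, map_add, map_sub, map_sub, eξ, push_pullMap_θ, push_pullMap_θ]
    change _ + pushW _ (twistHomotopy n _ _ _ (pullW (skIncl B k) β.form)) = _
    rw [← twistHomotopy_push, ← push_apply_zero, eξ]
    rfl

/-- The factorisation through the `k`-skeleton of a chain map from a `k`-dimensional complex. -/
noncomputable def skFactor {C : Cx} (f : C ⟶ B) (hC : ∀ p, k < p → Subsingleton (C.X p)) :
    C ⟶ sk B k where
  f p := AddCommGrpCat.ofHom
    { toFun := fun x => (⟨f.f p x, fun h => by
        have := hC p h
        rw [Subsingleton.elim x 0, map_zero]⟩ : skGroup B k p)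
      map_zero' := by
        apply Subtype.ext
        exact map_zero (f.f p).hom
      map_add' := fun x y => by
        apply Subtype.ext
        exact map_add (f.f p).hom x y }
  comm' i j _ := by
    ext x
    apply Subtype.ext
    exact ConcreteCategory.congr_hom (f.comm i j) x

theorem skFactor_incl {C : Cx} (f : C ⟶ B) (hC : ∀ p, k < p → Subsingleton (C.X p)) :
    skFactor f hC ≫ skIncl B k = f := by
  ext p x
  rfl

theorem isDim_sk (hB : ∀ p, Module.Finite ℤ (B.X p) ∧ Module.Projective ℤ (B.X p))
    (h0 : ∀ p < 0, Subsingleton (B.X p)) : IsDim k (sk B k) := by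
  refine ⟨fun p => ?_, fun p hp => ?_⟩
  · by_cases h : k < p
    · have hs : Subsingleton ((sk B k).X p) :=
        ⟨fun x y => Subtype.ext ((Subtype.prop x h).trans (Subtype.prop y h).symm)⟩
      exact ⟨inferInstance, inferInstance⟩
    · let e : B.X p ≃ₗ[ℤ] (sk B k).X p := LinearEquiv.ofLinearMap (skRet B k p).toIntLinearMap
        (fl (skIncl B k) p) (skRet_incl p) (incl_skRet (by omega))
      obtain ⟨h1, h2⟩ := hB p
      exact ⟨Module.Finite.equiv e, Module.Projective.of_equiv e⟩
  · refine ⟨fun x y => Subtype.ext ?_⟩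
    rcases hp with hp | hp
    · have := h0 p hp
      exact Subsingleton.elim (α := B.X p) _ _
    · exact (Subtype.prop x hp).trans (Subtype.prop y hp).symm

end skeleton

/-! ### Cobordism of normal complexes and the characteristic element. -/

namespace NormalCx

variable {B : Cx} {β : Bundle B} {n : ℤ}

theorem supp_push {C D : Cx} {k : ℤ} (f : C ⟶ D) (hC : ∀ p, k < p → Subsingleton (C.X p))
    (u : ℤ → Tens C) : Supp k (pushW f u) := by
  rintro s p q h
  change TensorProduct.map _ _ (u s p q) = 0
  have e : u s p q = 0 := by
    rcases h with h | h
    · exact tensor_eq_zero_left (hC p h) _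
    · exact tensor_eq_zero_right (hC q h) _
  rw [e, map_zero]

/-- One direction is functoriality along the classifying map of the cobordism. For the other, the
equivalence over B is compressed to the (n+1)-skeleton, through which both n-dimensional complexes
factor. -/
theorem cobordant_iff (hB : ∀ p, Module.Finite ℤ (B.X p) ∧ Module.Projective ℤ (B.X p))
    (h0 : ∀ p < 0, Subsingleton (B.X p)) (hn : 0 ≤ n) (x y : NormalCx β n) :
    x.Cobordant y ↔ (x.str.push x.map).Equiv (y.str.push y.map) := by
  constructor
  · rintro ⟨D, δ, g, a, b, -, ha, hb, h⟩
    rw [← ha, ← hb, SymStr.push_comp, SymStr.push_comp]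
    exact h.push g
  · intro h
    have supp (z : NormalCx β n) : Supp (n + 1) (z.str.push z.map).θ := by
      have h1 (p : ℤ) (hp : n + 1 < p) : Subsingleton (z.C.X p) := z.dim.2 p (Or.inr (by omega))
      rw [SymStr.push_θ]
      exact (supp_push _ h1 _).sub (supp_push _ h1 _)
    obtain ⟨ξ, hξ, η, hη, sξ, sη, e, f⟩ := SymStr.Equiv.exists_supp h0 hn (supp x) (supp y) h
    have hs (z : NormalCx β n) (p : ℤ) (hp : n + 1 < p) : Subsingleton (z.C.X p) :=
      z.dim.2 p (Or.inr (by omega))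
    let a (z : NormalCx β n) : BundleMap z.γ (β.pull (skIncl B (n + 1))) :=
      z.map.lift (skIncl B (n + 1)) (skFactor z.map.f (hs z)) (skFactor_incl _ _)
    have ha (z : NormalCx β n) : (a z).comp (β.pullMap _) = z.map := BundleMap.lift_comp _ _ _ _
    -- The cobordism is the skeleton itself with the restricted bundle, whatever the two normal
    -- complexes are.
    refine ⟨sk B (n + 1), β.pull (skIncl B (n + 1)), β.pullMap _, a x, a y, isDim_sk hB h0, ha x,
      ha y, ?_⟩
    have hx : x.str.push x.map = (x.str.push (a x)).push (β.pullMap (skIncl B (n + 1))) := by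
      rw [← SymStr.push_comp, ha]
    have hy : y.str.push y.map = (y.str.push (a y)).push (β.pullMap (skIncl B (n + 1))) := by
      rw [← SymStr.push_comp, ha]
    rw [hx, hy] at e f
    exact SymStr.equiv_of_push hξ hη sξ sη e f

/-- The correction term pairs the first projection with the second, so it vanishes on one summand
and the equality is strict. -/
theorem inl_comp_desc {C D : Cx} {γ : Bundle C} {δ : Bundle D} (a : BundleMap γ β)
    (b : BundleMap δ β) : (γ.inl δ).comp (Bundle.desc a b) = a := by
  refine BundleMap.ext_of (biprod.inl_desc _ _) ?_
  change 0 + pullW biprod.inl (pullW biprod.fst a.χ + pullW biprod.snd b.χ +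
    bracketF (biprod.fst ≫ a.f) (biprod.snd ≫ b.f) β.form) = a.χ
  have e : pullW (biprod.inl : C ⟶ C ⊞ D) (bracketF (biprod.fst ≫ a.f) (biprod.snd ≫ b.f) β.form) =
      0 := by
    funext s
    change pullF biprod.inl biprod.inl (pullF (biprod.fst ≫ a.f) (biprod.snd ≫ b.f) _) = 0
    rw [pullF_pullF, biprod.inl_snd_assoc, zero_comp, pullF_zero_right]
  rw [map_add, map_add, e, Bundle.pullW_comp, Bundle.pullW_comp, biprod.inl_fst, biprod.inl_snd,
    Bundle.pullW_zero, add_zero, add_zero, zero_add]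
  rfl

theorem inr_comp_desc {C D : Cx} {γ : Bundle C} {δ : Bundle D} (a : BundleMap γ β)
    (b : BundleMap δ β) : (γ.inr δ).comp (Bundle.desc a b) = b := by
  refine BundleMap.ext_of (biprod.inr_desc _ _) ?_
  change 0 + pullW biprod.inr (pullW biprod.fst a.χ + pullW biprod.snd b.χ +
    bracketF (biprod.fst ≫ a.f) (biprod.snd ≫ b.f) β.form) = b.χ
  have e : pullW (biprod.inr : D ⟶ C ⊞ D) (bracketF (biprod.fst ≫ a.f) (biprod.snd ≫ b.f) β.form) =
      0 := by
    funext s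
    change pullF biprod.inr biprod.inr (pullF (biprod.fst ≫ a.f) (biprod.snd ≫ b.f) _) = 0
    rw [pullF_pullF, biprod.inr_fst_assoc, zero_comp, pullF_zero_left]
  rw [map_add, map_add, e, Bundle.pullW_comp, Bundle.pullW_comp, biprod.inr_fst, biprod.inr_snd,
    Bundle.pullW_zero, zero_add, add_zero, zero_add]
  rfl

theorem push_add_equiv (x y : NormalCx β n) :
    ((x + y).str.push (x + y).map).Equiv (x.str.push x.map + y.str.push y.map) := by
  have h := SymStr.push_add (Bundle.desc x.map y.map) (x.str.push (x.γ.inl y.γ))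
    (y.str.push (x.γ.inr y.γ))
  rw [← SymStr.push_comp, ← SymStr.push_comp, inl_comp_desc, inr_comp_desc] at h
  exact h

/-- Cobordism of normal complexes as an additive congruence. -/
def cobordantCon (hB : ∀ p, Module.Finite ℤ (B.X p) ∧ Module.Projective ℤ (B.X p))
    (h0 : ∀ p < 0, Subsingleton (B.X p)) (hn : 0 ≤ n) : AddCon (NormalCx β n) where
  r := Cobordant
  iseqv :=
    { refl := fun x => (cobordant_iff hB h0 hn x x).2 (SymStr.Equiv.refl _)
      symm := fun h => (cobordant_iff hB h0 hn _ _).2 ((cobordant_iff hB h0 hn _ _).1 h).symm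
      trans := fun h h' => (cobordant_iff hB h0 hn _ _).2
        (((cobordant_iff hB h0 hn _ _).1 h).trans ((cobordant_iff hB h0 hn _ _).1 h')) }
  add' := fun h h' => (cobordant_iff hB h0 hn _ _).2
    ((push_add_equiv _ _).trans ((((cobordant_iff hB h0 hn _ _).1 h).add
      ((cobordant_iff hB h0 hn _ _).1 h')).trans (push_add_equiv _ _).symm))

theorem mk_eq_iff (hB : ∀ p, Module.Finite ℤ (B.X p) ∧ Module.Projective ℤ (B.X p))
    (h0 : ∀ p < 0, Subsingleton (B.X p)) (hn : 0 ≤ n) {x y : NormalCx β n} :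
    LHat.mk x = LHat.mk y ↔ x.Cobordant y := by
  refine (AddCon.eq (addConGen (Cobordant (β := β) (n := n))) (a := x) (b := y)).trans ?_
  rw [show addConGen (Cobordant (β := β) (n := n)) = cobordantCon hB h0 hn from
    AddCon.addConGen_of_addCon (cobordantCon hB h0 hn)]
  rfl

/-- A compressed structure lifts to the n-skeleton, which becomes a normal complex with the
inclusion as classifying map. -/
theorem exists_char_eq (hB : ∀ p, Module.Finite ℤ (B.X p) ∧ Module.Projective ℤ (B.X p))
    (h0 : ∀ p < 0, Subsingleton (B.X p)) (hn : 0 ≤ n) (x : SymStr β n) :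
    ∃ z : NormalCx β n, z.char = TwistedQ.mk x := by
  obtain ⟨y, h, hφ, hθ⟩ := x.exists_equiv_supp h0 hn
  obtain ⟨z, rfl⟩ := SymStr.exists_push_eq hφ hθ
  exact ⟨⟨sk B n, isDim_sk hB h0, β.pull (skIncl B n), z, β.pullMap (skIncl B n)⟩,
    SymStr.mk_eq_iff.2 h.symm⟩

theorem char_add (x y : NormalCx β n) : (x + y).char = x.char + y.char :=
  SymStr.mk_eq_iff.2 (push_add_equiv x y)

/-- The characteristic element defines an isomorphism from the cobordism group of normal complexes
to the twisted quadratic group. -/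
theorem exists_addEquiv (hB : ∀ p, Module.Finite ℤ (B.X p) ∧ Module.Projective ℤ (B.X p))
    (h0 : ∀ p < 0, Subsingleton (B.X p)) (hn : 0 ≤ n) :
    ∃ e : LHat β n ≃+ TwistedQ β n, ∀ x : NormalCx β n, e (LHat.mk x) = x.char := by
  have key (x y : NormalCx β n) : LHat.mk x = LHat.mk y ↔ x.char = y.char :=
    ((mk_eq_iff hB h0 hn).trans (cobordant_iff hB h0 hn x y)).trans SymStr.mk_eq_iff.symm
  let f : LHat β n → TwistedQ β n := fun a => Quotient.liftOn' a char fun x y h =>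
    (key x y).1 (Quotient.sound' h)
  have hf (x : NormalCx β n) : f (LHat.mk x) = x.char := rfl
  have hadd (a b : LHat β n) : f (a + b) = f a + f b := by
    induction a using AddCon.induction_on with | H x
    induction b using AddCon.induction_on with | H y
    exact char_add x y
  refine ⟨AddEquiv.ofBijective (AddHom.mk f hadd) ⟨?_, ?_⟩, hf⟩
  · intro a b
    induction a using AddCon.induction_on with | H x
    induction b using AddCon.induction_on with | H y
    exact (key x y).2
  · intro a
    induction a using AddCon.induction_on with | H x
    obtain ⟨z, hz⟩ := exists_char_eq hB h0 hn x
    exact ⟨LHat.mk z, hz⟩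

end NormalCx

/-! ### Integral coordinates on the universal complex -/

/-- The sign `(-1)^k`. -/
def sg (k : ℤ) : ℤ := if k % 2 = 0 then 1 else -1

theorem sgn_eq (k x : ℤ) : sgn k x = sg k * x := by
  by_cases h : Even k
  · rw [sgn_even h, sg, if_pos (Int.even_iff.1 h), one_mul]
  · rw [sgn_odd h, sg, if_neg (fun e => h (Int.even_iff.2 e)), neg_one_mul]

theorem sg_congr {a b : ℤ} (h : (a - b) % 2 = 0) : sg a = sg b := by
  unfold sg
  split_ifs <;> omega

theorem sg_even {a : ℤ} (h : a % 2 = 0) : sg a = 1 := if_pos h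

theorem sg_odd {a : ℤ} (h : a % 2 = 1) : sg a = -1 := if_neg (by omega)

theorem sg_mul_even {a : ℤ} (h : a % 2 = 0) (b : ℤ) : sg (a * b) = 1 :=
  sg_even (by rw [Int.mul_emod, h, zero_mul, Int.zero_emod])

theorem sg_mul_odd {a : ℤ} (h : a % 2 = 1) (b : ℤ) : sg (a * b) = sg b := by
  refine sg_congr ?_
  rw [show a * b - b = (a - 1) * b by ring, Int.mul_emod, show (a - 1) % 2 = 0 by omega, zero_mul,
    Int.zero_emod]

/-- The differential `B(∞)_k → B(∞)_{k-1}`. -/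
def cc (k : ℤ) : ℤ := if k % 2 = 0 then 0 else 2

theorem cc_even {k : ℤ} (h : k % 2 = 0) : cc k = 0 := if_pos h

theorem cc_odd {k : ℤ} (h : k % 2 = 1) : cc k = 2 := if_neg (by omega)

/-- The coefficients of `β(∞)`. -/
def bb (p q : ℤ) : ℤ :=
  if (p % 2 = 0 ∧ q = p) ∨ (p % 2 = 0 ∧ q = p + 1) ∨ (q % 2 = 0 ∧ p = q + 1) then 1 else 0

theorem bb_comm (p q : ℤ) : bb p q = bb q p := by
  unfold bb
  split_ifs <;> omega

theorem bb_add_two (p q : ℤ) : bb (p + 2) (q + 2) = bb p q := by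
  unfold bb
  split_ifs <;> omega

theorem betaCoeff_eq {s p q : ℤ} (h : p + q = -s) : betaCoeff s p q = bb p q := by
  simp only [betaCoeff, bb, h, true_and, Int.even_iff]

/-- Every nonzero component of β(∞) has an even index, so the sign of the transposition is never
felt. -/
theorem sg_mul_bb (p q : ℤ) : sg (p * q) * bb p q = bb p q := by
  unfold bb
  split_ifs with h
  · rcases Int.emod_two_eq_zero_or_one p with hp | hp
    · rw [sg_mul_even hp, one_mul]
    · rw [mul_comm p q, sg_mul_even (by omega), one_mul]
  · rw [mul_zero]

/-- The coordinate isomorphism `B(∞)_p ⊗ B(∞)_q ≅ ℤ` (for `p, q ≥ 0`). -/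
def co (p q : ℤ) : univCx.X p ⊗[ℤ] univCx.X q →ₗ[ℤ] ℤ := TensorProduct.lift (mulForm 1 p q)

theorem co_tmul (p q : ℤ) (x : zNonneg p) (y : zNonneg q) :
    co p q ((show univCx.X p from x) ⊗ₜ[ℤ] (show univCx.X q from y)) = x.1 * y.1 := by
  change 1 * (x.1 * y.1) = _
  rw [one_mul]

/-- The generator of `B(∞)_p`. -/
def gen (p : ℤ) : univCx.X p := (⟨if p < 0 then 0 else 1, fun h => if_pos h⟩ : zNonneg p)

theorem eq_smul_gen (p : ℤ) (x : univCx.X p) : x = (Subtype.val x : ℤ) • gen p := by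
  apply Subtype.ext
  change Subtype.val x = (Subtype.val x : ℤ) * (if p < 0 then 0 else 1)
  split_ifs with h
  · rw [Subtype.prop x h, zero_mul]
  · rw [mul_one]

/-- The element of `B(∞)_p ⊗ B(∞)_q` with coordinate `c`. -/
def el (p q c : ℤ) : univCx.X p ⊗[ℤ] univCx.X q := c • (gen p ⊗ₜ gen q)

theorem el_co (p q : ℤ) (x : univCx.X p ⊗[ℤ] univCx.X q) : el p q (co p q x) = x := by
  induction x with
  | zero => rw [map_zero, el, zero_smul]
  | add x y hx hy => rw [map_add, el, add_smul]; exact congrArg₂ (· + ·) hx hy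
  | tmul a b =>
    have h : co p q (a ⊗ₜ b) = Subtype.val a * Subtype.val b := co_tmul p q a b
    rw [h]
    conv_rhs => rw [eq_smul_gen p a, eq_smul_gen q b, TensorProduct.smul_tmul_smul]
    rfl

theorem co_injective (p q : ℤ) : Function.Injective (co p q) :=
  Function.LeftInverse.injective (el_co p q)

theorem co_el (p q c : ℤ) : co p q (el p q c) = if p < 0 ∨ q < 0 then 0 else c := by
  rw [el, map_smul]
  have h : co p q (gen p ⊗ₜ gen q) = (if p < 0 then 0 else 1) * (if q < 0 then 0 else 1) :=
    co_tmul p q (gen p) (gen q)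
  rw [h]
  by_cases hp : p < 0 <;> by_cases hq : q < 0 <;> simp [hp, hq]

theorem univ_subsingleton {p : ℤ} (hp : p < 0) : Subsingleton (univCx.X p) :=
  ⟨fun x y => Subtype.ext ((Subtype.prop x hp).trans (Subtype.prop y hp).symm)⟩

theorem univ_finite_projective (p : ℤ) :
    Module.Finite ℤ (univCx.X p) ∧ Module.Projective ℤ (univCx.X p) := by
  by_cases hp : p < 0
  · have := univ_subsingleton hp
    exact ⟨inferInstance, inferInstance⟩
  · let e : ℤ ≃+ zNonneg p :=
      { toFun := fun x => ⟨x, fun h => absurd h hp⟩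
        invFun := fun x => x.1
        left_inv := fun _ => rfl
        right_inv := fun _ => rfl
        map_add' := fun _ _ => rfl }
    let e' : ℤ ≃ₗ[ℤ] univCx.X p := e.toIntLinearEquiv
    exact ⟨Module.Finite.equiv e', Module.Projective.of_equiv e'⟩

theorem dCoeff_succ (q : ℤ) : dCoeff (q + 1) q = cc (q + 1) := by
  simp only [dCoeff, cc, true_and, Int.odd_iff]
  split_ifs <;> omega

theorem co_lTensor (p q : ℤ) (x : univCx.X p ⊗[ℤ] univCx.X (q + 1)) :
    co p q ((dl univCx (q + 1) q).lTensor (univCx.X p) x) = cc (q + 1) * co p (q + 1) x := by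
  induction x with
  | zero => simp
  | add x y hx hy => rw [map_add, map_add, map_add, hx, hy, mul_add]
  | tmul a b =>
    have h : co p (q + 1) (a ⊗ₜ b) = Subtype.val a * Subtype.val b := co_tmul p (q + 1) a b
    rw [h, ← dCoeff_succ]
    refine (co_tmul p q a (dUniv (q + 1) q b)).trans ?_
    change _ * (dCoeff (q + 1) q * Subtype.val b) = _
    ring

theorem co_rTensor (p q : ℤ) (x : univCx.X (p + 1) ⊗[ℤ] univCx.X q) :
    co p q ((dl univCx (p + 1) p).rTensor (univCx.X q) x) = cc (p + 1) * co (p + 1) q x := by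
  induction x with
  | zero => simp
  | add x y hx hy => rw [map_add, map_add, map_add, hx, hy, mul_add]
  | tmul a b =>
    have h : co (p + 1) q (a ⊗ₜ b) = Subtype.val a * Subtype.val b := co_tmul (p + 1) q a b
    rw [h, ← dCoeff_succ]
    refine (co_tmul p q (dUniv (p + 1) p a) b).trans ?_
    change (dCoeff (p + 1) p * Subtype.val a) * _ = _
    ring

theorem co_comm (p q : ℤ) (x : univCx.X q ⊗[ℤ] univCx.X p) :
    co p q (TensorProduct.comm ℤ (univCx.X q) (univCx.X p) x) = co q p x := by
  induction x with
  | zero => simp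
  | add x y hx hy => rw [map_add, map_add, map_add, hx, hy]
  | tmul a b => exact (co_tmul p q b a).trans ((mul_comm _ _).trans (co_tmul q p a b).symm)

theorem co_contr (c a b p q : ℤ) (x : univCx.X a ⊗[ℤ] univCx.X p)
    (y : univCx.X b ⊗[ℤ] univCx.X q) :
    co p q (contr (A := univCx.X a) (B := univCx.X b) (mulForm c a b) x y) =
      c * (co a p x * co b q y) := by
  induction x with
  | zero => simp
  | add x x' hx hx' => rw [map_add, LinearMap.add_apply, map_add, map_add, hx, hx']; ring
  | tmul u v =>
    induction y with
    | zero => simp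
    | add y y' hy hy' => rw [map_add, map_add, map_add, hy, hy']; ring
    | tmul w z =>
      have h1 : co a p (u ⊗ₜ v) = Subtype.val u * Subtype.val v := co_tmul a p u v
      have h2 : co b q (w ⊗ₜ z) = Subtype.val w * Subtype.val z := co_tmul b q w z
      have h3 : co p q (v ⊗ₜ z) = Subtype.val v * Subtype.val z := co_tmul p q v z
      rw [h1, h2]
      refine (map_smul (co p q) (c * (Subtype.val u * Subtype.val w) : ℤ) (v ⊗ₜ[ℤ] z)).trans ?_
      rw [h3, smul_eq_mul]
      ring

/-- The coordinates of a family `θ_s ∈ (B(∞) ⊗ B(∞))_{k+s}`. -/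
def coord (k : ℤ) (θ : ℤ → Tens univCx) (p q : ℤ) : ℤ := co p q (θ (p + q - k) p q)

theorem coord_add (k : ℤ) (θ η : ℤ → Tens univCx) (p q : ℤ) :
    coord k (θ + η) p q = coord k θ p q + coord k η p q := map_add (co p q) _ _

theorem coord_sub (k : ℤ) (θ η : ℤ → Tens univCx) (p q : ℤ) :
    coord k (θ - η) p q = coord k θ p q - coord k η p q := map_sub (co p q) _ _

theorem coord_zero (k p q : ℤ) : coord k 0 p q = 0 := map_zero (co p q)

theorem coord_left (k : ℤ) (θ : ℤ → Tens univCx) {p : ℤ} (hp : p < 0) (q : ℤ) :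
    coord k θ p q = 0 := by
  rw [coord, tensor_eq_zero_left (univ_subsingleton hp) (θ (p + q - k) p q), map_zero]

theorem coord_right (k : ℤ) (θ : ℤ → Tens univCx) (p : ℤ) {q : ℤ} (hq : q < 0) :
    coord k θ p q = 0 := by
  rw [coord, tensor_eq_zero_right (univ_subsingleton hq) (θ (p + q - k) p q), map_zero]

theorem coord_low {k : ℤ} {φ : ℤ → Tens univCx} (h : φ ∈ symChains univCx k) {p q : ℤ}
    (hpq : p + q < k) : coord k φ p q = 0 := by
  rw [coord, h.2 _ (by omega)]
  exact map_zero (co p q)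

theorem co_eq_coord {k : ℤ} (θ : ℤ → Tens univCx) {s p q : ℤ} (h : p + q = k + s) :
    co p q (θ s p q) = coord k θ p q := by
  obtain rfl : s = p + q - k := by omega
  rfl

/-- As s = p + q - k is forced, a chain of degree k is nothing but one integer for each bidegree. -/
theorem hyper_ext {k : ℤ} {θ η : ℤ → Tens univCx} (hθ : θ ∈ hyperChains univCx k)
    (hη : η ∈ hyperChains univCx k) (h : ∀ p q, coord k θ p q = coord k η p q) : θ = η := by
  funext s p q
  by_cases e : p + q = k + s
  · apply co_injective
    rw [co_eq_coord θ e, co_eq_coord η e, h]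
  · rw [hθ.1 s p q e, hη.1 s p q e]

/-- The differential in coordinates. -/
def Dop (m : ℤ) (u : ℤ → ℤ → ℤ) (p q : ℤ) : ℤ :=
  cc (q + 1) * u p (q + 1) + sg q * (cc (p + 1) * u (p + 1) q) +
    sg (p + q) * (u p q + sg (p + q - m + p * q) * u q p)

theorem co_sgn (k p q : ℤ) (x : univCx.X p ⊗[ℤ] univCx.X q) :
    co p q (sgn k x) = sg k * co p q x := by
  rw [map_sgn (co p q), sgn_eq]

theorem coord_dW {m k : ℤ} (hk : k = m + 1) (θ : ℤ → Tens univCx) (p q : ℤ) :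
    coord m (dW univCx k θ) p q = Dop m (coord k θ) p q := by
  subst hk
  rw [coord, dW_apply, map_add, map_add, co_lTensor, co_sgn, co_rTensor, co_sgn, map_add, co_sgn,
    co_sgn, co_comm, co_eq_coord θ (k := m + 1) (s := p + q - m) (by ring),
    co_eq_coord θ (k := m + 1) (s := p + q - m) (by ring),
    co_eq_coord θ (k := m + 1) (s := p + q - m - 1) (by ring),
    co_eq_coord θ (k := m + 1) (s := p + q - m - 1) (by ring), ← mul_assoc (sg (p + q - m))]
  have e : sg (p + q - m) * sg (p * q) = sg (p + q - m + p * q) := by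
    unfold sg
    split_ifs <;> first | rfl | omega
  rw [e, show m + 1 + (p + q - m) - 1 = p + q by ring]
  rfl

theorem coord_slant (m k p q s : ℤ) (x y : Tens univCx) (h : m - p + (k - q) = -s) :
    co p q (slant m k x y (univBundle.form s) p q) =
      sg (m * (k - q)) * (bb (m - p) (k - q) * (co (m - p) p (x (m - p) p) *
        co (k - q) q (y (k - q) q))) := by
  refine (co_sgn _ _ _ _).trans ?_
  refine congrArg _ ((co_contr _ _ _ _ _ _ _).trans ?_)
  rw [betaCoeff_eq h]

/-- The coordinates of β(∞) are invariant under transposition, by `bb_comm` and `sg_mul_bb`, so the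
formula is that of `coord_slant`. -/
theorem coord_slant_trF (m k p q s : ℤ) (x y : Tens univCx) (h : m - p + (k - q) = -s) :
    co p q (slant m k x y (trF univCx (univBundle.form s)) p q) =
      sg (m * (k - q)) * (bb (m - p) (k - q) * (co (m - p) p (x (m - p) p) *
        co (k - q) q (y (k - q) q))) := by
  change co p q (sgn (m * (k - q)) (contr (sgn ((m - p) * (k - q))
      ((univBundle.form s) (k - q) (m - p)).flip)
    (x (m - p) p) (y (k - q) q))) = _
  rw [contr_sgn, co_sgn, co_sgn]
  have e : ((univBundle.form s) (k - q) (m - p)).flip =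
      (show univCx.X (m - p) →ₗ[ℤ] univCx.X (k - q) →ₗ[ℤ] ℤ from
        mulForm (betaCoeff s (k - q) (m - p)) (m - p) (k - q)) := by
    refine LinearMap.ext₂ fun u v => ?_
    change betaCoeff s (k - q) (m - p) * (Subtype.val v * Subtype.val u) =
      betaCoeff s (k - q) (m - p) * (Subtype.val u * Subtype.val v)
    rw [mul_comm (Subtype.val v)]
  have e' := co_contr (betaCoeff s (k - q) (m - p)) _ _ p q (x (m - p) p) (y (k - q) q)
  rw [e, e', betaCoeff_eq (by omega), bb_comm, ← mul_assoc (sg ((m - p) * (k - q))), sg_mul_bb]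

theorem coord_twist (n p q : ℤ) (φ : ℤ → Tens univCx) :
    coord n (twist n (φ 0) univBundle.form) p q = sg (n * (n - q)) *
      (bb (n - p) (n - q) * (coord n φ (n - p) p * coord n φ (n - q) q)) := by
  refine (coord_slant n n p q _ _ _ (by ring)).trans ?_
  rw [co_eq_coord φ (k := n) (by ring), co_eq_coord φ (k := n) (by ring)]

theorem coord_bracket (n p q : ℤ) (φ ψ : ℤ → Tens univCx) :
    coord (n + 1) (bracket n (φ 0) (ψ 0) univBundle.form) p q = -(sg (n * (n - q)) *
      (bb (n - p) (n - q) * (coord n φ (n - p) p * coord n ψ (n - q) q))) := by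
  refine (map_neg (co p q) _).trans (congrArg Neg.neg ?_)
  refine (coord_slant_trF n n p q _ _ _ (by ring)).trans ?_
  rw [co_eq_coord φ (k := n) (by ring), co_eq_coord ψ (k := n) (by ring)]

/-- The twisted homotopy in coordinates. -/
def tHop (n : ℤ) (g x y : ℤ → ℤ → ℤ) (p q : ℤ) : ℤ :=
  sg (n * (n + 1 - q)) * (bb (n - p) (n + 1 - q) * (x (n - p) p * g (n + 1 - q) q)) +
    sg n * (sg ((n + 1) * (n - q)) * (bb (n + 1 - p) (n - q) * (g (n + 1 - p) p * y (n - q) q))) +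
    sg n * (sg ((n + 1) * (n + 1 - q)) *
      (bb (n + 1 - p) (n + 1 - q) * (g (n + 1 - p) p * g (n + 1 - q) q)))

theorem coord_twistHomotopy (n p q : ℤ) (ξ φ ψ : ℤ → Tens univCx) :
    coord (n + 1) (twistHomotopy n (ξ 0) (φ 0) (ψ 0) univBundle.form) p q =
      tHop n (coord (n + 1) ξ) (coord n φ) (coord n ψ) p q := by
  change co p q (slant n (n + 1) (φ 0) (ξ 0) _ p q + (sgn n (slant (n + 1) n (ξ 0) (ψ 0) _)) p q +
    (sgn n (slant (n + 1) (n + 1) (ξ 0) (ξ 0) (trF univCx _))) p q) = _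
  rw [map_add, map_add, sgn_apply₂, sgn_apply₂, co_sgn, co_sgn,
    coord_slant n (n + 1) p q _ _ _ (by ring), coord_slant (n + 1) n p q _ _ _ (by ring),
    coord_slant_trF (n + 1) (n + 1) p q _ _ _ (by ring), co_eq_coord φ (k := n) (by ring),
    co_eq_coord ψ (k := n) (by ring), co_eq_coord ξ (k := n + 1) (by ring),
    co_eq_coord ξ (k := n + 1) (by ring)]
  rfl

/-- `u` is supported in a finite subset of the quadrant `p, q ≥ 0`. -/
def FinSupp (u : ℤ → ℤ → ℤ) : Prop :=
  ∃ N : ℤ, ∀ p q, (p < 0 ∨ q < 0 ∨ N < p ∨ N < q) → u p q = 0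

theorem finSupp_coord {k : ℤ} {θ : ℤ → Tens univCx} (h : θ ∈ hyperChains univCx k) :
    FinSupp (coord k θ) := by
  obtain ⟨-, N, hN⟩ := h
  refine ⟨N, fun p q e => ?_⟩
  by_cases hp : p < 0
  · exact coord_left k θ hp q
  by_cases hq : q < 0
  · exact coord_right k θ p hq
  rw [coord, hN, map_zero]
  rw [abs_of_nonneg (by omega), abs_of_nonneg (by omega)]
  omega

/-- The family with given coordinates. -/
def fam (k : ℤ) (u : ℤ → ℤ → ℤ) : ℤ → Tens univCx := fun s p q =>
  if p + q = k + s then el p q (u p q) else 0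

theorem coord_fam (k : ℤ) {u : ℤ → ℤ → ℤ} (hu : FinSupp u) (p q : ℤ) :
    coord k (fam k u) p q = u p q := by
  obtain ⟨N, hN⟩ := hu
  rw [coord, fam, if_pos (by ring), co_el]
  split_ifs with h
  · exact (hN p q (by omega)).symm
  · rfl

theorem fam_hyper (k : ℤ) {u : ℤ → ℤ → ℤ} (hu : FinSupp u) : fam k u ∈ hyperChains univCx k := by
  obtain ⟨N, hN⟩ := hu
  have e0 (p q : ℤ) : el p q 0 = 0 := zero_smul _ _
  refine ⟨fun s p q e => if_neg e, |N|, fun s p q e => ?_⟩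
  rw [fam, hN p q, e0, ite_self]
  have h1 := le_abs_self N
  rcases e with e | e
  · rcases lt_abs.1 e with e | e <;> have := abs_nonneg N <;> omega
  · rcases lt_abs.1 e with e | e <;> have := abs_nonneg N <;> omega

theorem fam_sym {k : ℤ} {u : ℤ → ℤ → ℤ} (hu : FinSupp u) (h : ∀ p q, p + q < k → u p q = 0) :
    fam k u ∈ symChains univCx k := by
  refine ⟨fam_hyper k hu, fun s hs => ?_⟩
  funext p q
  have e0 (p q : ℤ) : el p q 0 = 0 := zero_smul _ _
  by_cases e : p + q = k + s
  · rw [fam, h p q (by omega), e0, ite_self]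
    rfl
  · exact if_neg e

theorem wu_univ (r : ℤ) (x : univCx.X r) :
    univBundle.wu r x = bb r r * (Subtype.val x * Subtype.val x) := by
  rw [← betaCoeff_eq (s := -2 * r) (by ring)]
  rfl

theorem dl_univ_eq {i j : ℤ} (h : i = j + 1) (x : univCx.X i) (y : univCx.X j) :
    dl univCx i j x = y ↔ cc i * Subtype.val x = Subtype.val y := by
  subst h
  rw [← dCoeff_succ]
  exact Subtype.ext_iff

/-- For r even all of ℤ consists of cycles, the boundaries are 2ℤ and the Wu class is x² ≡ x mod 2.
For r odd there are no nonzero cycles, and a = -a forces a = 0. -/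
theorem univBundle_isUniversal : univBundle.IsUniversal := by
  intro r hr
  have hz (x : univCx.X r) : dl univCx r (r - 1) x = 0 ↔ cc r * Subtype.val x = 0 :=
    dl_univ_eq (by ring) x 0
  have mk (a k : ℤ) (hk : 0 ≤ k) : ∃ x : univCx.X k, Subtype.val x = a :=
    ⟨(⟨a, fun h => absurd hk (by omega)⟩ : zNonneg k), rfl⟩
  have hadd (x y : univCx.X r) : Subtype.val (x + y) = Subtype.val x + Subtype.val y := rfl
  simp only [wu_univ, sgn_eq, hz, dl_univ_eq (rfl : r + 1 = r + 1)]
  rcases Int.emod_two_eq_zero_or_one r with h | h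
  · rw [sg_even h, cc_even h, cc_odd (k := r + 1) (by omega),
      show bb r r = 1 from if_pos (Or.inl ⟨h, rfl⟩)]
    refine ⟨fun x _ => by ring, fun x y _ _ => ⟨Subtype.val x * Subtype.val y, ?_⟩,
      fun x _ => ⟨?_, ?_⟩, fun a _ => ?_⟩
    · rw [hadd]
      ring
    · rintro ⟨b, hb⟩
      have h2 : Even (Subtype.val x : ℤ) := by
        have : Even (Subtype.val x * Subtype.val x : ℤ) := ⟨b, by linarith⟩
        simpa using (Int.even_mul.1 this)
      obtain ⟨c, hc⟩ := h2
      obtain ⟨z, hz⟩ := mk c (r + 1) (by omega)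
      exact ⟨z, by rw [hz, hc]; ring⟩
    · rintro ⟨z, hz⟩
      refine ⟨2 * (Subtype.val z * Subtype.val z), ?_⟩
      rw [← hz]
      ring
    · obtain ⟨x, hx⟩ := mk a r hr
      obtain ⟨c, hc⟩ := Int.even_mul_pred_self a
      exact ⟨x, by ring, c, by rw [hx]; linarith⟩
  · rw [sg_odd h, cc_odd h, cc_even (k := r + 1) (by omega),
      show bb r r = 0 from if_neg (by omega)]
    refine ⟨fun x _ => by ring, fun x y _ _ => ⟨0, by ring⟩,
      fun x hx => ⟨fun _ => ⟨0, ?_⟩, fun _ => ⟨0, by ring⟩⟩, fun a ha => ?_⟩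
    · linarith
    · obtain ⟨x, hx⟩ := mk 0 r hr
      exact ⟨x, by rw [hx]; ring, 0, by linarith⟩

/-! ### Symmetric structures on the universal bundle in coordinates -/

/-- The coordinates of `(φ₀)^% (S^n β(∞))`. -/
def Tw (n : ℤ) (F : ℤ → ℤ → ℤ) (p q : ℤ) : ℤ :=
  sg (n * (n - q)) * (bb (n - p) (n - q) * (F (n - p) p * F (n - q) q))

/-- `F` and `Θ` are the coordinates of an `n`-dimensional symmetric structure on `β(∞)`. -/
structure IsCoord (n : ℤ) (F Θ : ℤ → ℤ → ℤ) : Prop where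
  finF : FinSupp F
  finΘ : FinSupp Θ
  low : ∀ p q, p + q < n → F p q = 0
  cycle : ∀ p q, Dop (n - 1) F p q = 0
  eq : ∀ p q, F p q - Tw n F p q = Dop n Θ p q

namespace SymStr

variable {n : ℤ}

/-- The coordinates of `φ`. -/
def cφ (x : SymStr univBundle n) : ℤ → ℤ → ℤ := coord n x.φ

/-- The coordinates of `θ`. -/
def cθ (x : SymStr univBundle n) : ℤ → ℤ → ℤ := coord (n + 1) x.θ

theorem isCoord (x : SymStr univBundle n) : IsCoord n x.cφ x.cθ where
  finF := finSupp_coord x.φ_mem.1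
  finΘ := finSupp_coord x.θ_mem
  low p q h := coord_low x.φ_mem h
  cycle p q := by
    rw [cφ, ← coord_dW (m := n - 1) (k := n) (by ring), x.φ_cycle, coord_zero]
  eq p q := by
    rw [cθ, ← coord_dW rfl, ← x.eq, coord_sub, coord_twist]
    rfl

theorem cφ_left (x : SymStr univBundle n) {p : ℤ} (hp : p < 0) (q : ℤ) : x.cφ p q = 0 :=
  coord_left n x.φ hp q

theorem cφ_right (x : SymStr univBundle n) (p : ℤ) {q : ℤ} (hq : q < 0) : x.cφ p q = 0 :=
  coord_right n x.φ p hq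

theorem cθ_left (x : SymStr univBundle n) {p : ℤ} (hp : p < 0) (q : ℤ) : x.cθ p q = 0 :=
  coord_left (n + 1) x.θ hp q

theorem cθ_right (x : SymStr univBundle n) (p : ℤ) {q : ℤ} (hq : q < 0) : x.cθ p q = 0 :=
  coord_right (n + 1) x.θ p hq

theorem exists_of_isCoord {F Θ : ℤ → ℤ → ℤ} (h : IsCoord n F Θ) :
    ∃ x : SymStr univBundle n, x.cφ = F ∧ x.cθ = Θ := by
  have hF : coord n (fam n F) = F := funext₂ fun p q => coord_fam n h.finF p q
  have hΘ : coord (n + 1) (fam (n + 1) Θ) = Θ := funext₂ fun p q => coord_fam (n + 1) h.finΘ p q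
  have mF : fam n F ∈ symChains univCx n := fam_sym h.finF h.low
  have mΘ : fam (n + 1) Θ ∈ hyperChains univCx (n + 1) := fam_hyper (n + 1) h.finΘ
  have ht := twist_mem mF.1 univBundle.mem
  rw [add_zero] at ht
  refine ⟨⟨fam n F, fam (n + 1) Θ, mF, ?_, mΘ, ?_⟩, hF, hΘ⟩
  · refine hyper_ext (k := n - 1) (dW_hyper (by ring) mF.1) (zero_mem _) fun p q => ?_
    rw [coord_dW (by ring), hF, coord_zero, h.cycle]
  · refine hyper_ext (sub_mem mF.1 ht) (dW_hyper rfl mΘ) fun p q => ?_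
    rw [coord_dW rfl, hΘ, coord_sub, coord_twist, hF, ← h.eq]
    rfl

theorem equiv_iff (x y : SymStr univBundle n) : x.Equiv y ↔
    ∃ g η : ℤ → ℤ → ℤ, FinSupp g ∧ FinSupp η ∧ (∀ p q, p + q < n + 1 → g p q = 0) ∧
      (∀ p q, y.cφ p q - x.cφ p q = Dop n g p q) ∧
      ∀ p q, y.cθ p q - x.cθ p q - g p q + tHop n g x.cφ y.cφ p q = Dop (n + 1) η p q := by
  constructor
  · rintro ⟨ξ, hξ, η, hη, h1, h2⟩
    refine ⟨coord (n + 1) ξ, coord (n + 2) η, finSupp_coord hξ.1, finSupp_coord hη,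
      fun p q => coord_low hξ, fun p q => ?_, fun p q => ?_⟩
    · rw [← coord_dW rfl, ← h1, coord_sub]
      rfl
    · rw [← coord_dW (by ring), ← h2, coord_add, coord_sub, coord_sub, coord_twistHomotopy]
      rfl
  · rintro ⟨g, η, hg, hη, h0, h1, h2⟩
    have eg : coord (n + 1) (fam (n + 1) g) = g := funext₂ fun p q => coord_fam (n + 1) hg p q
    have eη : coord (n + 2) (fam (n + 2) η) = η := funext₂ fun p q => coord_fam (n + 2) hη p q
    have mg : fam (n + 1) g ∈ symChains univCx (n + 1) := fam_sym hg h0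
    have mη : fam (n + 2) η ∈ hyperChains univCx (n + 2) := fam_hyper (n + 2) hη
    refine ⟨_, mg, _, mη, ?_, ?_⟩
    · refine hyper_ext (sub_mem y.φ_mem.1 x.φ_mem.1) (dW_hyper rfl mg.1) fun p q => ?_
      rw [coord_dW rfl, eg, coord_sub, ← h1]
      rfl
    · refine hyper_ext (add_mem (sub_mem (sub_mem y.θ_mem x.θ_mem) mg.1) (twistHomotopy_mem
        (bounded_apply mg.1 0) x.bounded y.bounded _)) (dW_hyper (by ring) mη) fun p q => ?_
      rw [coord_dW (by ring), eη, coord_add, coord_sub, coord_sub, coord_twistHomotopy, eg, ← h2]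
      rfl

theorem exists_move (x : SymStr univBundle n) {g η : ℤ → ℤ → ℤ} (hg : FinSupp g)
    (hη : FinSupp η) (h0 : ∀ p q, p + q < n + 1 → g p q = 0) :
    ∃ y : SymStr univBundle n, x.Equiv y ∧ (∀ p q, y.cφ p q = x.cφ p q + Dop n g p q) ∧
      ∀ p q, y.cθ p q =
        x.cθ p q + g p q - tHop n g x.cφ y.cφ p q + Dop (n + 1) η p q := by
  have eg : coord (n + 1) (fam (n + 1) g) = g := funext₂ fun p q => coord_fam (n + 1) hg p q
  have eη : coord (n + 2) (fam (n + 2) η) = η := funext₂ fun p q => coord_fam (n + 2) hη p q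
  have mg : fam (n + 1) g ∈ symChains univCx (n + 1) := fam_sym hg h0
  have mη : fam (n + 2) η ∈ hyperChains univCx (n + 2) := fam_hyper (n + 2) hη
  let y := x.move mg mη
  have e1 : y.φ = x.φ + dW univCx (n + 1) (fam (n + 1) g) := rfl
  have e2 : y.φ 0 = x.φ 0 + dT univCx (fam (n + 1) g 0) := by
    rw [e1, Pi.add_apply, dW_apply_zero mg]
  have e3 : y.θ = x.θ + fam (n + 1) g - twistHomotopy n (fam (n + 1) g 0) (x.φ 0) (y.φ 0)
      univBundle.form + dW univCx (n + 2) (fam (n + 2) η) := by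
    rw [e2]
    rfl
  refine ⟨y, x.equiv_move mg mη, fun p q => ?_, fun p q => ?_⟩
  · rw [cφ, e1, coord_add, coord_dW rfl, eg]
    rfl
  · rw [cθ, e3, coord_add, coord_sub, coord_add, coord_twistHomotopy, eg, coord_dW (by ring), eη]
    rfl

theorem cφ_add (x y : SymStr univBundle n) (p q : ℤ) :
    (x + y).cφ p q = x.cφ p q + y.cφ p q := coord_add n x.φ y.φ p q

theorem cθ_add (x y : SymStr univBundle n) (p q : ℤ) :
    (x + y).cθ p q = x.cθ p q + y.cθ p q - sg (n * (n - q)) *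
      (bb (n - p) (n - q) * (x.cφ (n - p) p * y.cφ (n - q) q)) := by
  rw [cθ, add_θ, coord_add, coord_add, coord_bracket, ← sub_eq_add_neg]
  rfl

theorem cφ_zero (p q : ℤ) : (0 : SymStr univBundle n).cφ p q = 0 := coord_zero n p q

theorem cθ_zero (p q : ℤ) : (0 : SymStr univBundle n).cθ p q = 0 := coord_zero (n + 1) p q

theorem ext_coord {x y : SymStr univBundle n} (h : ∀ p q, x.cφ p q = y.cφ p q)
    (h' : ∀ p q, x.cθ p q = y.cθ p q) : x = y :=
  SymStr.ext (hyper_ext x.φ_mem.1 y.φ_mem.1 h) (hyper_ext x.θ_mem y.θ_mem h')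

end SymStr

/-! ### Evaluation of the operations -/

/-- The evaluation lemmas from here on have linear or parity conditions as hypotheses, so that
`simp` can discharge them with `omega` and thereby choose the right branch. -/
theorem bb_eq_zero {p q : ℤ}
    (h : ¬((p % 2 = 0 ∧ q = p) ∨ (p % 2 = 0 ∧ q = p + 1) ∨ (q % 2 = 0 ∧ p = q + 1))) :
    bb p q = 0 := if_neg h

theorem bb_eq_one {p q : ℤ}
    (h : (p % 2 = 0 ∧ q = p) ∨ (p % 2 = 0 ∧ q = p + 1) ∨ (q % 2 = 0 ∧ p = q + 1)) :
    bb p q = 1 := if_pos h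

theorem Tw_even {n : ℤ} (hn : n % 2 = 0) (F : ℤ → ℤ → ℤ) (p q : ℤ) :
    Tw n F p q = bb (n - p) (n - q) * (F (n - p) p * F (n - q) q) := by
  rw [Tw, sg_mul_even hn, one_mul]

theorem Tw_odd {n : ℤ} (hn : n % 2 = 1) (F : ℤ → ℤ → ℤ) (p q : ℤ) :
    Tw n F p q = -sg q * (bb (n - p) (n - q) * (F (n - p) p * F (n - q) q)) := by
  rw [Tw, sg_mul_odd hn, sg_congr (a := n - q) (b := 1 + q) (by omega)]
  congr 1
  unfold sg
  split_ifs <;> omega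

theorem tHop_even {n : ℤ} (hn : n % 2 = 0) (g x y : ℤ → ℤ → ℤ) (p q : ℤ) :
    tHop n g x y p q = bb (n - p) (n + 1 - q) * (x (n - p) p * g (n + 1 - q) q) +
      sg q * (bb (n + 1 - p) (n - q) * (g (n + 1 - p) p * y (n - q) q)) -
      sg q * (bb (n + 1 - p) (n + 1 - q) * (g (n + 1 - p) p * g (n + 1 - q) q)) := by
  rw [tHop, sg_mul_even hn, sg_even hn, sg_mul_odd (a := n + 1) (by omega),
    sg_mul_odd (a := n + 1) (by omega), sg_congr (a := n - q) (b := q) (by omega)]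
  have : sg (n + 1 - q) = -sg q := by
    unfold sg
    split_ifs <;> omega
  rw [this]
  ring

theorem tHop_odd {n : ℤ} (hn : n % 2 = 1) (g x y : ℤ → ℤ → ℤ) (p q : ℤ) :
    tHop n g x y p q = sg q * (bb (n - p) (n + 1 - q) * (x (n - p) p * g (n + 1 - q) q)) -
      bb (n + 1 - p) (n - q) * (g (n + 1 - p) p * y (n - q) q) -
      bb (n + 1 - p) (n + 1 - q) * (g (n + 1 - p) p * g (n + 1 - q) q) := by
  rw [tHop, sg_mul_odd hn, sg_odd hn, sg_mul_even (a := n + 1) (by omega),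
    sg_mul_even (a := n + 1) (by omega), sg_congr (a := n + 1 - q) (b := q) (by omega)]
  ring

/-- In an even row the sign (-1)^(pq) is trivial and the differential from row p + 1 is 2. -/
theorem Dop_even {p : ℤ} (hp : p % 2 = 0) (m : ℤ) (u : ℤ → ℤ → ℤ) (q : ℤ) :
    Dop m u p q = cc (q + 1) * u p (q + 1) + sg q * (2 * u (p + 1) q) +
      sg q * (u p q + sg (q - m) * u q p) := by
  rw [Dop, sg_congr (a := p + q - m + p * q) (b := q - m), sg_congr (a := p + q) (b := q),
    cc_odd (k := p + 1) (by omega)]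
  · omega
  · rw [show p + q - m + p * q - (q - m) = p * (1 + q) by ring, Int.mul_emod, hp, zero_mul,
      Int.zero_emod]

/-- In an odd row the differential from row p + 1 is 0, and the sign of the transposed term no
longer depends on q. -/
theorem Dop_odd {p : ℤ} (hp : p % 2 = 1) (m : ℤ) (u : ℤ → ℤ → ℤ) (q : ℤ) :
    Dop m u p q = cc (q + 1) * u p (q + 1) - sg q * (u p q - sg m * u q p) := by
  rw [Dop, cc_even (k := p + 1) (by omega), sg_congr (a := p + q - m + p * q) (b := 1 + m),
    sg_congr (a := p + q) (b := 1 + q) (by omega)]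
  · have e (k : ℤ) : sg (1 + k) = -sg k := by
      unfold sg
      split_ifs <;> omega
    rw [e, e]
    ring
  · rw [show p + q - m + p * q - (1 + m) = (p + 1) * (1 + q) + 2 * (-1 - m) by ring,
      Int.add_mul_emod_self_left, Int.mul_emod, show (p + 1) % 2 = 0 by omega, zero_mul,
      Int.zero_emod]

/-! ### The invariants -/

namespace SymStr

/-- With g the entry (h, h+1) of ξ, the change is 4g(g + 1) - 8η(h+1, h+1). The square comes from
the twisted homotopy, the rest of 4g from φ and from ξ itself. -/
theorem Equiv.invariant_zero {h : ℤ} (hn : n = 2 * h) (hh : h % 2 = 0)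
    {x y : SymStr univBundle n} (e : x.Equiv y) : ∃ k,
      y.cφ h h + 2 * y.cθ h (h + 1) - 2 * y.cθ (h + 1) h -
      (x.cφ h h + 2 * x.cθ h (h + 1) - 2 * x.cθ (h + 1) h) = 8 * k := by
  subst hn
  obtain ⟨g, η, -, -, h0, h1, h2⟩ := (equiv_iff x y).1 e
  have a1 := h1 h h
  have a2 := h2 h (h + 1)
  have a3 := h2 (h + 1) h
  simp (disch := omega) only [tHop_even, Dop_even, Dop_odd, cc_even, cc_odd, sg_even, sg_odd,
    bb_eq_zero, bb_eq_one, h0 h h] at a1 a2 a3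
  rw [show 2 * h - h = h by ring, show 2 * h + 1 - (h + 1) = h by ring,
    show 2 * h + 1 - h = h + 1 by ring] at a2 a3
  obtain ⟨c, hc⟩ := Int.even_mul_succ_self (g h (h + 1))
  -- The factor 2 g(h,h+1) on the equation for φ(h,h) rewrites the change of φ(h,h) as 2g(h,h+1) +
  -- 2g(h+1,h); this cancels the mixed product g(h,h+1) g(h+1,h) and leaves the square.
  exact ⟨c - η (h + 1) (h + 1), by
    linear_combination (1 + 2 * g h (h + 1)) * a1 + 2 * a2 - 2 * a3 + 4 * hc⟩

/-- Only the entry (h+1, h+1) of ξ reaches position (h, h+1), with coefficient -2: the entry (h,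
h+2) has coefficient 0, and ξ vanishes in total degree 2h + 1. -/
theorem Equiv.invariant_one {h : ℤ} (hn : n = 2 * h + 1) (hh : h % 2 = 0)
    {x y : SymStr univBundle n} (e : x.Equiv y) : ∃ k, y.cφ h (h + 1) - x.cφ h (h + 1) = 2 * k := by
  subst hn
  obtain ⟨g, η, -, -, h0, h1, h2⟩ := (equiv_iff x y).1 e
  have a1 := h1 h (h + 1)
  simp (disch := omega) only [Dop_even, cc_even, sg_even, sg_odd, h0] at a1
  exact ⟨-g (h + 1) (h + 1), by linear_combination a1⟩

/-- At (h, h) the linear term of ξ meets the square of the same entry in the twisted homotopy, so θ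
changes by g + g², up to even contributions of η. -/
theorem Equiv.invariant_three {h : ℤ} (hn : n = 2 * h - 1) (hh : h % 2 = 0)
    {x y : SymStr univBundle n} (e : x.Equiv y) : ∃ k, y.cθ h h - x.cθ h h = 2 * k := by
  subst hn
  obtain ⟨g, η, -, -, h0, h1, h2⟩ := (equiv_iff x y).1 e
  have a1 := h2 h h
  simp (disch := omega) only [tHop_odd, Dop_even, cc_odd, sg_even, bb_eq_zero, bb_eq_one] at a1
  rw [show 2 * h - 1 + 1 - h = h by ring] at a1
  obtain ⟨c, hc⟩ := Int.even_mul_succ_self (g h h)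
  exact ⟨c + η h (h + 1) + η (h + 1) h + η h h, by linear_combination a1 + hc⟩

/-! ### Vanishing criteria -/

/-- Here ξ is -θ_s for s > 0 and 0 for s = 0. Since ξ₀ = 0, the twisted homotopy does not contribute
and φ₀ is unchanged. -/
theorem exists_equiv_high (x : SymStr univBundle n) : ∃ y : SymStr univBundle n, x.Equiv y ∧
    (∀ p q, p + q = n → y.cφ p q = x.cφ p q) ∧ (∀ p q, p + q ≤ n + 1 → y.cθ p q = x.cθ p q) ∧
    ∀ p q, n + 1 < p + q → y.cθ p q = 0 := by
  let g (p q : ℤ) : ℤ := if p + q ≤ n + 1 then 0 else -x.cθ p q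
  have g0 {p q : ℤ} (h : p + q ≤ n + 1) : g p q = 0 := if_pos h
  have g1 {p q : ℤ} (h : n + 1 < p + q) : g p q = -x.cθ p q := if_neg (by omega)
  have z : FinSupp (fun _ _ => (0 : ℤ)) := ⟨0, fun _ _ _ => rfl⟩
  have hg : FinSupp g := by
    obtain ⟨N, hN⟩ := x.isCoord.finΘ
    refine ⟨N, fun p q h => ?_⟩
    simp only [g, hN p q h, neg_zero, ite_self]
  obtain ⟨y, e, h1, h2⟩ := x.exists_move hg z fun p q h => g0 (by omega)
  have ht (p q : ℤ) : tHop n g x.cφ y.cφ p q = 0 := by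
    simp only [tHop, g0 (show n + 1 - p + p ≤ n + 1 by omega),
      g0 (show n + 1 - q + q ≤ n + 1 by omega), mul_zero, zero_mul, add_zero]
  have hD (p q : ℤ) : Dop (n + 1) (fun _ _ => (0 : ℤ)) p q = 0 := by
    simp only [Dop, mul_zero, add_zero]
  refine ⟨y, e, fun p q h => ?_, fun p q h => ?_, fun p q h => ?_⟩
  · simp (disch := omega) only [h1, Dop, g0, mul_zero, add_zero]
  · rw [h2, ht, hD, g0 h]
    ring
  · rw [h2, ht, hD, g1 h]
    ring

/-- Once θ = 0, the structure equation makes φ the twist of φ₀, which is zero. -/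
theorem equiv_zero_of_low (x : SymStr univBundle n) (hF : ∀ p q, p + q = n → x.cφ p q = 0)
    (hΘ : ∀ p q, p + q ≤ n + 1 → x.cθ p q = 0) : x.Equiv 0 := by
  obtain ⟨y, e, h1, h2, h3⟩ := x.exists_equiv_high
  have hθ (p q : ℤ) : y.cθ p q = 0 := by
    rcases le_or_gt (p + q) (n + 1) with h | h
    · rw [h2 p q h, hΘ p q h]
    · exact h3 p q h
  have hy : y = 0 := by
    refine ext_coord (fun p q => ?_) fun p q => hθ p q
    have h := y.isCoord.eq p q
    simp only [Tw, Dop, hθ, h1 _ _ (show n - p + p = n by ring),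
      hF _ _ (show n - p + p = n by ring),
      zero_mul, mul_zero, add_zero, sub_zero] at h
    exact h
  rwa [hy] at e

/-- The differential from degree 2 to degree 1 is 0, so in the structure equation the first two rows
and columns of φ depend only on those of θ and on φ₀ there. -/
theorem exists_equiv_two_le (x : SymStr univBundle n)
    (hF : ∀ p q, p ≤ 1 ∨ q ≤ 1 → p + q = n → x.cφ p q = 0)
    (hΘ : ∀ p q, p ≤ 1 ∨ q ≤ 1 → p + q ≤ n + 1 → x.cθ p q = 0) :
    ∃ y : SymStr univBundle n, x.Equiv y ∧ (∀ p q, p + q = n → y.cφ p q = x.cφ p q) ∧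
      (∀ p q, p + q ≤ n + 1 → y.cθ p q = x.cθ p q) ∧
      (∀ p q, p ≤ 1 ∨ q ≤ 1 → y.cφ p q = 0) ∧ ∀ p q, p ≤ 1 ∨ q ≤ 1 → y.cθ p q = 0 := by
  obtain ⟨y, e, h1, h2, h3⟩ := x.exists_equiv_high
  have hθ (p q : ℤ) (hp : p ≤ 1 ∨ q ≤ 1) : y.cθ p q = 0 := by
    rcases le_or_gt (p + q) (n + 1) with h | h
    · rw [h2 p q h, hΘ p q hp h]
    · exact h3 p q h
  refine ⟨y, e, h1, h2, fun p q hp => ?_, hθ⟩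
  have h := y.isCoord.eq p q
  have k1 : y.cφ (n - p) p * y.cφ (n - q) q = 0 := by
    rw [h1 _ _ (show n - p + p = n by ring), h1 _ _ (show n - q + q = n by ring)]
    rcases hp with hp | hp
    · rw [hF (n - p) p (Or.inr hp) (by ring), zero_mul]
    · rw [hF (n - q) q (Or.inr hp) (by ring), mul_zero]
  have k2 : cc (q + 1) * y.cθ p (q + 1) = 0 := by
    by_cases hq : q = 1
    · rw [hq, cc_even (by norm_num), zero_mul]
    · rw [hθ p (q + 1) (by omega), mul_zero]
  have k3 : cc (p + 1) * y.cθ (p + 1) q = 0 := by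
    by_cases hq : p = 1
    · rw [hq, cc_even (by norm_num), zero_mul]
    · rw [hθ (p + 1) q (by omega), mul_zero]
  rw [Tw, Dop, k1, k2, k3, hθ p q hp, hθ q p hp.symm] at h
  simpa using h

/-- An entry of θ below the diagonal is cancelled by the transposed term of an η supported strictly
above the diagonal. The neighbours (p, q+1) and (p+1, q) that also enter lie on or below the
diagonal, where η is zero. -/
theorem exists_equiv_triangular (x : SymStr univBundle n) : ∃ y : SymStr univBundle n,
    x.Equiv y ∧ ∀ p q, q < p → y.cθ p q = 0 := by
  let η (q p : ℤ) : ℤ :=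
    if q < p then -(sg (p + q) * sg (p + q - (n + 1) + p * q) * x.cθ p q) else 0
  have η0 {q p : ℤ} (h : p ≤ q) : η q p = 0 := if_neg (by omega)
  have η1 {q p : ℤ} (h : q < p) :
      η q p = -(sg (p + q) * sg (p + q - (n + 1) + p * q) * x.cθ p q) := if_pos h
  have z : FinSupp (fun _ _ => (0 : ℤ)) := ⟨0, fun _ _ _ => rfl⟩
  have hη : FinSupp η := by
    obtain ⟨N, hN⟩ := x.isCoord.finΘ
    refine ⟨N, fun q p h => ?_⟩
    simp only [η, hN p q (by omega), mul_zero, neg_zero, ite_self]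
  obtain ⟨y, e, -, h2⟩ := x.exists_move z hη fun _ _ _ => rfl
  refine ⟨y, e, fun p q h => ?_⟩
  have hs (k : ℤ) : sg k * sg k = 1 := by
    unfold sg
    split_ifs <;> rfl
  have ht : tHop n (fun _ _ => (0 : ℤ)) x.cφ y.cφ p q = 0 := by
    simp only [tHop, mul_zero, zero_mul, add_zero]
  rw [h2, ht, Dop, η0 (q := p) (p := q + 1) (by omega), η0 (q := p + 1) (p := q) (by omega),
    η0 (q := p) (p := q) (by omega), η1 h]
  linear_combination -x.cθ p q * (sg (p + q - (n + 1) + p * q) * sg (p + q - (n + 1) + p * q)) *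
    hs (p + q) - x.cθ p q * hs (p + q - (n + 1) + p * q)

end SymStr

/-! ### Reduction of symmetric structures on the universal bundle -/

/-- Supplies the matrices ξ and η of the moves below. Values are stated up to provable equality of
indices, again for `omega`; positions that are not needed get the value 0. -/
theorem exists_four_points {p₁ q₁ p₂ q₂ p₃ q₃ p₄ q₄ : ℤ} (h₁ : 0 ≤ p₁ ∧ 0 ≤ q₁)
    (h₂ : 0 ≤ p₂ ∧ 0 ≤ q₂) (h₃ : 0 ≤ p₃ ∧ 0 ≤ q₃) (h₄ : 0 ≤ p₄ ∧ 0 ≤ q₄)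
    (h₁₂ : ¬(p₂ = p₁ ∧ q₂ = q₁)) (h₁₃ : ¬(p₃ = p₁ ∧ q₃ = q₁)) (h₁₄ : ¬(p₄ = p₁ ∧ q₄ = q₁))
    (h₂₃ : ¬(p₃ = p₂ ∧ q₃ = q₂)) (h₂₄ : ¬(p₄ = p₂ ∧ q₄ = q₂)) (h₃₄ : ¬(p₄ = p₃ ∧ q₄ = q₃))
    (c₁ c₂ c₃ c₄ : ℤ) : ∃ g : ℤ → ℤ → ℤ, FinSupp g ∧
      (∀ p q, p = p₁ → q = q₁ → g p q = c₁) ∧ (∀ p q, p = p₂ → q = q₂ → g p q = c₂) ∧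
      (∀ p q, p = p₃ → q = q₃ → g p q = c₃) ∧ (∀ p q, p = p₄ → q = q₄ → g p q = c₄) ∧
      ∀ p q, ¬(p = p₁ ∧ q = q₁) → ¬(p = p₂ ∧ q = q₂) → ¬(p = p₃ ∧ q = q₃) →
        ¬(p = p₄ ∧ q = q₄) → g p q = 0 := by
  refine ⟨fun p q => if p = p₁ ∧ q = q₁ then c₁ else if p = p₂ ∧ q = q₂ then c₂ else
    if p = p₃ ∧ q = q₃ then c₃ else if p = p₄ ∧ q = q₄ then c₄ else 0,
    ⟨p₁ + q₁ + p₂ + q₂ + p₃ + q₃ + p₄ + q₄, fun p q h => ?_⟩, ?_, ?_, ?_, ?_, ?_⟩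
  · dsimp only
    rw [if_neg (by omega), if_neg (by omega), if_neg (by omega), if_neg (by omega)]
  · rintro p q rfl rfl
    exact if_pos ⟨rfl, rfl⟩
  · rintro p q rfl rfl
    dsimp only
    rw [if_neg h₁₂, if_pos ⟨rfl, rfl⟩]
  · rintro p q rfl rfl
    dsimp only
    rw [if_neg h₁₃, if_neg h₂₃, if_pos ⟨rfl, rfl⟩]
  · rintro p q rfl rfl
    dsimp only
    rw [if_neg h₁₄, if_neg h₂₄, if_neg h₃₄, if_pos ⟨rfl, rfl⟩]
  · intro p q k₁ k₂ k₃ k₄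
    dsimp only
    rw [if_neg k₁, if_neg k₂, if_neg k₃, if_neg k₄]

/-- The coordinates in the first two rows and columns, for even `n ≥ 2`. -/
theorem IsCoord.corner_even {n : ℤ} (hn : n % 2 = 0) (h2 : 2 ≤ n) {F T : ℤ → ℤ → ℤ}
    (h : IsCoord n F T) (t : ∀ p q, q < p → T p q = 0) :
    ∃ s f : ℤ, F n 0 = -2 * s ∧ F (n - 1) 1 = 0 ∧ F 1 (n - 1) = 0 ∧
      F 0 n = 2 * T 0 (n + 1) + 2 * T 1 n - 2 * s ∧ T 0 0 = 2 * f - 2 * s ^ 2 ∧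
      T 0 1 = -2 * f ∧ T 1 1 = f ∧ T 0 n = -2 * s ∧ (∀ q, 2 ≤ q → q < n → T 0 q = 0) ∧
      ∀ q, 2 ≤ q → q < n → T 1 q = 0 := by
  have low := h.low
  have c1 := h.cycle (n - 1) 0
  have c2 := h.cycle 0 (n - 1)
  simp (disch := omega) only [Dop_even, Dop_odd, cc_even, cc_odd, sg_even, sg_odd, low,
    zero_add, sub_add_cancel] at c1 c2
  have F1 : F (n - 1) 1 = 0 := by linarith
  have F2 : F 1 (n - 1) = 0 := by linarith
  have e1 := h.eq n 0
  have e3 := h.eq 1 0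
  have e4 := h.eq 0 0
  have e6 := h.eq 0 n
  simp (disch := omega) only [Tw_even, Dop_even, Dop_odd, cc_odd, sg_even, low, bb_eq_zero,
    bb_eq_one, t, zero_add, sub_zero] at e1 e3 e4 e6
  -- The structure equations at (0, 0), where the square is the twist, and at (1, 0), which gives T
  -- 0 1 = -2 T 1 1. They force F n 0 to be even and leave s and f as parameters.
  have hy : F n 0 * F n 0 = 4 * T 1 1 - 2 * T 0 0 := by linarith
  have he : Even (F n 0) := by
    have : Even (F n 0 * F n 0) := ⟨2 * T 1 1 - T 0 0, by linarith⟩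
    simpa using Int.even_mul.1 this
  obtain ⟨r, hr⟩ := he
  rw [hr] at hy
  refine ⟨-r, T 1 1, by linarith, F1, F2, by linarith, by linarith, by linarith, rfl, by linarith,
    fun q hq hq' => ?_, fun q hq hq' => ?_⟩
  · have e := h.eq q 0
    rcases Int.emod_two_eq_zero_or_one q with p | p <;>
      simp (disch := omega) only [Tw_even, Dop_even, Dop_odd, cc_odd, sg_even, low, bb_eq_zero,
        t] at e <;> linarith
  · have e := h.eq q 1
    have F3 : F q 1 = 0 := by
      rcases eq_or_ne q (n - 1) with rfl | k
      · exact F1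
      · exact low q 1 (by omega)
    rcases Int.emod_two_eq_zero_or_one q with p | p <;>
      simp (disch := omega) only [Tw_even, Dop_even, Dop_odd, cc_even, sg_even, sg_odd, F1, F3,
        t] at e <;> linarith

-- The left side is the θ of the moved structure as given by `exists_move`. Typical is position (1,
-- 1): the square of g n 1 = f enters and f - f² + 2u = 0, so evenness of f(f - 1) removes any
-- obstruction.
set_option linter.unusedSimpArgs false in
theorem corner_even_eq_zero {n : ℤ} (hn : n % 2 = 0) (h2 : 2 ≤ n) {F T g η Y : ℤ → ℤ → ℤ}
    (t : ∀ p q, q < p → T p q = 0) {s f u : ℤ} (k1 : F n 0 = -2 * s) (k2 : F (n - 1) 1 = 0)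
    (k5 : T 0 0 = 2 * f - 2 * s ^ 2) (k6 : T 0 1 = -2 * f) (k7 : T 1 1 = f)
    (k8 : T 0 n = -2 * s) (k9 : ∀ q, 2 ≤ q → q < n → T 0 q = 0)
    (k10 : ∀ q, 2 ≤ q → q < n → T 1 q = 0) (hu : f * (f - 1) = u + u)
    (g1 : ∀ p q, p = n → q = 1 → g p q = f) (g2 : ∀ p q, p = n + 1 → q = 0 → g p q = s - f)
    (g3 : ∀ p q, p = 0 → q = n + 1 → g p q = s - f - T 0 (n + 1))
    (g4 : ∀ p q, p = 1 → q = n → g p q = f - T 1 n)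
    (g0 : ∀ p q, ¬(p = n ∧ q = 1) → ¬(p = n + 1 ∧ q = 0) → ¬(p = 0 ∧ q = n + 1) →
      ¬(p = 1 ∧ q = n) → g p q = 0)
    (η1 : ∀ p q, p = 1 → q = n → η p q = f) (η2 : ∀ p q, p = 0 → q = n + 1 → η p q = s - f)
    (η3 : ∀ p q, p = 1 → q = 1 → η p q = u)
    (η4 : ∀ p q, p = 0 → q = 1 → η p q = f * (s - f) + 2 * u)
    (η0 : ∀ p q, ¬(p = 1 ∧ q = n) → ¬(p = 0 ∧ q = n + 1) → ¬(p = 1 ∧ q = 1) →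
      ¬(p = 0 ∧ q = 1) → η p q = 0)
    (hY : ∀ p q, p ≤ 1 ∨ q ≤ 1 → p + q = n → Y p q = 0) {p q : ℤ} (hp : 0 ≤ p) (hq : 0 ≤ q)
    (h : p ≤ 1 ∨ q ≤ 1) (hpq : p + q ≤ n + 1) :
    T p q + g p q - tHop n g F Y p q + Dop (n + 1) η p q = 0 := by
  rw [tHop_even hn]
  obtain rfl | rfl | hp2 : p = 0 ∨ p = 1 ∨ 2 ≤ p := by omega
  · obtain rfl | rfl | hq2 | rfl | rfl : q = 0 ∨ q = 1 ∨ (2 ≤ q ∧ q < n) ∨ q = n ∨ q = n + 1 := by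
      omega
    all_goals clear h
    all_goals simp (disch := omega) only [Dop_even, Dop_odd, cc_even, cc_odd, sg_even, sg_odd,
      bb_eq_zero, bb_eq_one, g1, g2, g3, g4, g0, η1, η2, η3, η4, η0, hY, t, k1, k2, k5, k6, k7, k8,
      k9, k10, zero_mul, mul_zero, add_zero, zero_add, sub_zero, one_mul, sub_self,
      add_sub_cancel_right]
    all_goals first
      | linear_combination (0 : ℤ) * hu
      | linear_combination (-2 : ℤ) * hu
      | linear_combination (2 : ℤ) * hu
  · obtain rfl | rfl | hq2 | hq2 | rfl : q = 0 ∨ q = 1 ∨ (2 ≤ q ∧ q < n - 1) ∨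
        (2 ≤ q ∧ q = n - 1) ∨ q = n := by omega
    all_goals clear h
    all_goals simp (disch := omega) only [Dop_even, Dop_odd, cc_even, cc_odd, sg_even, sg_odd,
      bb_eq_zero, bb_eq_one, g1, g2, g3, g4, g0, η1, η2, η3, η4, η0, hY, t, k1, k2, k5, k6, k7, k8,
      k9, k10, zero_mul, mul_zero, add_zero, zero_add, sub_zero, one_mul, sub_self,
      add_sub_cancel_right]
    all_goals first
      | linear_combination (0 : ℤ) * hu
      | linear_combination (-1 : ℤ) * hu
  · obtain ⟨rfl, hp3⟩ | ⟨rfl, rfl⟩ | ⟨rfl, rfl⟩ | ⟨rfl, hp3⟩ | ⟨rfl, rfl⟩ :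
        (q = 0 ∧ p < n) ∨ (q = 0 ∧ p = n) ∨ (q = 0 ∧ p = n + 1) ∨ (q = 1 ∧ p < n) ∨
          (q = 1 ∧ p = n) := by omega
    all_goals clear h
    · rcases Int.emod_two_eq_zero_or_one p with pp | pp <;>
        simp (disch := omega) only [Dop_even, Dop_odd, cc_even, cc_odd, sg_even, sg_odd,
          bb_eq_zero, bb_eq_one, g1, g2, g3, g4, g0, η1, η2, η3, η4, η0, hY, t, k1, k2, k5, k6, k7,
          k8, k9, k10, zero_mul, mul_zero, add_zero, zero_add, sub_zero, one_mul, sub_self,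
          add_sub_cancel_right]
    · simp (disch := omega) only [Dop_even, Dop_odd, cc_even, cc_odd, sg_even, sg_odd,
        bb_eq_zero, bb_eq_one, g1, g2, g3, g4, g0, η1, η2, η3, η4, η0, hY, t, k1, k2, k5, k6, k7,
            k8,
        k9, k10, zero_mul, mul_zero, add_zero, zero_add, sub_zero, one_mul, sub_self,
        add_sub_cancel_right]
    · simp (disch := omega) only [Dop_even, Dop_odd, cc_even, cc_odd, sg_even, sg_odd,
        bb_eq_zero, bb_eq_one, g1, g2, g3, g4, g0, η1, η2, η3, η4, η0, hY, t, k1, k2, k5, k6, k7,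
            k8,
        k9, k10, zero_mul, mul_zero, add_zero, zero_add, sub_zero, one_mul, sub_self,
        add_sub_cancel_right]
      ring
    · rcases Int.emod_two_eq_zero_or_one p with pp | pp <;>
        simp (disch := omega) only [Dop_even, Dop_odd, cc_even, cc_odd, sg_even, sg_odd,
          bb_eq_zero, bb_eq_one, g1, g2, g3, g4, g0, η1, η2, η3, η4, η0, hY, t, k1, k2, k5, k6, k7,
          k8, k9, k10, zero_mul, mul_zero, add_zero, zero_add, sub_zero, one_mul, sub_self,
          add_sub_cancel_right]
    · simp (disch := omega) only [Dop_even, Dop_odd, cc_even, cc_odd, sg_even, sg_odd,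
        bb_eq_zero, bb_eq_one, g1, g2, g3, g4, g0, η1, η2, η3, η4, η0, hY, t, k1, k2, k5, k6, k7,
            k8,
        k9, k10, zero_mul, mul_zero, add_zero, zero_add, sub_zero, one_mul, sub_self,
        add_sub_cancel_right]
      ring

theorem SymStr.reduce_even {n : ℤ} (hn : n % 2 = 0) (h2 : 2 ≤ n) (x : SymStr univBundle n) :
    ∃ y : SymStr univBundle n, x.Equiv y ∧ (∀ p q, p ≤ 1 ∨ q ≤ 1 → y.cφ p q = 0) ∧
      ∀ p q, p ≤ 1 ∨ q ≤ 1 → y.cθ p q = 0 := by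
  obtain ⟨x', e', t⟩ := x.exists_equiv_triangular
  obtain ⟨s, f, k1, k2, k3, k4, k5, k6, k7, k8, k9, k10⟩ := x'.isCoord.corner_even hn h2 t
  obtain ⟨u, hu⟩ := Int.even_mul_pred_self f
  -- The entries f at (n, 1) and s - f at (n+1, 0) contribute 2f + 2(s - f), which cancels φ(n,0) =
  -- -2s; the share f is dictated by θ(1,1) = f. The other two entries cancel φ(0,n) and leave s - f
  -- and f in θ.
  obtain ⟨g, hg, g1, g2, g3, g4, g0⟩ := exists_four_points (p₁ := n) (q₁ := 1) (p₂ := n + 1)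
    (q₂ := 0) (p₃ := 0) (q₃ := n + 1) (p₄ := 1) (q₄ := n) (by omega) (by omega) (by omega)
    (by omega) (by omega) (by omega) (by omega) (by omega) (by omega) (by omega) f (s - f)
    (s - f - x'.cθ 0 (n + 1)) (f - x'.cθ 1 n)
  -- The first two entries remove what ξ leaves in θ at (1, n), (0, n+1) and their transposes. The
  -- last two absorb the products in the twisted homotopy at (1, 1) and (0, 1).
  obtain ⟨η, hη, η1, η2, η3, η4, η0⟩ := exists_four_points (p₁ := 1) (q₁ := n) (p₂ := 0)
    (q₂ := n + 1) (p₃ := 1) (q₃ := 1) (p₄ := 0) (q₄ := 1) (by omega) (by omega) (by omega)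
    (by omega) (by omega) (by omega) (by omega) (by omega) (by omega) (by omega) f (s - f)
    u (f * (s - f) + 2 * u)
  obtain ⟨y, e, m1, m2⟩ := x'.exists_move hg hη fun p q h =>
    g0 p q (by omega) (by omega) (by omega) (by omega)
  have hY (p q : ℤ) (h : p ≤ 1 ∨ q ≤ 1) (hpq : p + q = n) : y.cφ p q = 0 := by
    by_cases hp : p < 0
    · exact y.cφ_left hp q
    by_cases hq : q < 0
    · exact y.cφ_right p hq
    have : (p = n ∧ q = 0) ∨ (p = n - 1 ∧ q = 1) ∨ (p = 0 ∧ q = n) ∨ (p = 1 ∧ q = n - 1) := by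
      omega
    rw [m1]
    clear m1 m2 k9 k10 hu hη hg h hpq
    rcases this with ⟨rfl, rfl⟩ | ⟨rfl, rfl⟩ | ⟨rfl, rfl⟩ | ⟨rfl, rfl⟩ <;>
      simp (disch := omega) only [Dop_even, Dop_odd, cc_even, cc_odd, sg_even, sg_odd, g1, g2, g3,
        g4, g0, k1, k2, k3, k4] <;> ring
  have hΘ (p q : ℤ) (h : p ≤ 1 ∨ q ≤ 1) (hpq : p + q ≤ n + 1) : y.cθ p q = 0 := by
    by_cases hp : p < 0
    · exact y.cθ_left hp q
    by_cases hq : q < 0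
    · exact y.cθ_right p hq
    rw [m2]
    exact corner_even_eq_zero hn h2 t k1 k2 k5 k6 k7 k8 k9 k10 hu g1 g2 g3 g4 g0 η1 η2 η3 η4 η0 hY
      (by omega) (by omega) h hpq
  obtain ⟨z, ez, -, -, z1, z2⟩ := y.exists_equiv_two_le hY hΘ
  exact ⟨z, (e'.trans e).trans ez, z1, z2⟩

/-- The coordinates in the first two rows and columns, for odd `n ≥ 3`. -/
theorem IsCoord.corner_odd {n : ℤ} (hn : n % 2 = 1) (h3 : 3 ≤ n) {F T : ℤ → ℤ → ℤ}
    (h : IsCoord n F T) (t : ∀ p q, q < p → T p q = 0) :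
    ∃ w : ℤ, F n 0 = -2 * w ∧ F (n - 1) 1 = 2 * w ∧ F 1 (n - 1) = 2 * T 1 n + 2 * w ∧
      F 0 n = -2 * T 1 n - 2 * w ∧ T 1 (n - 1) = -2 * w ∧ T 0 1 = 0 ∧ T 1 1 = -2 * w ^ 2 ∧
      T 0 n = 2 * w ∧ (∀ q, 2 ≤ q → q < n → T 0 q = 0) ∧
      ∀ q, 2 ≤ q → q < n - 1 → T 1 q = 0 := by
  have low := h.low
  have c1 := h.cycle (n - 1) 0
  have c2 := h.cycle 0 (n - 1)
  have e1 := h.eq n 0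
  have e2 := h.eq (n - 1) 1
  have e3 := h.eq 1 0
  have e4 := h.eq 0 0
  have e6 := h.eq 0 n
  simp (disch := omega) only [Tw_odd, Dop_even, Dop_odd, cc_even, cc_odd, sg_even, sg_odd, low,
    bb_eq_zero, bb_eq_one, t, zero_add, sub_zero, sub_add_cancel] at c1 c2 e1 e2 e3 e4 e6
  have F0 : F n 0 = -F (n - 1) 1 := by linarith
  have T01 : T 0 1 = 0 := by linarith
  rw [F0, T01] at e3
  -- The twist at (1, 0) is the product of F (n-1) 1 and F n 0, which are opposite, so a square
  -- appears again and must be even.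
  have hy : F (n - 1) 1 * F (n - 1) 1 = -2 * T 1 1 := by linarith
  have he : Even (F (n - 1) 1) := by
    have : Even (F (n - 1) 1 * F (n - 1) 1) := ⟨-T 1 1, by linarith⟩
    simpa using Int.even_mul.1 this
  obtain ⟨w, hw⟩ := he
  rw [hw] at hy
  refine ⟨w, by linarith, by linarith, by linarith, by linarith, by linarith, T01, by linarith,
    by linarith, fun q hq hq' => ?_, fun q hq hq' => ?_⟩
  · have e := h.eq q 0
    rcases Int.emod_two_eq_zero_or_one q with p | p <;>
      simp (disch := omega) only [Tw_odd, Dop_even, Dop_odd, cc_odd, sg_even, sg_odd, low,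
        bb_eq_zero, t] at e <;> linarith
  · have e := h.eq q 1
    rcases Int.emod_two_eq_zero_or_one q with p | p <;>
      simp (disch := omega) only [Tw_odd, Dop_even, Dop_odd, cc_even, sg_even, sg_odd, low,
        bb_eq_zero, t] at e <;> linarith

-- At (0, 0) the square of g (n+1) 0 = T 0 0 turns T 0 0 into T 0 0 + T 0 0 ^ 2 = 2u, which η
-- cancels. For n ≥ 3 the position (n+1, 0) is not (0, 0), so the square comes without its linear
-- term and an odd T 0 0 is no obstruction, unlike for n = -1.
set_option linter.unusedSimpArgs false in
theorem corner_odd_eq_zero {n : ℤ} (hn : n % 2 = 1) (h3 : 3 ≤ n) {F T g η Y : ℤ → ℤ → ℤ}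
    (t : ∀ p q, q < p → T p q = 0) {w u : ℤ} (k1 : F n 0 = -2 * w) (k2 : F (n - 1) 1 = 2 * w)
    (k5 : ∀ q, q = n - 1 → T 1 q = -2 * w) (k6 : T 0 1 = 0) (k7 : T 1 1 = -2 * w ^ 2)
    (k8 : T 0 n = 2 * w) (k9 : ∀ q, 2 ≤ q → q < n → T 0 q = 0)
    (k10 : ∀ q, 2 ≤ q → q < n - 1 → T 1 q = 0) (hu : T 0 0 * (T 0 0 + 1) = u + u)
    (g1 : ∀ p q, p = n → q = 1 → g p q = w) (g2 : ∀ p q, p = n + 1 → q = 0 → g p q = T 0 0)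
    (g3 : ∀ p q, p = 0 → q = n + 1 → g p q = T 0 0 - T 0 (n + 1))
    (g4 : ∀ p q, p = 1 → q = n → g p q = -T 1 n - w)
    (g0 : ∀ p q, ¬(p = n ∧ q = 1) → ¬(p = n + 1 ∧ q = 0) → ¬(p = 0 ∧ q = n + 1) →
      ¬(p = 1 ∧ q = n) → g p q = 0)
    (η1 : ∀ p q, p = 1 → q = n → η p q = w) (η2 : ∀ p q, p = 0 → q = n + 1 → η p q = -T 0 0)
    (η3 : ∀ p q, p = 0 → q = 0 → η p q = -u) (η4 : ∀ p q, p = 0 → q = 1 → η p q = 0)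
    (η0 : ∀ p q, ¬(p = 1 ∧ q = n) → ¬(p = 0 ∧ q = n + 1) → ¬(p = 0 ∧ q = 0) →
      ¬(p = 0 ∧ q = 1) → η p q = 0)
    (hY : ∀ p q, p ≤ 1 ∨ q ≤ 1 → p + q = n → Y p q = 0) {p q : ℤ} (hp : 0 ≤ p) (hq : 0 ≤ q)
    (h : p ≤ 1 ∨ q ≤ 1) (hpq : p + q ≤ n + 1) :
    T p q + g p q - tHop n g F Y p q + Dop (n + 1) η p q = 0 := by
  rw [tHop_odd hn]
  obtain rfl | rfl | hp2 : p = 0 ∨ p = 1 ∨ 2 ≤ p := by omega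
  · obtain rfl | rfl | hq2 | rfl | rfl : q = 0 ∨ q = 1 ∨ (2 ≤ q ∧ q < n) ∨ q = n ∨ q = n + 1 := by
      omega
    all_goals clear h
    all_goals simp (disch := omega) only [Dop_even, Dop_odd, cc_even, cc_odd, sg_even, sg_odd,
      bb_eq_zero, bb_eq_one, g1, g2, g3, g4, g0, η1, η2, η3, η4, η0, hY, t, k1, k2, k5, k6, k7, k8,
      k9, k10, zero_mul, mul_zero, add_zero, zero_add, sub_zero, one_mul, sub_self,
      add_sub_cancel_right]
    all_goals first
      | linear_combination (0 : ℤ) * hu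
      | linear_combination (1 : ℤ) * hu
  · obtain rfl | rfl | hq2 | hq2 | rfl : q = 0 ∨ q = 1 ∨ (2 ≤ q ∧ q < n - 1) ∨
        (2 ≤ q ∧ q = n - 1) ∨ q = n := by omega
    all_goals clear h
    all_goals simp (disch := omega) only [Dop_even, Dop_odd, cc_even, cc_odd, sg_even, sg_odd,
      bb_eq_zero, bb_eq_one, g1, g2, g3, g4, g0, η1, η2, η3, η4, η0, hY, t, k1, k2, k5, k6, k7, k8,
      k9, k10, zero_mul, mul_zero, add_zero, zero_add, sub_zero, one_mul, sub_self,
      add_sub_cancel_right]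
    all_goals ring
  · obtain ⟨rfl, hp3⟩ | ⟨rfl, rfl⟩ | ⟨rfl, rfl⟩ | ⟨rfl, hp3⟩ | ⟨rfl, rfl⟩ :
        (q = 0 ∧ p < n) ∨ (q = 0 ∧ p = n) ∨ (q = 0 ∧ p = n + 1) ∨ (q = 1 ∧ p < n) ∨
          (q = 1 ∧ p = n) := by omega
    all_goals clear h
    · rcases Int.emod_two_eq_zero_or_one p with pp | pp <;>
        simp (disch := omega) only [Dop_even, Dop_odd, cc_even, cc_odd, sg_even, sg_odd,
          bb_eq_zero, bb_eq_one, g1, g2, g3, g4, g0, η1, η2, η3, η4, η0, hY, t, k1, k2, k5, k6, k7,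
          k8, k9, k10, zero_mul, mul_zero, add_zero, zero_add, sub_zero, one_mul, sub_self,
          add_sub_cancel_right]
    · simp (disch := omega) only [Dop_even, Dop_odd, cc_even, cc_odd, sg_even, sg_odd,
        bb_eq_zero, bb_eq_one, g1, g2, g3, g4, g0, η1, η2, η3, η4, η0, hY, t, k1, k2, k5, k6, k7,
            k8,
        k9, k10, zero_mul, mul_zero, add_zero, zero_add, sub_zero, one_mul, sub_self,
        add_sub_cancel_right]
    · simp (disch := omega) only [Dop_even, Dop_odd, cc_even, cc_odd, sg_even, sg_odd,
        bb_eq_zero, bb_eq_one, g1, g2, g3, g4, g0, η1, η2, η3, η4, η0, hY, t, k1, k2, k5, k6, k7,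
            k8,
        k9, k10, zero_mul, mul_zero, add_zero, zero_add, sub_zero, one_mul, sub_self,
        add_sub_cancel_right]
      ring
    · rcases Int.emod_two_eq_zero_or_one p with pp | pp <;>
        simp (disch := omega) only [Dop_even, Dop_odd, cc_even, cc_odd, sg_even, sg_odd,
          bb_eq_zero, bb_eq_one, g1, g2, g3, g4, g0, η1, η2, η3, η4, η0, hY, t, k1, k2, k5, k6, k7,
          k8, k9, k10, zero_mul, mul_zero, add_zero, zero_add, sub_zero, one_mul, sub_self,
          add_sub_cancel_right]
    · simp (disch := omega) only [Dop_even, Dop_odd, cc_even, cc_odd, sg_even, sg_odd,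
        bb_eq_zero, bb_eq_one, g1, g2, g3, g4, g0, η1, η2, η3, η4, η0, hY, t, k1, k2, k5, k6, k7,
            k8,
        k9, k10, zero_mul, mul_zero, add_zero, zero_add, sub_zero, one_mul, sub_self,
        add_sub_cancel_right]
      ring

theorem SymStr.reduce_odd {n : ℤ} (hn : n % 2 = 1) (h3 : 3 ≤ n) (x : SymStr univBundle n) :
    ∃ y : SymStr univBundle n, x.Equiv y ∧ (∀ p q, p ≤ 1 ∨ q ≤ 1 → y.cφ p q = 0) ∧
      ∀ p q, p ≤ 1 ∨ q ≤ 1 → y.cθ p q = 0 := by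
  obtain ⟨x', e', t⟩ := x.exists_equiv_triangular
  obtain ⟨w, k1, k2, k3, k4, k5, k6, k7, k8, k9, k10⟩ := x'.isCoord.corner_odd hn h3 t
  obtain ⟨u, hu⟩ := Int.even_mul_succ_self (x'.cθ 0 0)
  -- The entry w at (n, 1) cancels both φ(n,0) = -2w and φ(n-1,1) = 2w, and the one at (1, n)
  -- cancels φ(0,n) and φ(1,n-1). The entries at (n+1, 0) and (0, n+1) do not affect φ₀ and serve to
  -- clear θ(0,0) and θ(0,n+1).
  obtain ⟨g, hg, g1, g2, g3, g4, g0⟩ := exists_four_points (p₁ := n) (q₁ := 1) (p₂ := n + 1)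
    (q₂ := 0) (p₃ := 0) (q₃ := n + 1) (p₄ := 1) (q₄ := n) (by omega) (by omega) (by omega)
    (by omega) (by omega) (by omega) (by omega) (by omega) (by omega) (by omega) w (x'.cθ 0 0)
    (x'.cθ 0 0 - x'.cθ 0 (n + 1)) (-x'.cθ 1 n - w)
  obtain ⟨η, hη, η1, η2, η3, η4, η0⟩ := exists_four_points (p₁ := 1) (q₁ := n) (p₂ := 0)
    (q₂ := n + 1) (p₃ := 0) (q₃ := 0) (p₄ := 0) (q₄ := 1) (by omega) (by omega) (by omega)
    (by omega) (by omega) (by omega) (by omega) (by omega) (by omega) (by omega) w (-x'.cθ 0 0)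
    (-u) 0
  obtain ⟨y, e, m1, m2⟩ := x'.exists_move hg hη fun p q h =>
    g0 p q (by omega) (by omega) (by omega) (by omega)
  have hY (p q : ℤ) (h : p ≤ 1 ∨ q ≤ 1) (hpq : p + q = n) : y.cφ p q = 0 := by
    by_cases hp : p < 0
    · exact y.cφ_left hp q
    by_cases hq : q < 0
    · exact y.cφ_right p hq
    have : (p = n ∧ q = 0) ∨ (p = n - 1 ∧ q = 1) ∨ (p = 0 ∧ q = n) ∨ (p = 1 ∧ q = n - 1) := by
      omega
    rw [m1]
    clear m1 m2 k9 k10 hu hη hg h hpq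
    rcases this with ⟨rfl, rfl⟩ | ⟨rfl, rfl⟩ | ⟨rfl, rfl⟩ | ⟨rfl, rfl⟩ <;>
      simp (disch := omega) only [Dop_even, Dop_odd, cc_even, cc_odd, sg_even, sg_odd, g1, g3, g4,
        g0, k1, k2, k3, k4] <;> ring
  have hΘ (p q : ℤ) (h : p ≤ 1 ∨ q ≤ 1) (hpq : p + q ≤ n + 1) : y.cθ p q = 0 := by
    by_cases hp : p < 0
    · exact y.cθ_left hp q
    by_cases hq : q < 0
    · exact y.cθ_right p hq
    rw [m2]
    exact corner_odd_eq_zero hn h3 t k1 k2 (fun q e => e ▸ k5) k6 k7 k8 k9 k10 hu g1 g2 g3 g4 g0 η1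
        η2 η3 η4 η0 hY
      (by omega) (by omega) h hpq
  obtain ⟨z, ez, -, -, z1, z2⟩ := y.exists_equiv_two_le hY hΘ
  exact ⟨z, (e'.trans e).trans ez, z1, z2⟩

/-! ### Double suspension -/

/-- The coefficients of the differential depend only on parities, and for m - 4 the sign exponents
change by even numbers. The drop by 4 is what the twist needs: n - p then drops by 2 as well, and
`bb` is invariant when both indices move by 2. -/
theorem Dop_shift (m : ℤ) (u : ℤ → ℤ → ℤ) (p q : ℤ) :
    Dop (m - 4) (fun p q => u (p + 2) (q + 2)) p q = Dop m u (p + 2) (q + 2) := by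
  have hc (k : ℤ) : cc (k + 2 + 1) = cc (k + 1) := by
    unfold cc
    split_ifs <;> omega
  rw [Dop, Dop, hc, hc, sg_congr (a := q + 2) (b := q) (by omega),
    sg_congr (a := p + 2 + (q + 2)) (b := p + q) (by omega),
    sg_congr (a := p + 2 + (q + 2) - m + (p + 2) * (q + 2)) (b := p + q - (m - 4) + p * q)]
  · rw [add_right_comm p 1 2, add_right_comm q 1 2]
  · rw [show p + 2 + (q + 2) - m + (p + 2) * (q + 2) - (p + q - (m - 4) + p * q) =
      2 * (p + q + 2) by ring, Int.mul_emod_right]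

theorem Tw_shift (n : ℤ) (F : ℤ → ℤ → ℤ) (p q : ℤ) :
    Tw (n - 4) (fun p q => F (p + 2) (q + 2)) p q = Tw n F (p + 2) (q + 2) := by
  rw [Tw, Tw, ← bb_add_two (n - 4 - p) (n - 4 - q), show n - 4 - p + 2 = n - (p + 2) by ring,
    show n - 4 - q + 2 = n - (q + 2) by ring,
    sg_congr (a := (n - 4) * (n - 4 - q)) (b := n * (n - (q + 2)))]
  rw [show (n - 4) * (n - 4 - q) - n * (n - (q + 2)) = 2 * (-(n - 4 - q) * 2 - n) by ring,
    Int.mul_emod_right]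

theorem tHop_shift (n : ℤ) (g x y : ℤ → ℤ → ℤ) (p q : ℤ) :
    tHop (n - 4) (fun p q => g (p + 2) (q + 2)) (fun p q => x (p + 2) (q + 2))
      (fun p q => y (p + 2) (q + 2)) p q = tHop n g x y (p + 2) (q + 2) := by
  have e (k : ℤ) : bb (n - 4 - p) k = bb (n - (p + 2)) (k + 2) := by
    rw [← bb_add_two]
    congr 1
    ring
  have e' (k : ℤ) : bb (n - 4 + 1 - p) k = bb (n + 1 - (p + 2)) (k + 2) := by
    rw [← bb_add_two]
    congr 1
    ring
  rcases Int.emod_two_eq_zero_or_one n with hn | hn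
  · rw [tHop_even (by omega), tHop_even hn, sg_congr (a := q + 2) (b := q) (by omega), e, e', e']
    rw [show n - 4 - p + 2 = n - (p + 2) by ring, show n - 4 - q + 2 = n - (q + 2) by ring,
      show n - 4 + 1 - p + 2 = n + 1 - (p + 2) by ring,
      show n - 4 + 1 - q + 2 = n + 1 - (q + 2) by ring]
  · rw [tHop_odd (by omega), tHop_odd hn, sg_congr (a := q + 2) (b := q) (by omega), e, e', e']
    rw [show n - 4 - p + 2 = n - (p + 2) by ring, show n - 4 - q + 2 = n - (q + 2) by ring,
      show n - 4 + 1 - p + 2 = n + 1 - (p + 2) by ring,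
      show n - 4 + 1 - q + 2 = n + 1 - (q + 2) by ring]

namespace SymStr

variable {n : ℤ}

/-- A structure which vanishes in the first two rows and columns is a double suspension. -/
theorem exists_desuspension (x : SymStr univBundle n)
    (hF : ∀ p q, p ≤ 1 ∨ q ≤ 1 → x.cφ p q = 0) (hΘ : ∀ p q, p ≤ 1 ∨ q ≤ 1 → x.cθ p q = 0) :
    ∃ z : SymStr univBundle (n - 4), (∀ p q, z.cφ p q = x.cφ (p + 2) (q + 2)) ∧
      (∀ p q, z.cθ p q = x.cθ (p + 2) (q + 2)) ∧ (z.Equiv 0 → x.Equiv 0) := by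
  have hs {u : ℤ → ℤ → ℤ} (hu : FinSupp u) (h0 : ∀ p q, p ≤ 1 ∨ q ≤ 1 → u p q = 0) :
      FinSupp fun p q => u (p + 2) (q + 2) := by
    obtain ⟨N, hN⟩ := hu
    refine ⟨N, fun p q h => ?_⟩
    by_cases k : p < 0 ∨ q < 0
    · exact h0 _ _ (by omega)
    · exact hN _ _ (by omega)
  have hc := x.isCoord
  have : IsCoord (n - 4) (fun p q => x.cφ (p + 2) (q + 2)) fun p q => x.cθ (p + 2) (q + 2) :=
    { finF := hs hc.finF hF
      finΘ := hs hc.finΘ hΘ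
      low := fun p q h => hc.low _ _ (by omega)
      cycle := fun p q => by
        rw [show n - 4 - 1 = n - 1 - 4 by ring, Dop_shift, hc.cycle]
      eq := fun p q => by rw [Tw_shift, Dop_shift, hc.eq] }
  obtain ⟨z, h1, h2⟩ := exists_of_isCoord this
  refine ⟨z, fun p q => by rw [h1], fun p q => by rw [h2], fun e => ?_⟩
  obtain ⟨g, η, hg, hη, g0, k1, k2⟩ := (equiv_iff z 0).1 e
  have hu {u : ℤ → ℤ → ℤ} (hu : FinSupp u) : FinSupp fun p q => u (p - 2) (q - 2) := by
    obtain ⟨N, hN⟩ := hu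
    exact ⟨N + 2, fun p q h => hN _ _ (by omega)⟩
  have hsub (u : ℤ → ℤ → ℤ) :
      (fun p q => (fun p q => u (p - 2) (q - 2)) (p + 2) (q + 2)) = u := by
    funext p q
    simp only [add_sub_cancel_right]
  have h0 : (fun p q => (0 : SymStr univBundle n).cφ (p + 2) (q + 2)) =
      (0 : SymStr univBundle (n - 4)).cφ := by
    funext p q
    rw [cφ_zero, cφ_zero]
  -- The null equivalence of z, moved back by (2, 2).
  refine (equiv_iff x 0).2 ⟨_, _, hu hg, hu hη, fun p q h => g0 _ _ (by omega), fun p q => ?_,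
    fun p q => ?_⟩
  · have d := Dop_shift n (fun p q => g (p - 2) (q - 2)) (p - 2) (q - 2)
    rw [hsub, ← k1, cφ_zero, h1] at d
    simp only [sub_add_cancel] at d
    rw [← d, cφ_zero]
  · have d := Dop_shift (n + 1) (fun p q => η (p - 2) (q - 2)) (p - 2) (q - 2)
    have d' := tHop_shift n (fun p q => g (p - 2) (q - 2)) x.cφ (0 : SymStr univBundle n).cφ
      (p - 2) (q - 2)
    rw [hsub, show n + 1 - 4 = n - 4 + 1 by ring, ← k2, cθ_zero, h2] at d
    rw [hsub, h0, ← h1] at d'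
    rw [d'] at d
    simp only [sub_add_cancel] at d
    rw [← d, cθ_zero]

/-! ### Vanishing of the invariants -/

/-- The invariants of a symmetric structure on `β(∞)` vanish. -/
def Vanishes (x : SymStr univBundle n) : Prop := ∀ h : ℤ, h % 2 = 0 →
  (n = 2 * h → ∃ k, x.cφ h h + 2 * x.cθ h (h + 1) - 2 * x.cθ (h + 1) h = 8 * k) ∧
  (n = 2 * h + 1 → ∃ k, x.cφ h (h + 1) = 2 * k) ∧ (n = 2 * h - 1 → ∃ k, x.cθ h h = 2 * k)

theorem Vanishes.of_equiv {x y : SymStr univBundle n} (hx : x.Vanishes) (e : x.Equiv y) :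
    y.Vanishes := by
  refine fun h hh => ⟨fun hn => ?_, fun hn => ?_, fun hn => ?_⟩
  · obtain ⟨k, hk⟩ := (hx h hh).1 hn
    obtain ⟨j, hj⟩ := e.invariant_zero hn hh
    exact ⟨k + j, by linarith⟩
  · obtain ⟨k, hk⟩ := (hx h hh).2.1 hn
    obtain ⟨j, hj⟩ := e.invariant_one hn hh
    exact ⟨k + j, by linarith⟩
  · obtain ⟨k, hk⟩ := (hx h hh).2.2 hn
    obtain ⟨j, hj⟩ := e.invariant_three hn hh
    exact ⟨k + j, by linarith⟩

/-- All entries that matter have negative total degree. -/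
theorem equiv_zero_neg_two (x : SymStr univBundle (-2)) : x.Equiv 0 := by
  refine x.equiv_zero_of_low (fun p q h => ?_) fun p q h => ?_
  · rcases lt_or_ge p 0 with hp | hp
    · exact x.cφ_left hp q
    · exact x.cφ_right p (by omega)
  · rcases lt_or_ge p 0 with hp | hp
    · exact x.cθ_left hp q
    · exact x.cθ_right p (by omega)

theorem equiv_zero_neg_one (x : SymStr univBundle (-1)) (hx : x.Vanishes) : x.Equiv 0 := by
  obtain ⟨k, hk⟩ := (hx 0 rfl).2.2 rfl
  have z : FinSupp (fun _ _ => (0 : ℤ)) := ⟨0, fun _ _ _ => rfl⟩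
  -- The only entry left is θ(0,0) = 2k, and the symmetrisation in dη doubles η(0,0).
  let η (p q : ℤ) : ℤ := if p = 0 ∧ q = 0 then -k else 0
  have hη : FinSupp η := ⟨0, fun p q h => if_neg (by omega)⟩
  obtain ⟨y, e, m1, m2⟩ := x.exists_move z hη fun _ _ _ => rfl
  refine e.trans (y.equiv_zero_of_low (fun p q h => ?_) fun p q h => ?_)
  · rcases lt_or_ge p 0 with hp | hp
    · exact y.cφ_left hp q
    · exact y.cφ_right p (by omega)
  · by_cases hp : p < 0
    · exact y.cθ_left hp q
    by_cases hq : q < 0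
    · exact y.cθ_right p hq
    obtain ⟨rfl, rfl⟩ : p = 0 ∧ q = 0 := by omega
    have η0 : η 0 0 = -k := rfl
    have η1 : η 0 (0 + 1) = 0 := rfl
    have η2 : η (0 + 1) 0 = 0 := rfl
    rw [m2, hk, Dop, tHop, η0, η1, η2, sg_even (a := 0 + 0) rfl,
      sg_even (a := 0 + 0 - (-1 + 1) + 0 * 0) rfl]
    ring

set_option linter.unusedSimpArgs false in
theorem equiv_zero_zero (x : SymStr univBundle 0) (hx : x.Vanishes) : x.Equiv 0 := by
  obtain ⟨x', e', t⟩ := x.exists_equiv_triangular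
  obtain ⟨k, hk⟩ := (hx.of_equiv e' 0 rfl).1 rfl
  have e0 := x'.isCoord.eq 0 0
  simp (disch := omega) only [Tw_even, Dop_even, cc_odd, sg_even, bb_eq_one, t, zero_add,
    sub_zero] at e0 hk
  -- With this a the vanishing of the invariant mod 8 reads φ(0,0) = -2a, which the entry a of ξ at
  -- (1, 0) cancels.
  obtain ⟨a, ha⟩ : ∃ a, a = x'.cθ 0 1 - 4 * k := ⟨_, rfl⟩
  have k1 : x'.cφ 0 0 = -2 * a := by linarith
  have k2 : x'.cθ 0 1 = a + 4 * k := by linarith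
  rw [k1, k2] at e0
  have k3 : x'.cθ 0 0 = -2 * a - 2 * a ^ 2 - 4 * k := by linarith
  clear e0 hk ha
  obtain ⟨g, hg, g1, g2, g3, g4, g0⟩ := exists_four_points (p₁ := 1) (q₁ := 0) (p₂ := 0) (q₂ := 1)
      (p₃ := 1) (q₃ := 1) (p₄ := 2) (q₄ := 2) (by omega) (by omega) (by omega) (by omega)
      (by omega) (by omega) (by omega) (by omega) (by omega) (by omega) a 0 0 0
  obtain ⟨η, hη, η1, η2, η3, η4, η0⟩ := exists_four_points (p₁ := 1) (q₁ := 1) (p₂ := 0) (q₂ := 1)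
      (p₃ := 2) (q₃ := 2) (p₄ := 3) (q₄ := 3) (by omega) (by omega) (by omega) (by omega)
      (by omega) (by omega) (by omega) (by omega) (by omega) (by omega) k (a + 2 * k) 0 0
  obtain ⟨y, e, m1, m2⟩ := x'.exists_move hg hη fun p q h => by
    by_cases h' : p = 0 ∧ q = 1
    · exact g2 p q h'.1 h'.2
    · exact g0 p q (by omega) h' (by omega) (by omega)
  have hF (p q : ℤ) (hpq : p + q = 0) : y.cφ p q = 0 := by
    by_cases hp : p < 0
    · exact y.cφ_left hp q
    by_cases hq : q < 0
    · exact y.cφ_right p hq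
    obtain ⟨rfl, rfl⟩ : p = 0 ∧ q = 0 := by omega
    all_goals rw [m1]
    all_goals simp (disch := omega) only [Dop_even, Dop_odd, cc_even, cc_odd, sg_even, sg_odd, g1,
      g2, g3, g4, g0, k1, k2, k3, zero_add]
    all_goals ring
  have hΘ (p q : ℤ) (hpq : p + q ≤ 0 + 1) : y.cθ p q = 0 := by
    by_cases hp : p < 0
    · exact y.cθ_left hp q
    by_cases hq : q < 0
    · exact y.cθ_right p hq
    obtain ⟨rfl, rfl⟩ | ⟨rfl, rfl⟩ | ⟨rfl, rfl⟩ : (p = 0 ∧ q = 0) ∨ (p = 0 ∧ q = 1) ∨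
        (p = 1 ∧ q = 0) := by omega
    all_goals rw [m2]
    all_goals simp (disch := omega) only [tHop_even, Dop_even, Dop_odd, cc_even, cc_odd, sg_even,
        sg_odd,
        bb_eq_zero, bb_eq_one, g1, g2, g3, g4, g0, η1, η2, η3, η4, η0, hF, t, k1, k2, k3,
        zero_mul, mul_zero, add_zero, zero_add, sub_zero, one_mul, sub_self]
    all_goals ring
  exact (e'.trans e).trans (y.equiv_zero_of_low hF hΘ)

set_option linter.unusedSimpArgs false in
theorem equiv_zero_one (x : SymStr univBundle 1) (hx : x.Vanishes) : x.Equiv 0 := by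
  obtain ⟨x', e', t⟩ := x.exists_equiv_triangular
  obtain ⟨w, k1⟩ := (hx.of_equiv e' 0 rfl).2.1 rfl
  obtain ⟨u, hu⟩ := Int.even_mul_succ_self (x'.cθ 0 0)
  have c0 := x'.isCoord.cycle 0 0
  have e0 := x'.isCoord.eq 0 0
  have e1 := x'.isCoord.eq 1 0
  have low := x'.isCoord.low
  rw [zero_add] at k1
  simp (disch := omega) only [Tw_odd, Dop_even, Dop_odd, cc_odd, sg_even, sg_odd, bb_eq_one,
    bb_eq_zero, low, t, zero_add, sub_zero, sub_self, k1] at c0 e0 e1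
  have k2 : x'.cφ 1 0 = -2 * w := by linarith
  have k3 : x'.cθ 0 1 = 0 := by linarith
  rw [k2, k3] at e1
  have k4 : x'.cθ 1 1 = -w - 2 * w ^ 2 := by linarith
  clear e0 e1 c0
  obtain ⟨g, hg, g1, g2, g3, g4, g0⟩ := exists_four_points (p₁ := 1) (q₁ := 1) (p₂ := 2) (q₂ := 0)
      (p₃ := 0) (q₃ := 2) (p₄ := 2) (q₄ := 2) (by omega) (by omega) (by omega) (by omega)
      (by omega) (by omega) (by omega) (by omega) (by omega) (by omega) w (x'.cθ 0 0)
      (x'.cθ 0 0 - x'.cθ 0 2) 0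
  -- The entry at (1, 2) cancels the product of φ(1,0) = -2w with ξ(0,2) in the twisted homotopy at
  -- (0, 2); for n = 1 these positions interact, unlike for larger odd n.
  obtain ⟨η, hη, η1, η2, η3, η4, η0⟩ := exists_four_points (p₁ := 0) (q₁ := 2) (p₂ := 0) (q₂ := 0)
      (p₃ := 1) (q₃ := 2) (p₄ := 2) (q₄ := 2) (by omega) (by omega) (by omega) (by omega)
      (by omega) (by omega) (by omega) (by omega) (by omega) (by omega) (-x'.cθ 0 0) (-u)
      (-w * (x'.cθ 0 0 - x'.cθ 0 2)) 0
  obtain ⟨y, e, m1, m2⟩ := x'.exists_move hg hη fun p q h =>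
    g0 p q (by omega) (by omega) (by omega) (by omega)
  have hF (p q : ℤ) (hpq : p + q = 1) : y.cφ p q = 0 := by
    by_cases hp : p < 0
    · exact y.cφ_left hp q
    by_cases hq : q < 0
    · exact y.cφ_right p hq
    obtain ⟨rfl, rfl⟩ | ⟨rfl, rfl⟩ : (p = 0 ∧ q = 1) ∨ (p = 1 ∧ q = 0) := by omega
    all_goals rw [m1]
    all_goals simp (disch := omega) only [Dop_even, Dop_odd, cc_even, cc_odd, sg_even, sg_odd, g1,
      g2, g3, g4, g0, k1, k2, k3, k4, zero_add]
    all_goals ring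
  have hΘ (p q : ℤ) (hpq : p + q ≤ 1 + 1) : y.cθ p q = 0 := by
    by_cases hp : p < 0
    · exact y.cθ_left hp q
    by_cases hq : q < 0
    · exact y.cθ_right p hq
    obtain ⟨rfl, rfl⟩ | ⟨rfl, rfl⟩ | ⟨rfl, rfl⟩ | ⟨rfl, rfl⟩ | ⟨rfl, rfl⟩ | ⟨rfl, rfl⟩ :
        (p = 0 ∧ q = 0) ∨ (p = 0 ∧ q = 1) ∨ (p = 1 ∧ q = 0) ∨ (p = 1 ∧ q = 1) ∨ (p = 0 ∧ q = 2) ∨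
          (p = 2 ∧ q = 0) := by omega
    all_goals rw [m2]
    all_goals simp (disch := omega) only [tHop_odd, Dop_even, Dop_odd, cc_even, cc_odd, sg_even,
        sg_odd,
        bb_eq_zero, bb_eq_one, g1, g2, g3, g4, g0, η1, η2, η3, η4, η0, hF, t, k1, k2, k3, k4,
        zero_mul, mul_zero, add_zero, zero_add, sub_zero, one_mul, sub_self]
    all_goals first
      | linear_combination (0 : ℤ) * hu
      | linear_combination (1 : ℤ) * hu
  exact (e'.trans e).trans (y.equiv_zero_of_low hF hΘ)

/-- Descent from n to n - 4, with m a natural number bounding n + 2. The negative dimensions -2 and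
-1 are included because n = 2 and n = 3 descend to them. -/
theorem equiv_zero_of_vanishes (m : ℕ) {n : ℤ} (hm : n + 2 ≤ m) (hn : -2 ≤ n)
    (x : SymStr univBundle n) (hx : x.Vanishes) : x.Equiv 0 := by
  induction m using Nat.strong_induction_on generalizing n with
  | _ m ih =>
    rcases lt_or_ge n 2 with h | h
    · obtain rfl | rfl | rfl | rfl : n = -2 ∨ n = -1 ∨ n = 0 ∨ n = 1 := by omega
      · exact x.equiv_zero_neg_two
      · exact x.equiv_zero_neg_one hx
      · exact x.equiv_zero_zero hx
      · exact x.equiv_zero_one hx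
    · have : ∃ y : SymStr univBundle n, x.Equiv y ∧ (∀ p q, p ≤ 1 ∨ q ≤ 1 → y.cφ p q = 0) ∧
          ∀ p q, p ≤ 1 ∨ q ≤ 1 → y.cθ p q = 0 := by
        rcases Int.emod_two_eq_zero_or_one n with h' | h'
        · exact x.reduce_even h' h
        · exact x.reduce_odd h' (by omega)
      obtain ⟨y, e, h1, h2⟩ := this
      have hy := hx.of_equiv e
      obtain ⟨z, z1, z2, hz⟩ := y.exists_desuspension h1 h2
      refine e.trans (hz (ih (m - 4) (by omega) (by omega) (by omega) z fun h hh => ?_))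
      -- The invariant of the desuspension at h is the invariant of y at h + 2.
      have := hy (h + 2) (by omega)
      rw [z1, z1, z2, z2, z2, add_right_comm h 1 2]
      exact ⟨fun k => this.1 (by omega), fun k => this.2.1 (by omega),
        fun k => this.2.2 (by omega)⟩

end SymStr

/-! ### The twisted quadratic groups of the universal bundle -/

theorem exists_point {a b : ℤ} (ha : 0 ≤ a) (hb : 0 ≤ b) (c : ℤ) : ∃ g : ℤ → ℤ → ℤ, FinSupp g ∧
    (∀ p q, p = a → q = b → g p q = c) ∧ ∀ p q, ¬(p = a ∧ q = b) → g p q = 0 :=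
  ⟨fun p q => if p = a ∧ q = b then c else 0, ⟨a + b, fun _ _ _ => if_neg (by omega)⟩,
    fun _ _ h h' => if_pos ⟨h, h'⟩, fun _ _ h => if_neg h⟩

theorem finSupp_zero : FinSupp fun _ _ => 0 := ⟨0, fun _ _ _ => rfl⟩

namespace SymStr

/-- The form of rank one with value 1 in the middle dimension: its twist is 1² = 1, so θ = 0 will
do. -/
theorem exists_generator_zero {n h : ℤ} (hn : n = 2 * h) (hh : h % 2 = 0) (h0 : 0 ≤ h) :
    ∃ x : SymStr univBundle n, x.cφ h h + 2 * x.cθ h (h + 1) - 2 * x.cθ (h + 1) h = 1 := by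
  subst hn
  obtain ⟨F, hF, F1, F0⟩ := exists_point h0 h0 1
  have D0 (p q : ℤ) : Dop (2 * h) (fun _ _ => 0) p q = 0 := by
    simp only [Dop, mul_zero, add_zero]
  have key : IsCoord (2 * h) F fun _ _ => 0 :=
    { finF := hF
      finΘ := finSupp_zero
      low := fun p q k => F0 p q (by omega)
      cycle := fun p q => by
        obtain hp | hp | hp : p = h ∨ p = h - 1 ∨ (p ≠ h ∧ p ≠ h - 1) := by omega
        · by_cases hq : q = h
          · obtain rfl : p = q := by omega
            simp (disch := omega) only [Dop_even, F1, F0, sg_even, sg_odd]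
            norm_num
          · by_cases hq' : q = h - 1
            · simp (disch := omega) only [Dop_even, F0, cc_even, mul_zero, zero_mul, add_zero]
            · simp (disch := omega) only [Dop_even, F0, mul_zero, add_zero]
        · simp (disch := omega) only [Dop_odd, F0, mul_zero, sub_zero]
        · simp (disch := omega) only [Dop, F0, mul_zero, add_zero]
      eq := fun p q => by
        rw [D0]
        by_cases hp : p = h
        · by_cases hq : q = h
          · simp (disch := omega) only [Tw_even, bb_eq_one, F1]
            norm_num
          · simp (disch := omega) only [Tw_even, F0, mul_zero, sub_zero]
        · simp (disch := omega) only [Tw_even, F0, mul_zero, zero_mul, sub_zero] }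
  obtain ⟨x, hx, hx'⟩ := exists_of_isCoord key
  refine ⟨x, ?_⟩
  rw [hx, hx', F1 h h rfl rfl]
  norm_num

/-- A single entry of θ at (h, h), with φ = 0, is a cycle: the transposed term has sign -1 as n is
odd, and the differentials out of degree h vanish. -/
theorem exists_generator_three {n h : ℤ} (hn : n = 2 * h - 1) (hh : h % 2 = 0) (h0 : 0 ≤ h) :
    ∃ x : SymStr univBundle n, x.cθ h h = 1 := by
  subst hn
  obtain ⟨T, hT, T1, T0⟩ := exists_point h0 h0 1
  have key : IsCoord (2 * h - 1) (fun _ _ => 0) T :=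
    { finF := finSupp_zero
      finΘ := hT
      low := fun _ _ _ => rfl
      cycle := fun p q => by simp only [Dop, mul_zero, add_zero]
      eq := fun p q => by
        rw [Tw, mul_zero, mul_zero, mul_zero, sub_zero]
        symm
        obtain hp | hp | hp : p = h ∨ p = h - 1 ∨ (p ≠ h ∧ p ≠ h - 1) := by omega
        · by_cases hq : q = h
          · obtain rfl : p = q := by omega
            simp (disch := omega) only [Dop_even, T1, T0, sg_even, sg_odd]
            norm_num
          · by_cases hq' : q = h - 1
            · simp (disch := omega) only [Dop_even, T0, cc_even, mul_zero, zero_mul, add_zero]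
            · simp (disch := omega) only [Dop_even, T0, mul_zero, add_zero]
        · simp (disch := omega) only [Dop_odd, T0, mul_zero, sub_zero]
        · simp (disch := omega) only [Dop, T0, mul_zero, add_zero] }
  obtain ⟨x, -, hx⟩ := exists_of_isCoord key
  exact ⟨x, by rw [hx, T1 h h rfl rfl]⟩

-- The value 1 at (h, h+1) forces the rest: the cycle condition at (h, h) gives φ(h+1,h) = -1, at
-- (h, h+1) it gives φ(h+1,h+1) = -1, and the structure equation at (h, h+1) gives θ(h+1,h+1) = -1.
set_option linter.unusedSimpArgs false in
theorem exists_generator_one {n h : ℤ} (hn : n = 2 * h + 1) (hh : h % 2 = 0) (h0 : 0 ≤ h) :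
    ∃ x : SymStr univBundle n, x.cφ h (h + 1) = 1 := by
  subst hn
  obtain ⟨F, hF, F1, F2, F3, F4, F0⟩ := exists_four_points (p₁ := h) (q₁ := h + 1)
    (p₂ := h + 1) (q₂ := h) (p₃ := h + 1) (q₃ := h + 1) (p₄ := h) (q₄ := h) (by omega) (by omega)
    (by omega) (by omega) (by omega) (by omega) (by omega) (by omega) (by omega) (by omega)
    1 (-1) (-1) 0
  obtain ⟨T, hT, T1, T0⟩ := exists_point (a := h + 1) (b := h + 1) (by omega) (by omega) (-1)
  have F5 (p q : ℤ) (h1 : ¬(h ≤ p ∧ p ≤ h + 1)) : F p q = 0 :=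
    F0 p q (by omega) (by omega) (by omega) (by omega)
  have F6 (p q : ℤ) (h1 : ¬(h ≤ q ∧ q ≤ h + 1)) : F p q = 0 :=
    F0 p q (by omega) (by omega) (by omega) (by omega)
  have key : IsCoord (2 * h + 1) F T :=
    { finF := hF
      finΘ := hT
      low := fun p q k => by
        by_cases k' : p = h ∧ q = h
        · exact F4 p q k'.1 k'.2
        · exact F0 p q (by omega) (by omega) (by omega) k'
      cycle := fun p q => by
        obtain hp | hp | hp | hp : p = h ∨ p = h + 1 ∨ p = h - 1 ∨ ¬(h - 1 ≤ p ∧ p ≤ h + 1) := by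
          omega
        all_goals obtain hq | hq | hq | hq :
          q = h ∨ q = h + 1 ∨ q = h - 1 ∨ ¬(h - 1 ≤ q ∧ q ≤ h + 1) := by omega
        all_goals first
          | simp (disch := omega) only [Dop_even, Dop_odd, F1, F2, F3, F4, F5, F6, sg_even,
              sg_odd, cc_even, cc_odd, mul_zero, zero_mul, add_zero, sub_zero]
            done
          | simp (disch := omega) only [Dop_even, Dop_odd, F1, F2, F3, F4, F5, F6, sg_even,
              sg_odd, cc_even, cc_odd]
            norm_num
          | simp (disch := omega) only [Dop, F5, F6, mul_zero, add_zero]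
      eq := fun p q => by
        obtain hp | hp | hp | hp : p = h ∨ p = h + 1 ∨ p = h - 1 ∨ ¬(h - 1 ≤ p ∧ p ≤ h + 1) := by
          omega
        all_goals obtain hq | hq | hq | hq :
          q = h ∨ q = h + 1 ∨ q = h - 1 ∨ ¬(h - 1 ≤ q ∧ q ≤ h + 1) := by omega
        all_goals first
          | simp (disch := omega) only [Tw_odd, Dop_even, Dop_odd, F1, F2, F3, F4, F5, F6, T1, T0,
              sg_even, sg_odd, cc_even, cc_odd, bb_eq_zero, bb_eq_one, mul_zero, zero_mul,
              add_zero, sub_zero]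
            done
          | simp (disch := omega) only [Tw_odd, Dop_even, Dop_odd, F1, F2, F3, F4, F5, F6, T1, T0,
              sg_even, sg_odd, cc_even, cc_odd, bb_eq_zero, bb_eq_one]
            norm_num
            done
          | simp (disch := omega) only [Tw_odd, Dop, F5, F6, T0, mul_zero, zero_mul, add_zero,
              sub_zero] }
  obtain ⟨x, hx, -⟩ := exists_of_isCoord key
  exact ⟨x, by rw [hx, F1 h (h + 1) rfl rfl]⟩

variable {n : ℤ}

theorem equiv_of_add_neg {x y : SymStr univBundle n} (h : (x + -y).Equiv 0) : x.Equiv y := by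
  have e := h.add (Equiv.refl y)
  rwa [add_assoc', neg_add_cancel', add_zero', zero_add'] at e

/-- An additive invariant of equivalence which detects the zero class and is onto computes the
twisted quadratic group. -/
theorem nonempty_addEquiv {A : Type} [AddCommGroup A] (K : SymStr univBundle n → A)
    (hadd : ∀ x y, K (x + y) = K x + K y) (hK : ∀ x y, x.Equiv y → K x = K y)
    (hzero : ∀ x, K x = 0 → x.Equiv 0) (hsurj : Function.Surjective K) :
    Nonempty (TwistedQ univBundle n ≃+ A) := by
  let f : TwistedQ univBundle n → A := fun a => Quotient.liftOn' a K fun x y h =>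
    hK x y (mk_eq_iff.1 (Quotient.sound' h))
  have hf (a b : TwistedQ univBundle n) : f (a + b) = f a + f b := by
    induction a using AddCon.induction_on with | H x
    induction b using AddCon.induction_on with | H y
    exact hadd x y
  refine ⟨AddEquiv.ofBijective (AddHom.mk f hf) ⟨?_, fun a => ?_⟩⟩
  · intro a b
    induction a using AddCon.induction_on with | H x
    induction b using AddCon.induction_on with | H y
    intro (h : K x = K y)
    have k0 : K (-y + y) = K (-y) + K y := hadd _ _
    have k1 : K (0 + 0) = K 0 + K 0 := hadd 0 0
    rw [add_zero', left_eq_add] at k1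
    rw [neg_add_cancel', k1] at k0
    -- Injectivity reduces to the zero class since structures have strict negatives; their sum need
    -- not be strictly commutative.
    refine mk_eq_iff.2 (equiv_of_add_neg (hzero _ ?_))
    rw [hadd, h, add_comm, ← k0]
  · obtain ⟨x, hx⟩ := hsurj a
    exact ⟨TwistedQ.mk x, hx⟩

theorem surjective_of_one {m : ℕ} [NeZero m] {K : SymStr univBundle n → ZMod m}
    (hadd : ∀ x y, K (x + y) = K x + K y) {x : SymStr univBundle n} (hx : K x = 1) :
    Function.Surjective K := by
  have k1 : K (0 + 0) = K 0 + K 0 := hadd 0 0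
  rw [add_zero', left_eq_add] at k1
  have hk (k : ℕ) : ∃ y, K y = k := by
    induction k with
    | zero => exact ⟨0, by rw [k1, Nat.cast_zero]⟩
    | succ k ih =>
      obtain ⟨y, hy⟩ := ih
      exact ⟨y + x, by rw [hadd, hy, hx, Nat.cast_succ]⟩
  intro a
  obtain ⟨y, hy⟩ := hk a.val
  exact ⟨y, by rw [hy, ZMod.natCast_zmod_val]⟩

theorem equiv_zero_of_nonneg (hn : 0 ≤ n) (x : SymStr univBundle n) (hx : x.Vanishes) :
    x.Equiv 0 :=
  x.equiv_zero_of_vanishes (n + 2).toNat (by omega) (by omega) hx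

theorem nonempty_addEquiv_zero {h : ℤ} (hn : n = 2 * h) (hh : h % 2 = 0) (h0 : 0 ≤ h) :
    Nonempty (TwistedQ univBundle n ≃+ ZMod 8) := by
  let K (x : SymStr univBundle n) : ZMod 8 :=
    (x.cφ h h + 2 * x.cθ h (h + 1) - 2 * x.cθ (h + 1) h : ℤ)
  have hadd (x y : SymStr univBundle n) : K (x + y) = K x + K y := by
    -- The brackets at (h, h+1) and (h+1, h) carry the coefficients `bb h (h-1)` and `bb (h-1) h`,
    -- which vanish for h even.
    simp (disch := omega) only [K, cφ_add, cθ_add, bb_eq_zero, zero_mul, mul_zero, sub_zero]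
    push_cast
    ring
  obtain ⟨x₀, hx₀⟩ := exists_generator_zero hn hh h0
  refine nonempty_addEquiv K hadd (fun x y e => ?_) (fun x hx => ?_)
    (surjective_of_one hadd (x := x₀) (by simp only [K, hx₀, Int.cast_one]))
  · obtain ⟨k, hk⟩ := e.invariant_zero hn hh
    exact (ZMod.intCast_eq_intCast_iff_dvd_sub _ _ 8).2 ⟨k, hk⟩
  · obtain ⟨k, hk⟩ := (ZMod.intCast_zmod_eq_zero_iff_dvd _ 8).1 hx
    refine x.equiv_zero_of_nonneg (by omega) fun h' hh' =>
      ⟨fun e => ?_, fun e => by omega, fun e => by omega⟩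
    obtain rfl : h' = h := by omega
    exact ⟨k, hk⟩

theorem nonempty_addEquiv_one {h : ℤ} (hn : n = 2 * h + 1) (hh : h % 2 = 0) (h0 : 0 ≤ h) :
    Nonempty (TwistedQ univBundle n ≃+ ZMod 2) := by
  let K (x : SymStr univBundle n) : ZMod 2 := (x.cφ h (h + 1) : ℤ)
  have hadd (x y : SymStr univBundle n) : K (x + y) = K x + K y := by
    simp only [K, cφ_add, Int.cast_add]
  obtain ⟨x₀, hx₀⟩ := exists_generator_one hn hh h0
  refine nonempty_addEquiv K hadd (fun x y e => ?_) (fun x hx => ?_)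
    (surjective_of_one hadd (x := x₀) (by simp only [K, hx₀, Int.cast_one]))
  · obtain ⟨k, hk⟩ := e.invariant_one hn hh
    exact (ZMod.intCast_eq_intCast_iff_dvd_sub _ _ 2).2 ⟨k, hk⟩
  · obtain ⟨k, hk⟩ := (ZMod.intCast_zmod_eq_zero_iff_dvd _ 2).1 hx
    refine x.equiv_zero_of_nonneg (by omega) fun h' hh' =>
      ⟨fun e => by omega, fun e => ?_, fun e => by omega⟩
    obtain rfl : h' = h := by omega
    exact ⟨k, hk⟩

theorem nonempty_addEquiv_three {h : ℤ} (hn : n = 2 * h - 1) (hh : h % 2 = 0) (h0 : 0 < h) :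
    Nonempty (TwistedQ univBundle n ≃+ ZMod 2) := by
  let K (x : SymStr univBundle n) : ZMod 2 := (x.cθ h h : ℤ)
  have hadd (x y : SymStr univBundle n) : K (x + y) = K x + K y := by
    -- The bracket at (h, h) carries the coefficient `bb (h-1) (h-1)`, which vanishes since h - 1 is
    -- odd.
    simp (disch := omega) only [K, cθ_add, bb_eq_zero, zero_mul, mul_zero, sub_zero, Int.cast_add]
  obtain ⟨x₀, hx₀⟩ := exists_generator_three hn hh h0.le
  refine nonempty_addEquiv K hadd (fun x y e => ?_) (fun x hx => ?_)
    (surjective_of_one hadd (x := x₀) (by simp only [K, hx₀, Int.cast_one]))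
  · obtain ⟨k, hk⟩ := e.invariant_three hn hh
    exact (ZMod.intCast_eq_intCast_iff_dvd_sub _ _ 2).2 ⟨k, hk⟩
  · obtain ⟨k, hk⟩ := (ZMod.intCast_zmod_eq_zero_iff_dvd _ 2).1 hx
    refine x.equiv_zero_of_nonneg (by omega) fun h' hh' =>
      ⟨fun e => by omega, fun e => by omega, fun e => ?_⟩
    obtain rfl : h' = h := by omega
    exact ⟨k, hk⟩

theorem nonempty_addEquiv_two (hn : n % 4 = 2) (h0 : 0 ≤ n) :
    Nonempty (TwistedQ univBundle n ≃+ PUnit.{1}) :=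
  nonempty_addEquiv (fun _ => PUnit.unit) (fun _ _ => rfl) (fun _ _ _ => rfl)
    (fun x _ => x.equiv_zero_of_nonneg h0 fun h' hh' =>
      ⟨fun e => by omega, fun e => by omega, fun e => by omega⟩) fun _ => ⟨0, rfl⟩

end SymStr

end ChainBundles

theorem mainTheorem10 (n : ℕ) :
    ChainBundles.univBundle.IsUniversal ∧
    (∀ x y : ChainBundles.SymStr ChainBundles.univBundle n,
      (ChainBundles.TwistedQ.mk x = ChainBundles.TwistedQ.mk y ↔
        ChainBundles.SymStr.Equiv x y)) ∧
    (∀ x y : ChainBundles.NormalCx ChainBundles.univBundle n,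
      (ChainBundles.LHat.mk x = ChainBundles.LHat.mk y ↔
        ChainBundles.NormalCx.Cobordant x y)) ∧
    (∃ e : ChainBundles.LHat ChainBundles.univBundle n ≃+
        ChainBundles.TwistedQ ChainBundles.univBundle n,
      ∀ x : ChainBundles.NormalCx ChainBundles.univBundle n,
        e (ChainBundles.LHat.mk x) = x.char) ∧
    (n % 4 = 0 → Nonempty (ChainBundles.TwistedQ ChainBundles.univBundle n ≃+ ZMod 8)) ∧
    (n % 4 = 1 ∨ n % 4 = 3 →
      Nonempty (ChainBundles.TwistedQ ChainBundles.univBundle n ≃+ ZMod 2)) ∧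
    (n % 4 = 2 →
      Nonempty (ChainBundles.TwistedQ ChainBundles.univBundle n ≃+ PUnit.{1})) := by
  have hB := ChainBundles.univ_finite_projective
  have h0 : ∀ p < 0, Subsingleton (ChainBundles.univCx.X p) :=
    fun _ hp => ChainBundles.univ_subsingleton hp
  have hn : (0 : ℤ) ≤ n := n.cast_nonneg
  refine ⟨ChainBundles.univBundle_isUniversal, fun x y => ChainBundles.SymStr.mk_eq_iff,
    fun x y => ChainBundles.NormalCx.mk_eq_iff hB h0 hn,
    ChainBundles.NormalCx.exists_addEquiv hB h0 hn, fun h => ?_, fun h => ?_, fun h => ?_⟩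
  · exact ChainBundles.SymStr.nonempty_addEquiv_zero (h := n / 2) (by omega) (by omega) (by omega)
  · rcases h with h | h
    · exact ChainBundles.SymStr.nonempty_addEquiv_one (h := n / 2) (by omega) (by omega) (by omega)
    -- For n ≡ 3 mod 4 the quotient n / 2 is odd; the even h with n = 2h - 1 is the next integer.
    · exact ChainBundles.SymStr.nonempty_addEquiv_three (h := n / 2 + 1) (by omega) (by omega)
        (by omega)
  · exact ChainBundles.SymStr.nonempty_addEquiv_two (by omega) hn
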